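/- Conventions. Let $n\ge 1$. A weight is an (a.e.) positive, locally integrable function on $\mathbb R^n$; $B(y,r)$ is the open ball, $\lambda B$ is the ball with the same centre as $B$ and $\lambda$ times its radius, $w(E)=\int_E w\,dx$, and $\|f\|_{L^p_w}=(\int|f|^pw\,dx)^{1/p}$. For $1<p<\infty$ and $p'=p/(p-1)$, $w\in A_p$ means that $w$ is a weight and there is $C<\infty$ with $\big(\frac1{|B|}\int_B w\big)^{1/p}\big(\frac1{|B|}\int_B w^{-p'/p}\big)^{1/p'}\le C$ for all balls $B$; $\mu\in\Delta_2$ means that $\mu$ is a weight and there is $C<\infty$ with $\mu(2B)\le C\mu(B)$ for all balls $B$. The space $(L^p,L^q)^\alpha(w;\mu)$ consists of the locally integrable functions $f:\mathbb R^n\to\mathbb C$ with $$\|f\|_{(L^p,L^q)^\alpha(w;\mu)}:=\sup_{r>0}\Big\|\,w(B(y,r))^{1/\alpha-1/p-1/q}\,\big\|f\chi_{B(y,r)}\big\|_{L^p_w}\Big\|_{L^q_\mu(dy)}<\infty$$ (for $q=\infty$, $1/q=0$ and the outer norm is the essential supremum). Let $\theta$ be a non-negative, non-decreasing function on $(0,\infty)$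 with $\int_0^1\theta(t)\,\frac{dt}{t}<\infty$. A linear operator $T_\theta:\mathscr S(\mathbb R^n)\to\mathscr S'(\mathbb R^n)$ is a $\theta$-type Calderón–Zygmund operator if it extends to a bounded linear operator on $L^2(\mathbb R^n)$ and there is a measurable $K$, defined off the diagonal of $\mathbb R^n\times\mathbb R^n$, and a constant $C$ with $|K(x,y)|\le C|x-y|^{-n}$ for $x\ne y$, with $$|K(x,y)-K(z,y)|+|K(y,x)-K(y,z)|\le \frac{C}{|x-y|^{n}}\,\theta\Big(\frac{|x-z|}{|x-y|}\Big)\quad\text{for } 0<|x-z|<|x-y|/2,$$ and with $T_\theta f(x)=\int K(x,y)f(y)\,dy$ for all $f\in C_0^\infty(\mathbb R^n)$ and a.e. $x\notin\operatorname{supp}f$. For $f\in(L^p,L^q)^\alpha(w;\mu)$, $T_\theta f$ denotes a function $g$ such that for every ball $B$ $$g(x)=T_\theta(f\chi_{2B})(x)+\int_{(2B)^c}K(x,z)f(z)\,dz\qquad\text{for a.e. }x\in B,$$ where the integral converges absolutely and $T_\theta(f\chi_{2B})$ is the value at $f\chi_{2B}\in L^p_w$ of the extension of $T_\theta$ by continuity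 from $C_0^\infty(\mathbb R^n)$ to $L^p_w$ (that is, the $L^p_w$-limit of $T_\theta\varphi_k$ for some $\varphi_k\in C_0^\infty(\mathbb R^n)$ with $\varphi_k\to f\chi_{2B}$ in $L^p_w$). **Theorem.** Let $1<p\le\alpha<q\le\infty$, $w\in A_p$ and $\mu\in\Delta_2$, and let $T_\theta$ be a $\theta$-type Calderón–Zygmund operator. Then $T_\theta$ is bounded on $(L^p,L^q)^\alpha(w;\mu)$. That is: for every $f\in(L^p,L^q)^\alpha(w;\mu)$ the function $T_\theta f$ exists and is unique up to null sets, $f\mapsto T_\theta f$ is linear and agrees with the $L^2$-extension of $T_\theta$ when $f\in L^2(\mathbb R^n)$, and there is a constant $C<\infty$ independent of $f$ with $$\|T_\theta f\|_{(L^p,L^q)^\alpha(w;\mu)}\le C\,\|f\|_{(L^p,L^q)^\alpha(w;\mu)}.$$ -/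

import Mathlib

open MeasureTheory Set Filter Metric
open scoped ENNReal NNReal Topology SchwartzMap

noncomputable section

/-- The Euclidean space `ℝⁿ`. -/
abbrev RSpace (n : ℕ) : Type := EuclideanSpace ℝ (Fin n)

/-! ### Weights -/

/-- A weight: a locally integrable function which is positive almost everywhere. -/
structure IsWeight {n : ℕ} (w : RSpace n → ℝ) : Prop where
  locallyIntegrable : LocallyIntegrable w volume
  pos : ∀ᵐ x ∂(volume : Measure (RSpace n)), 0 < w x

/-- The measure `w(x) dx`; thus `w(B) = weightMeasure w B`. -/
def weightMeasure {n : ℕ} (w : RSpace n → ℝ) : Measure (RSpace n) :=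
  volume.withDensity fun x => ENNReal.ofReal (w x)

/-- The Muckenhoupt class `A_p`, `1 < p < ∞`: there is a finite `C` such that, with
`p' = p / (p - 1)`,
`(|B|⁻¹ ∫_B w)^(1/p) * (|B|⁻¹ ∫_B w^(-p'/p))^(1/p') ≤ C` for all balls `B`.
The integrals are `[0, ∞]`-valued, so the bound includes their finiteness. -/
structure IsMuckenhouptAp {n : ℕ} (p : ℝ) (w : RSpace n → ℝ) : Prop where
  isWeight : IsWeight w
  bound : ∃ C : ℝ≥0, ∀ (y : RSpace n) (r : ℝ), 0 < r →
    ((volume (ball y r))⁻¹ * ∫⁻ x in ball y r, ENNReal.ofReal (w x)) ^ (1 / p) *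
      ((volume (ball y r))⁻¹ *
        ∫⁻ x in ball y r, ENNReal.ofReal (w x) ^ (-(p / (p - 1)) / p)) ^ (1 / (p / (p - 1)))
      ≤ C

/-- The class `Δ₂` of doubling weights: `μ(2B) ≤ C μ(B)` for all balls `B`. -/
structure IsDoublingWeight {n : ℕ} (μ : RSpace n → ℝ) : Prop where
  isWeight : IsWeight μ
  bound : ∃ C : ℝ≥0, ∀ (y : RSpace n) (r : ℝ), 0 < r →
    weightMeasure μ (ball y (2 * r)) ≤ C * weightMeasure μ (ball y r)

/-! ### Weighted amalgam spaces -/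

/-- The norm of `(L^p, L^q)^α(w; μ)`, with values in `[0, ∞]`:
`sup_{r > 0} ‖ y ↦ w(B(y,r))^(1/α - 1/p - 1/q) ‖f χ_{B(y,r)}‖_{L^p(w)} ‖_{L^q(μ)}`.
For `q = ∞` one has `1/q = 0`, and the outer norm is the essential supremum. -/
def amalgamNorm {n : ℕ} (p α : ℝ) (q : ℝ≥0∞) (w μ : RSpace n → ℝ) (f : RSpace n → ℂ) : ℝ≥0∞ :=
  ⨆ (r : ℝ) (_ : 0 < r),
    eLpNorm
      (fun y : RSpace n =>
        weightMeasure w (ball y r) ^ (1 / α - 1 / p - (q⁻¹).toReal) *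
          eLpNorm ((ball y r).indicator f) (ENNReal.ofReal p) (weightMeasure w))
      q (weightMeasure μ)

/-- Membership in the weighted amalgam space `(L^p, L^q)^α(w; μ)`. -/
structure MemAmalgam {n : ℕ} (p α : ℝ) (q : ℝ≥0∞) (w μ : RSpace n → ℝ) (f : RSpace n → ℂ) :
    Prop where
  locallyIntegrable : LocallyIntegrable f volume
  norm_lt_top : amalgamNorm p α q w μ f < ∞

/-! ### `θ`-type Calderón–Zygmund operators -/

/-- A modulus `θ` on `(0, ∞)`: non-negative, non-decreasing and with `∫₀¹ θ(t)/t dt < ∞`. -/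
structure IsDiniModulus (θ : ℝ → ℝ) : Prop where
  nonneg : ∀ t, 0 < t → 0 ≤ θ t
  monotone : MonotoneOn θ (Ioi 0)
  dini : IntegrableOn (fun t => θ t / t) (Ioo 0 1) volume

/-- A `θ`-type kernel on `ℝⁿ × ℝⁿ` minus the diagonal. In the regularity condition the case
`x = z`, in which the left-hand side is zero, is left out because `θ` lives on `(0, ∞)` only. -/
structure IsThetaKernel {n : ℕ} (θ : ℝ → ℝ) (K : RSpace n → RSpace n → ℂ) : Prop where
  measurable : Measurable fun z : {z : RSpace n × RSpace n // z.1 ≠ z.2} => K z.1.1 z.1.2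
  bounds : ∃ C : ℝ,
    (∀ x y : RSpace n, x ≠ y → ‖K x y‖ ≤ C / ‖x - y‖ ^ n) ∧
    (∀ x y z : RSpace n, x ≠ z → ‖x - z‖ < ‖x - y‖ / 2 →
      ‖K x y - K z y‖ + ‖K y x - K y z‖ ≤ C / ‖x - y‖ ^ n * θ (‖x - z‖ / ‖x - y‖))

/-- The linear operator `T : 𝓢 → 𝓢'` is a `θ`-type Calderón–Zygmund operator with (bounded)
`L²`-extension `T₂` and kernel `K`. The functions in `C₀^∞` are the compactly supported Schwartz
functions. -/
structure IsThetaCZO {n : ℕ} (θ : ℝ → ℝ) (T : 𝓢(RSpace n, ℂ) →ₗ[ℂ] 𝓢'(RSpace n, ℂ))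
    (T₂ : Lp ℂ 2 (volume : Measure (RSpace n)) →L[ℂ] Lp ℂ 2 (volume : Measure (RSpace n)))
    (K : RSpace n → RSpace n → ℂ) : Prop where
  extends_T : ∀ φ : 𝓢(RSpace n, ℂ), T φ = Lp.toTemperedDistribution (T₂ (φ.toLp 2 volume))
  isThetaKernel : IsThetaKernel θ K
  repr : ∀ φ : 𝓢(RSpace n, ℂ), HasCompactSupport φ →
    ∀ᵐ x ∂(volume : Measure (RSpace n)), x ∉ tsupport φ →
      T₂ (φ.toLp 2 volume) x = ∫ y, K x y * φ y

/-! ### The action of the operator on weighted spaces -/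

/-- `g` is the value at `h ∈ L^p(w)` of the operator extended from `C₀^∞` to `L^p(w)` by
continuity: there are `φ_k ∈ C₀^∞` with `φ_k → h` and `T φ_k → g` in `L^p(w)`. -/
structure IsWeightedLpValue {n : ℕ}
    (T₂ : Lp ℂ 2 (volume : Measure (RSpace n)) →L[ℂ] Lp ℂ 2 (volume : Measure (RSpace n)))
    (p : ℝ) (w : RSpace n → ℝ) (h g : RSpace n → ℂ) : Prop where
  memLp_left : MemLp h (ENNReal.ofReal p) (weightMeasure w)
  memLp_right : MemLp g (ENNReal.ofReal p) (weightMeasure w)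
  approx : ∃ φ : ℕ → 𝓢(RSpace n, ℂ), (∀ k, HasCompactSupport (φ k)) ∧
    Tendsto (fun k => eLpNorm (fun x => φ k x - h x) (ENNReal.ofReal p) (weightMeasure w))
      atTop (𝓝 0) ∧
    Tendsto (fun k => eLpNorm (fun x => T₂ ((φ k).toLp 2 volume) x - g x)
      (ENNReal.ofReal p) (weightMeasure w)) atTop (𝓝 0)

/-- `g = T f` for a function `f` that is only locally in `L^p(w)`: for every ball `B = B(y, r)`
and almost every `x ∈ B`,
`g(x) = T(f χ_{2B})(x) + ∫_{(2B)ᶜ} K(x, z) f(z) dz`,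
where the first term is the `L^p(w)`-extension of the operator and the integral converges
absolutely. -/
def IsLocalValue {n : ℕ}
    (T₂ : Lp ℂ 2 (volume : Measure (RSpace n)) →L[ℂ] Lp ℂ 2 (volume : Measure (RSpace n)))
    (K : RSpace n → RSpace n → ℂ) (p : ℝ) (w : RSpace n → ℝ) (f g : RSpace n → ℂ) : Prop :=
  ∀ (y : RSpace n) (r : ℝ), 0 < r →
    ∃ g₁ : RSpace n → ℂ, IsWeightedLpValue T₂ p w ((ball y (2 * r)).indicator f) g₁ ∧
      ∀ᵐ x ∂(volume.restrict (ball y r)),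
        IntegrableOn (fun z => K x z * f z) (ball y (2 * r))ᶜ volume ∧
        g x = g₁ x + ∫ z in (ball y (2 * r))ᶜ, K x z * f z

end

/-! Put s = 1/α - 1/p - 1/q. From p ≤ α one gets s ≤ 0, and from α < q one gets s + 1/p = 1/α - 1/q
> 0. The proof combines the bound of T on L^p(w) with the geometric growth of w(2^k B) in k.

Fix a ball B = B(y, r). The part f χ_{2B} is handled by the L^p(w) bound. On B the remaining kernel
integral is at most a constant times the tail ∫_{(2B)ᶜ} |z - y|^(-n) |f(z)| dz. Cut into dyadic
annuli, with Hölder and the A_p condition on each, this tail is at most a multiple of ∑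
w(2^(k+2)B)^(-1/p) ‖f χ_{2^(k+2)B}‖_{L^p(w)}. After multiplication by w(B)^(s + 1/p), reverse
doubling of w turns the k-th term into c^k, c < 1, times the function of y that defines the amalgam
norm at radius 2^(k+2) r (`exists_tail_le_section`). Minkowski's inequality in L^q(μ) sums the
series, since each radius contributes at most the amalgam norm of f (`eLpNorm_tsum_mul_le`,
`exists_amalgamNorm_le`).

The L^p(w) bound (`exists_eLpNorm_l2Apply_le`) is proved by sparse domination. A Calderón–Zygmund
decomposition gives the weak type (1,1) bound (`weak_type`). With the weak type bound of the maximal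
function and the Dini regularity of the kernel it yields one step of a stopping-time construction
(`exists_sparse_step`): off a family of subcubes of total measure at most |Q|/2, T(f χ_{Q*}) is
controlled by the mean of |f| over the enlarged ball Q*; on a selected subcube P it is controlled by
two such means and T(f χ_{P*}). Iteration dominates T f by a sum of means over a sparse family. The
resulting bilinear form is bounded by Hölder's inequality and the maximal operators of w dx and of
the dual measure σ, both doubling by A_p (`exists_sparse_form_le`). No duality theorem is needed:
the form is tested against a truncated power of |T f| itself.

To give T f a meaning, T is extended to L^p(w) by density, and the kernel formula is extended to
functions in L^p(w) with bounded support (`weightedValue_eq_integral`). Passing from one ball to a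
larger one then only moves a piece of f between the two terms of the local formula
(`localValue_eq`), so the local values glue together. -/

section

/-! ### The maximal operator of a doubling measure -/

/-- A measure which is finite and positive on balls, and doubling (with dilation factor `5`). -/
structure IsBallDoubling {n : ℕ} (ν : Measure (RSpace n)) (D : ℝ≥0) : Prop where
  pos : ∀ c r, 0 < r → ν (ball c r) ≠ 0
  finite : ∀ c r, ν (ball c r) ≠ ∞
  doubling : ∀ c r, 0 < r → ν (ball c (5 * r)) ≤ D * ν (ball c r)

/-- The uncentred maximal function over balls with respect to the measure `ν`. -/
noncomputable def ballMaximal {n : ℕ} (ν : Measure (RSpace n)) (f : RSpace n → ℝ≥0∞)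
    (x : RSpace n) : ℝ≥0∞ :=
  ⨆ (c : RSpace n) (r : ℝ) (_ : x ∈ ball c r), (ν (ball c r))⁻¹ * ∫⁻ y in ball c r, f y ∂ν

theorem le_ballMaximal {n : ℕ} (ν : Measure (RSpace n)) (f : RSpace n → ℝ≥0∞) {x c : RSpace n}
    {r : ℝ} (hx : x ∈ ball c r) :
    (ν (ball c r))⁻¹ * ∫⁻ y in ball c r, f y ∂ν ≤ ballMaximal ν f x :=
  le_iSup_of_le c (le_iSup_of_le r (le_iSup_of_le hx le_rfl))

theorem setOf_lt_ballMaximal {n : ℕ} (ν : Measure (RSpace n)) (f : RSpace n → ℝ≥0∞) (t : ℝ≥0∞) :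
    {x | t < ballMaximal ν f x} =
      ⋃ a ∈ {a : RSpace n × ℝ | t < (ν (ball a.1 a.2))⁻¹ * ∫⁻ y in ball a.1 a.2, f y ∂ν},
        ball a.1 a.2 := by
  ext x
  simp only [mem_ofPred_eq, ballMaximal, lt_iSup_iff, mem_iUnion, Prod.exists]
  constructor
  · rintro ⟨c, r, h, h'⟩; exact ⟨c, r, h', h⟩
  · rintro ⟨c, r, h, h'⟩; exact ⟨c, r, h', h⟩

theorem measurable_ballMaximal {n : ℕ} (ν : Measure (RSpace n)) (f : RSpace n → ℝ≥0∞) :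
    Measurable (ballMaximal ν f) := by
  refine measurable_of_Ioi fun t => ?_
  have : ballMaximal ν f ⁻¹' Ioi t = {x | t < ballMaximal ν f x} := rfl
  rw [this, setOf_lt_ballMaximal]
  exact (isOpen_biUnion fun _ _ => isOpen_ball).measurableSet

/-- Vitali's covering lemma: a disjoint subfamily of the balls with large mean covers the level set
after fivefold enlargement, and doubling pays for the enlargement. The covering lemma needs bounded
radii, so the level set is exhausted by balls of radius at most `N`. Level sets are open, hence `f`
may be arbitrary. -/
theorem ballMaximal_weak {n : ℕ} {ν : Measure (RSpace n)} {D : ℝ≥0} (hν : IsBallDoubling ν D)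
    (f : RSpace n → ℝ≥0∞) (t : ℝ≥0∞) :
    t * ν {x | t < ballMaximal ν f x} ≤ D * ∫⁻ y, f y ∂ν := by
  set s : ℕ → Set (RSpace n × ℝ) := fun N =>
    {a | a.2 ≤ N ∧ 0 < a.2 ∧ t < (ν (ball a.1 a.2))⁻¹ * ∫⁻ y in ball a.1 a.2, f y ∂ν} with hs
  have hU : {x | t < ballMaximal ν f x} = ⋃ N, ⋃ a ∈ s N, ball a.1 a.2 := by
    rw [setOf_lt_ballMaximal]
    ext x
    simp only [mem_iUnion, hs, mem_ofPred_eq, exists_prop]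
    constructor
    · rintro ⟨a, ha, hx⟩
      obtain ⟨N, hN⟩ := exists_nat_ge a.2
      exact ⟨N, a, ⟨hN, pos_of_mem_ball hx, ha⟩, hx⟩
    · rintro ⟨N, a, ha, hx⟩
      exact ⟨a, ha.2.2, hx⟩
  have hmono : Monotone fun N => ⋃ a ∈ s N, ball a.1 a.2 := by
    intro N M hNM
    refine biUnion_subset_biUnion_left fun a ha => ⟨ha.1.trans (by exact_mod_cast hNM), ha.2⟩
  rw [hU, hmono.measure_iUnion, ENNReal.mul_iSup]
  refine iSup_le fun N => ?_
  obtain ⟨u, hu, hdisj, hcov⟩ := Vitali.exists_disjoint_subfamily_covering_enlargement_ball (s N)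
    (fun a => a.1) (fun a => a.2) N (fun a ha => ha.1) 5 (by norm_num)
  have hcount : u.Countable := hdisj.countable_of_isOpen (fun _ _ => isOpen_ball)
    fun a ha => nonempty_ball.2 (hu ha).2.1
  calc t * ν (⋃ a ∈ s N, ball a.1 a.2)
      ≤ t * ν (⋃ a ∈ u, ball a.1 (5 * a.2)) := by
        gcongr t * ν ?_
        refine iUnion₂_subset fun a ha => ?_
        obtain ⟨b, hb, hab⟩ := hcov a ha
        exact hab.trans (subset_biUnion_of_mem (u := fun a : RSpace n × ℝ => ball a.1 (5 * a.2)) hb)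
    _ ≤ t * ∑' a : u, ν (ball a.1.1 (5 * a.1.2)) := by
        gcongr
        exact measure_biUnion_le _ hcount _
    _ ≤ t * ∑' a : u, D * ν (ball a.1.1 a.1.2) := by
        gcongr with a
        exact hν.doubling _ _ (hu a.2).2.1
    _ = D * ∑' a : u, t * ν (ball a.1.1 a.1.2) := by
        rw [ENNReal.tsum_mul_left, ENNReal.tsum_mul_left]; ring
    _ ≤ D * ∑' a : u, ∫⁻ y in ball a.1.1 a.1.2, f y ∂ν := by
        gcongr with a
        have h := (hu a.2).2.2.le
        have h0 := hν.pos a.1.1 a.1.2 (hu a.2).2.1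
        have h1 := hν.finite a.1.1 a.1.2
        calc t * ν (ball a.1.1 a.1.2) ≤ _ := mul_le_mul_left h _
          _ = _ := by rw [mul_comm, ← mul_assoc, ENNReal.mul_inv_cancel h0 h1, one_mul]
    _ = D * ∫⁻ y in ⋃ a ∈ u, ball a.1 a.2, f y ∂ν := by
        rw [lintegral_biUnion hcount (fun _ _ => measurableSet_ball) hdisj]
    _ ≤ D * ∫⁻ y, f y ∂ν := by
        gcongr (D : ℝ≥0∞) * ?_
        exact setLIntegral_le_lintegral _ _

/-- Since f ≤ f χ_{f > t} + t, a mean of f above 2t forces a mean of f χ_{f > t} above t. This form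
of the weak bound is the one that can be integrated in t. -/
theorem ballMaximal_weak_truncated {n : ℕ} {ν : Measure (RSpace n)} {D : ℝ≥0}
    (hν : IsBallDoubling ν D) {f : RSpace n → ℝ≥0∞} (hf : Measurable f) (t : ℝ≥0∞) :
    t * ν {x | 2 * t < ballMaximal ν f x} ≤ D * ∫⁻ y in {y | t < f y}, f y ∂ν := by
  have hm : MeasurableSet {y | t < f y} := measurableSet_lt measurable_const hf
  rw [← lintegral_indicator hm]
  refine le_trans ?_ (ballMaximal_weak hν _ t)
  gcongr t * ν ?_
  intro x hx
  have hx' : 2 * t < ballMaximal ν f x := hx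
  show t < _
  by_contra! hcon
  refine absurd hx' (not_lt.2 ?_)
  refine iSup_le fun c => iSup_le fun r => iSup_le fun hxc => ?_
  have h1 := (le_ballMaximal ν ({y | t < f y}.indicator f) hxc).trans hcon
  calc (ν (ball c r))⁻¹ * ∫⁻ y in ball c r, f y ∂ν
      ≤ (ν (ball c r))⁻¹ * ∫⁻ y in ball c r, ({y | t < f y}.indicator f y + t) ∂ν := by
        gcongr with y
        by_cases hy : t < f y
        · rw [indicator_of_mem (by exact hy)]; exact le_self_add
        · rw [indicator_of_notMem (by exact hy), zero_add]; exact not_lt.1 hy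
    _ = (ν (ball c r))⁻¹ * (∫⁻ y in ball c r, {y | t < f y}.indicator f y ∂ν)
          + (ν (ball c r))⁻¹ * ν (ball c r) * t := by
        rw [lintegral_add_right _ measurable_const, mul_add, setLIntegral_const]; ring
    _ ≤ t + 1 * t := by
        gcongr
        exact ENNReal.inv_mul_le_one _
    _ = 2 * t := by ring

theorem ballMaximal_congr {n : ℕ} {ν : Measure (RSpace n)} {f g : RSpace n → ℝ≥0∞}
    (h : f =ᵐ[ν] g) : ballMaximal ν f = ballMaximal ν g := by
  ext x
  simp only [ballMaximal]
  congr! 6 with c r hx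
  exact lintegral_congr_ae (ae_restrict_of_ae h)

/-- Monotone convergence. It allows the arguments below to work with a bounded truncation, which is
real-valued and can be divided by. -/
theorem lintegral_rpow_le_of_forall_min {X : Type*} [MeasurableSpace X] {ν : Measure X} {p : ℝ}
    (hp : 1 ≤ p) {M : X → ℝ≥0∞} (hM : Measurable M) {A : ℝ≥0∞}
    (h : ∀ N : ℕ, ∫⁻ x, (min (M x) N) ^ p ∂ν ≤ A) : ∫⁻ x, M x ^ p ∂ν ≤ A := by
  have hsup : ∀ x, M x ^ p = ⨆ N : ℕ, (min (M x) N) ^ p := by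
    intro x
    have hmono : Monotone fun y : ℝ≥0∞ => y ^ p := ENNReal.monotone_rpow_of_nonneg (by linarith)
    refine le_antisymm ?_ (iSup_le fun N => hmono (min_le_left _ _))
    by_cases hx : M x = ∞
    · rw [hx, ENNReal.top_rpow_of_pos (by linarith)]
      rw [top_le_iff, iSup_eq_top]
      intro b hb
      obtain ⟨N, hN⟩ := ENNReal.exists_nat_gt hb.ne
      refine ⟨N + 1, hN.trans_le ?_⟩
      rw [min_eq_right le_top]
      calc (N : ℝ≥0∞) ≤ ((N + 1 : ℕ) : ℝ≥0∞) := by exact_mod_cast Nat.le_succ N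
        _ = ((N + 1 : ℕ) : ℝ≥0∞) ^ (1 : ℝ) := by simp
        _ ≤ _ := ENNReal.rpow_le_rpow_of_exponent_le (by simp) hp
    · obtain ⟨N, hN⟩ := ENNReal.exists_nat_gt hx
      refine le_iSup_of_le N ?_
      rw [min_eq_left hN.le]
  simp_rw [hsup]
  rw [lintegral_iSup (fun N => by fun_prop)]
  · exact iSup_le h
  · intro N N' hN x
    exact ENNReal.rpow_le_rpow (min_le_min le_rfl (by exact_mod_cast hN)) (by linarith)

/-- Marcinkiewicz interpolation by the layer-cake formula: the truncated weak bound at height t/2 is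
integrated against p t^(p-1) dt. What results is again a layer-cake integral, of 2f with exponent p
- 1 and respect to the measure f dν; this is `hlayer`. -/
theorem ballMaximal_strong_aux {n : ℕ} {ν : Measure (RSpace n)} [SFinite ν] {D : ℝ≥0}
    (hν : IsBallDoubling ν D) {p : ℝ} (hp : 1 < p) {f : RSpace n → ℝ≥0} (hf : Measurable f) :
    ∫⁻ x, ballMaximal ν (fun y => f y) x ^ p ∂ν ≤
      ENNReal.ofReal p * (2 * D) * (ENNReal.ofReal (p - 1))⁻¹ * ENNReal.ofReal (2 ^ (p - 1)) *
        ∫⁻ x, (f x : ℝ≥0∞) ^ p ∂ν := by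
  set M := ballMaximal ν (fun y => (f y : ℝ≥0∞)) with hM
  have hMm : Measurable M := measurable_ballMaximal _ _
  have hlayer : ∫⁻ t : ℝ in Ioi 0, (ν.withDensity fun y => (f y : ℝ≥0∞)) {y | t < 2 * (f y : ℝ)} *
        ENNReal.ofReal (t ^ (p - 1 - 1)) =
      (ENNReal.ofReal (p - 1))⁻¹ * ENNReal.ofReal (2 ^ (p - 1)) * ∫⁻ x, (f x : ℝ≥0∞) ^ p ∂ν := by
    have h := lintegral_rpow_eq_lintegral_meas_lt_mul (ν.withDensity fun y => (f y : ℝ≥0∞))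
      (f := fun y => 2 * (f y : ℝ)) (Eventually.of_forall fun y => by positivity)
      (by fun_prop) (p := p - 1) (by linarith)
    have h1 : ENNReal.ofReal (p - 1) ≠ 0 := by simpa using hp
    have h2 : ∫⁻ y, ENNReal.ofReal ((2 * (f y : ℝ)) ^ (p - 1)) ∂(ν.withDensity fun y => (f y : ℝ≥0∞))
        = ENNReal.ofReal (2 ^ (p - 1)) * ∫⁻ x, (f x : ℝ≥0∞) ^ p ∂ν := by
      rw [lintegral_withDensity_eq_lintegral_mul _ (by fun_prop) (by fun_prop),
        ← lintegral_const_mul _ (by fun_prop)]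
      refine lintegral_congr fun y => ?_
      simp only [Pi.mul_apply]
      rw [Real.mul_rpow (by norm_num) (by positivity), ENNReal.ofReal_mul (by positivity),
        ← ENNReal.ofReal_rpow_of_nonneg (x := (f y : ℝ)) (by positivity) (by linarith),
        ENNReal.ofReal_coe_nnreal, mul_left_comm]
      congr 1
      have : p = 1 + (p - 1) := by ring
      conv_rhs => rw [this, ENNReal.rpow_add_of_nonneg _ _ (by norm_num) (by linarith)]
      simp
    rw [h2] at h
    rw [mul_assoc, h, ← mul_assoc, ENNReal.inv_mul_cancel h1 ENNReal.ofReal_ne_top, one_mul]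
  have key : ∀ N : ℕ, ∫⁻ x, (min (M x) N) ^ p ∂ν ≤
      ENNReal.ofReal p * (2 * D) * (ENNReal.ofReal (p - 1))⁻¹ * ENNReal.ofReal (2 ^ (p - 1)) *
        ∫⁻ x, (f x : ℝ≥0∞) ^ p ∂ν := by
    intro N
    have hfin : ∀ x, min (M x) N ≠ ∞ := fun x =>
      ne_top_of_le_ne_top (ENNReal.natCast_ne_top N) (min_le_right _ _)
    have h := lintegral_rpow_eq_lintegral_meas_lt_mul ν
      (f := fun y => (min (M y) N).toReal) (Eventually.of_forall fun y => by positivity)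
      (by fun_prop) (p := p) (by linarith)
    have h3 : ∫⁻ x, (min (M x) N) ^ p ∂ν = ∫⁻ y, ENNReal.ofReal ((min (M y) N).toReal ^ p) ∂ν := by
      refine lintegral_congr fun y => ?_
      rw [← ENNReal.ofReal_rpow_of_nonneg (by positivity) (by linarith),
        ENNReal.ofReal_toReal (hfin y)]
    rw [h3, h]
    calc _ ≤ ENNReal.ofReal p * ∫⁻ t : ℝ in Ioi 0, (2 * D) *
          ((ν.withDensity fun y => (f y : ℝ≥0∞)) {y | t < 2 * (f y : ℝ)} *
            ENNReal.ofReal (t ^ (p - 1 - 1))) := by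
          gcongr ENNReal.ofReal p * ?_
          refine setLIntegral_mono' measurableSet_Ioi fun t ht => ?_
          have ht0 : (0 : ℝ) < t := ht
          have hw := ballMaximal_weak_truncated hν (f := fun y => (f y : ℝ≥0∞)) (by fun_prop)
            (ENNReal.ofReal (t / 2))
          have hms : MeasurableSet {y | t < 2 * (f y : ℝ)} :=
            measurableSet_lt measurable_const (by fun_prop)
          have e1 : (ν.withDensity fun y => (f y : ℝ≥0∞)) {y | t < 2 * (f y : ℝ)} =
              ∫⁻ y in {y | ENNReal.ofReal (t / 2) < (f y : ℝ≥0∞)}, (f y : ℝ≥0∞) ∂ν := by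
            rw [withDensity_apply _ hms]
            congr 3 with y
            rw [← ENNReal.ofReal_coe_nnreal,
              ENNReal.ofReal_lt_ofReal_iff_of_nonneg (by positivity)]
            constructor <;> intro _ <;> linarith
          have e2 : ν {a | t < (min (M a) N).toReal} ≤
              ν {x | 2 * ENNReal.ofReal (t / 2) < M x} := by
            refine measure_mono fun a ha => ?_
            have ha' : t < (min (M a) N).toReal := ha
            have : 2 * ENNReal.ofReal (t / 2) = ENNReal.ofReal t := by
              rw [show (2 : ℝ≥0∞) = ENNReal.ofReal 2 by simp, ← ENNReal.ofReal_mul (by norm_num)]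
              congr 1; ring
            show 2 * ENNReal.ofReal (t / 2) < M a
            rw [this]
            exact ((ENNReal.ofReal_lt_iff_lt_toReal ht0.le (hfin a)).2 ha').trans_le (min_le_left _ _)
          have e3 : ENNReal.ofReal (t ^ (p - 1)) =
              2 * ENNReal.ofReal (t / 2) * ENNReal.ofReal (t ^ (p - 1 - 1)) := by
            rw [show (2 : ℝ≥0∞) = ENNReal.ofReal 2 by simp, ← ENNReal.ofReal_mul (by norm_num),
              ← ENNReal.ofReal_mul (by positivity)]
            congr 1
            rw [Real.rpow_sub_one ht0.ne' (p - 1)]; field_simp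
          rw [e1, e3]
          calc _ ≤ ν {x | 2 * ENNReal.ofReal (t / 2) < M x} *
                (2 * ENNReal.ofReal (t / 2) * ENNReal.ofReal (t ^ (p - 1 - 1))) := by gcongr
            _ = 2 * (ENNReal.ofReal (t / 2) * ν {x | 2 * ENNReal.ofReal (t / 2) < M x}) *
                ENNReal.ofReal (t ^ (p - 1 - 1)) := by ring
            _ ≤ 2 * (D * ∫⁻ y in {y | ENNReal.ofReal (t / 2) < (f y : ℝ≥0∞)}, (f y : ℝ≥0∞) ∂ν) *
                ENNReal.ofReal (t ^ (p - 1 - 1)) := by gcongr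
            _ = _ := by ring
      _ = _ := by
          rw [lintegral_const_mul' _ _ (by finiteness), hlayer]; ring
  exact lintegral_rpow_le_of_forall_min hp.le hMm key

theorem ballMaximal_strong {n : ℕ} {ν : Measure (RSpace n)} [SFinite ν] {D : ℝ≥0}
    (hν : IsBallDoubling ν D) {p : ℝ} (hp : 1 < p) :
    ∃ C : ℝ≥0, ∀ f : RSpace n → ℝ≥0∞, AEMeasurable f ν →
      ∫⁻ x, ballMaximal ν f x ^ p ∂ν ≤ C * ∫⁻ x, f x ^ p ∂ν := by
  set K : ℝ≥0∞ :=
    ENNReal.ofReal p * (2 * D) * (ENNReal.ofReal (p - 1))⁻¹ * ENNReal.ofReal (2 ^ (p - 1))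
  have hK : K ≠ ∞ := by
    have : ENNReal.ofReal (p - 1) ≠ 0 := by simpa using hp
    finiteness
  -- The summand 1 makes the constant nonzero, so that the bound is trivial when the right-hand
  -- integral is infinite.
  refine ⟨K.toNNReal + 1, fun f hf => ?_⟩
  by_cases h : ∫⁻ x, f x ^ p ∂ν = ∞
  · rw [h, ENNReal.mul_top (by simp)]; exact le_top
  have hfin : ∀ᵐ x ∂ν, f x < ∞ := by
    filter_upwards [ae_lt_top' (hf.pow_const p) h] with x hx
    exact (ENNReal.rpow_lt_top_iff_of_pos (by linarith)).1 hx
  have hae : f =ᵐ[ν] fun x => (((hf.mk f x).toNNReal : ℝ≥0) : ℝ≥0∞) := by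
    filter_upwards [hfin, hf.ae_eq_mk] with x hx hx'
    rw [← hx', ENNReal.coe_toNNReal hx.ne]
  rw [ballMaximal_congr hae]
  refine (ballMaximal_strong_aux hν hp hf.measurable_mk.ennreal_toNNReal).trans ?_
  have : ∫⁻ x, ((hf.mk f x).toNNReal : ℝ≥0∞) ^ p ∂ν = ∫⁻ x, f x ^ p ∂ν :=
    lintegral_congr_ae (hae.mono fun x hx => by simp only [hx])
  rw [this]
  gcongr
  rw [ENNReal.coe_add, ENNReal.coe_toNNReal hK]
  exact le_self_add

end

section

/-! ### Pairs of measures satisfying the `A_p` condition -/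

/-- A measure `W` together with the dual measure `σ`, satisfying the `A_p` condition. -/
structure IsApPair {n : ℕ} (p : ℝ) (W σ : Measure (RSpace n)) (C : ℝ≥0) : Prop where
  pos_left : ∀ c r, 0 < r → W (ball c r) ≠ 0
  finite_left : ∀ c r, W (ball c r) ≠ ∞
  pos_right : ∀ c r, 0 < r → σ (ball c r) ≠ 0
  finite_right : ∀ c r, σ (ball c r) ≠ ∞
  holder : ∀ E, MeasurableSet E → volume E ≤ W E ^ (1 / p) * σ E ^ (1 - 1 / p)
  bound : ∀ c r, 0 < r →
    W (ball c r) ^ (1 / p) * σ (ball c r) ^ (1 - 1 / p) ≤ C * volume (ball c r)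

theorem volume_ball_mul {n : ℕ} (c c' : RSpace n) {t r : ℝ} (ht : 0 < t) :
    volume (ball c (t * r)) = ENNReal.ofReal (t ^ n) * volume (ball c' r) := by
  rw [Measure.addHaar_ball_mul_of_pos volume c ht r, finrank_euclideanSpace, Fintype.card_fin,
    ← Measure.addHaar_ball_center volume c']

theorem volume_ball_ne_zero {n : ℕ} (c : RSpace n) {r : ℝ} (hr : 0 < r) :
    volume (ball c r) ≠ 0 := (measure_ball_pos volume c hr).ne'

theorem volume_ball_ne_top {n : ℕ} (c : RSpace n) (r : ℝ) :
    volume (ball c r) ≠ ∞ := measure_ball_lt_top.ne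

/-! ### Doubling and reverse doubling from the `A_p` condition -/

namespace IsApPair

variable {n : ℕ} {p : ℝ} {W σ : Measure (RSpace n)} {C : ℝ≥0}

theorem symm (h : IsApPair p W σ C) (hp : 1 < p) : IsApPair (p / (p - 1)) σ W C := by
  have h1 : 1 / (p / (p - 1)) = 1 - 1 / p := by
    have : p - 1 ≠ 0 := by linarith
    field_simp
  have h2 : 1 - 1 / (p / (p - 1)) = 1 / p := by rw [h1]; ring
  refine ⟨h.pos_right, h.finite_right, h.pos_left, h.finite_left, fun E hE => ?_, fun c r hr => ?_⟩
  · rw [h1, sub_sub_cancel, mul_comm]; exact h.holder E hE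
  · rw [h1, sub_sub_cancel, mul_comm]; exact h.bound c r hr

/-- Hölder on `E` bounds |E| below by W and σ, the `A_p` condition bounds them above on the ball;
the common factor σ(ball)^(1 - 1/p) cancels. Doubling, reverse doubling and the passage to sparse
cores are all instances. -/
theorem measure_ball_le (h : IsApPair p W σ C) (hp : 1 < p) {c : RSpace n} {r : ℝ} (hr : 0 < r)
    {E : Set (RSpace n)} (hE : MeasurableSet E) (hEB : E ⊆ ball c r) {K : ℝ≥0}
    (hK : volume (ball c r) ≤ K * volume E) : W (ball c r) ≤ ((C * K) ^ p : ℝ≥0) * W E := by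
  have hp0 : 0 < p := by linarith
  have hp1 : 0 ≤ 1 - 1 / p := by
    rw [sub_nonneg, div_le_one hp0]; exact hp.le
  have key : W (ball c r) ^ (1 / p) * σ (ball c r) ^ (1 - 1 / p) ≤
      C * K * W E ^ (1 / p) * σ (ball c r) ^ (1 - 1 / p) :=
    calc _ ≤ C * volume (ball c r) := h.bound c r hr
      _ ≤ C * (K * (W E ^ (1 / p) * σ E ^ (1 - 1 / p))) := by
        gcongr; exact hK.trans (by gcongr; exact h.holder E hE)
      _ ≤ C * (K * (W E ^ (1 / p) * σ (ball c r) ^ (1 - 1 / p))) := by gcongr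
      _ = _ := by ring
  have key2 := (ENNReal.mul_le_mul_iff_left (ENNReal.rpow_pos
    (pos_iff_ne_zero.2 (h.pos_right c r hr)) (h.finite_right c r)).ne'
    (ENNReal.rpow_ne_top_of_nonneg hp1 (h.finite_right c r))).1 key
  have key3 := ENNReal.rpow_le_rpow key2 hp0.le
  rw [ENNReal.mul_rpow_of_nonneg _ _ hp0.le, ← ENNReal.rpow_mul, ← ENNReal.rpow_mul,
    one_div_mul_cancel hp0.ne', ENNReal.rpow_one, ENNReal.rpow_one] at key3
  rwa [ENNReal.coe_rpow_of_nonneg _ hp0.le, ENNReal.coe_mul]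

theorem measure_ball_mul_le (h : IsApPair p W σ C) (hp : 1 < p) {t : ℝ} (ht : 1 ≤ t) :
    ∃ D : ℝ≥0, ∀ c r, 0 < r → W (ball c (t * r)) ≤ D * W (ball c r) := by
  refine ⟨(C * (t ^ n).toNNReal) ^ p, fun c r hr => ?_⟩
  refine h.measure_ball_le hp (by positivity) measurableSet_ball
    (ball_subset_ball (by nlinarith)) ?_
  rw [volume_ball_mul c c (by positivity)]; rfl

theorem isBallDoubling_left (h : IsApPair p W σ C) (hp : 1 < p) : ∃ D, IsBallDoubling W D := by
  obtain ⟨D, hD⟩ := h.measure_ball_mul_le hp (t := 5) (by norm_num)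
  exact ⟨D, h.pos_left, h.finite_left, hD⟩

theorem isBallDoubling_right (h : IsApPair p W σ C) (hp : 1 < p) : ∃ D, IsBallDoubling σ D :=
  (h.symm hp).isBallDoubling_left (by rw [lt_div_iff₀ (by linarith)]; linarith)

/-- The annulus 2B \ B has at least half the volume of 2B because 2^n ≥ 2, so it carries a fixed
share 1/D of W(2B), which B then misses. -/
theorem reverse_doubling (h : IsApPair p W σ C) (hp : 1 < p) (hn : 1 ≤ n) :
    ∃ δ : ℝ≥0, δ < 1 ∧ ∀ c r, 0 < r → W (ball c r) ≤ δ * W (ball c (2 * r)) := by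
  -- The maximum with 1 makes `D` invertible and keeps the truncated difference `1 - D⁻¹` a true
  -- one.
  set D : ℝ≥0 := max 1 ((C * 2) ^ p) with hD
  have hD1 : (1 : ℝ≥0) ≤ D := le_max_left _ _
  refine ⟨1 - D⁻¹, tsub_lt_self one_pos (by positivity), fun c r hr => ?_⟩
  set E := ball c (2 * r) \ ball c r
  have hsub : ball c r ⊆ ball c (2 * r) := ball_subset_ball (by linarith)
  have hvol : volume (ball c (2 * r)) = volume E + volume (ball c r) := by
    have := measure_sdiff_add_inter (μ := volume) (ball c (2 * r)) (measurableSet_ball (x := c) (ε := r))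
    rw [inter_eq_self_of_subset_right hsub] at this
    exact this.symm
  have hW : W (ball c (2 * r)) = W E + W (ball c r) := by
    have := measure_sdiff_add_inter (μ := W) (ball c (2 * r)) (measurableSet_ball (x := c) (ε := r))
    rw [inter_eq_self_of_subset_right hsub] at this
    exact this.symm
  have h2 : 2 * volume (ball c r) ≤ volume (ball c (2 * r)) := by
    rw [volume_ball_mul c c two_pos]
    gcongr
    rw [← ENNReal.ofReal_ofNat]
    apply ENNReal.ofReal_le_ofReal
    calc (OfNat.ofNat 2 : ℝ) = 2 ^ 1 := by norm_num
      _ ≤ 2 ^ n := pow_le_pow_right₀ (by norm_num) hn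
  have hEvol : volume (ball c (2 * r)) ≤ (2 : ℝ≥0) * volume E := by
    have hle : volume (ball c r) ≤ volume E := by
      rw [hvol, two_mul] at h2
      exact (ENNReal.add_le_add_iff_right (volume_ball_ne_top c r)).1 h2
    rw [hvol, ENNReal.coe_ofNat, two_mul]
    gcongr
  have hle := h.measure_ball_le hp (by positivity : 0 < 2 * r)
    (measurableSet_ball.diff measurableSet_ball) sdiff_subset hEvol
  have hle' : W (ball c (2 * r)) ≤ D * W E := hle.trans (by gcongr; exact le_max_right _ _)
  have hD0 : (D : ℝ≥0∞) ≠ 0 := by simpa using (zero_lt_one.trans_le hD1).ne'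
  have h3 : (D : ℝ≥0∞)⁻¹ * W (ball c (2 * r)) ≤ W E := by
    rw [ENNReal.inv_mul_le_iff hD0 ENNReal.coe_ne_top]; exact hle'
  rw [ENNReal.coe_sub, ENNReal.sub_mul (fun _ _ => h.finite_left _ _), ENNReal.coe_inv (by positivity)]
  refine ENNReal.le_sub_of_add_le_left ?_ ?_
  · exact ENNReal.mul_ne_top (ENNReal.inv_ne_top.2 hD0) (h.finite_left _ _)
  · rw [ENNReal.coe_one, one_mul]
    nth_rewrite 2 [hW]
    gcongr

theorem measure_ball_le_pow (h : IsApPair p W σ C) (hp : 1 < p) (hn : 1 ≤ n) :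
    ∃ δ : ℝ≥0, δ < 1 ∧ ∀ c r, 0 < r → ∀ k : ℕ, W (ball c r) ≤ δ ^ k * W (ball c (2 ^ k * r)) := by
  obtain ⟨δ, hδ, hle⟩ := h.reverse_doubling hp hn
  refine ⟨δ, hδ, fun c r hr k => ?_⟩
  induction k with
  | zero => simp
  | succ k ih =>
    refine ih.trans ?_
    calc _ ≤ (δ : ℝ≥0∞) ^ k * (δ * W (ball c (2 * (2 ^ k * r)))) := by
          gcongr; exact hle _ _ (by positivity)
      _ = _ := by rw [← mul_assoc, ← pow_succ, pow_succ' (2 : ℝ) k, mul_assoc 2]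

end IsApPair

/-! ### Muckenhoupt weights -/

/-- The dual measure `w^(-p'/p) dx` of a weight `w`. -/
noncomputable def dualMeasure {n : ℕ} (p : ℝ) (w : RSpace n → ℝ) : Measure (RSpace n) :=
  volume.withDensity fun x => ENNReal.ofReal (w x) ^ (-(p / (p - 1)) / p)

namespace IsWeight

variable {n : ℕ} {w : RSpace n → ℝ}

theorem aemeasurable (hw : IsWeight w) : AEMeasurable w volume :=
  hw.locallyIntegrable.aestronglyMeasurable.aemeasurable

theorem measure_absolutelyContinuous (w : RSpace n → ℝ) : weightMeasure w ≪ volume :=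
  withDensity_absolutelyContinuous _ _

theorem absolutelyContinuous_measure (hw : IsWeight w) : volume ≪ weightMeasure w := by
  refine withDensity_absolutelyContinuous' hw.aemeasurable.ennreal_ofReal ?_
  filter_upwards [hw.pos] with x hx
  simpa using hx

theorem measure_ball_ne_zero (hw : IsWeight w) (c : RSpace n) {r : ℝ} (hr : 0 < r) :
    weightMeasure w (ball c r) ≠ 0 := fun h =>
  volume_ball_ne_zero c hr (hw.absolutelyContinuous_measure h)

theorem measure_ball_ne_top (hw : IsWeight w) (c : RSpace n) (r : ℝ) :
    weightMeasure w (ball c r) ≠ ∞ := by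
  have h := (hw.locallyIntegrable.integrableOn_isCompact (isCompact_closedBall c r)).2
  refine ne_top_of_le_ne_top h.ne ?_
  rw [weightMeasure, withDensity_apply _ measurableSet_ball]
  refine (lintegral_mono fun x => ?_).trans (lintegral_mono_set ball_subset_closedBall)
  exact Real.ofReal_le_enorm (w x)

theorem sFinite (w : RSpace n → ℝ) : SFinite (weightMeasure w) := by
  unfold weightMeasure; infer_instance

end IsWeight

instance {n : ℕ} (w : RSpace n → ℝ) : SFinite (weightMeasure w) := IsWeight.sFinite w

instance {n : ℕ} (p : ℝ) (w : RSpace n → ℝ) : SFinite (dualMeasure p w) := by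
  unfold dualMeasure; infer_instance

namespace IsMuckenhouptAp

variable {n : ℕ} {w : RSpace n → ℝ} {p : ℝ}

/-- The density is h = F w^(p'/p), so that F dx = h dσ and F^p w dx = h^p dσ. Lebesgue means of |f|
thereby become σ-integrals of a function with the same L^p norm, to which the maximal operator of σ
applies. -/
theorem exists_dual_density (hw : IsWeight w) (hp : 1 < p) {F : RSpace n → ℝ≥0∞}
    (hF : AEMeasurable F volume) :
    ∃ h : RSpace n → ℝ≥0∞, AEMeasurable h (dualMeasure p w) ∧
      (∀ E, MeasurableSet E → ∫⁻ x in E, h x ∂(dualMeasure p w) = ∫⁻ x in E, F x) ∧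
      ∀ E, MeasurableSet E →
        ∫⁻ x in E, h x ^ p ∂(dualMeasure p w) = ∫⁻ x in E, F x ^ p ∂(weightMeasure w) := by
  have hp1 : p - 1 ≠ 0 := by linarith
  have hp0 : p ≠ 0 := by linarith
  set e : ℝ := -(p / (p - 1)) / p with he
  have hwm := hw.aemeasurable.ennreal_ofReal
  have hac : dualMeasure p w ≪ volume := withDensity_absolutelyContinuous _ _
  have hm : AEMeasurable (fun x => F x * ENNReal.ofReal (w x) ^ (-e)) volume :=
    hF.mul (hwm.pow_const _)
  refine ⟨fun x => F x * ENNReal.ofReal (w x) ^ (-e), hm.mono_ac hac, fun E hE => ?_, fun E hE => ?_⟩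
  · rw [dualMeasure, restrict_withDensity hE,
      lintegral_withDensity_eq_lintegral_mul₀ (hwm.pow_const _).restrict hm.restrict]
    refine lintegral_congr_ae (ae_restrict_of_ae ?_)
    filter_upwards [hw.pos] with x hx
    have h0 : ENNReal.ofReal (w x) ≠ 0 := by simpa using hx
    simp only [Pi.mul_apply]
    rw [mul_comm, mul_assoc, ← ENNReal.rpow_add _ _ h0 ENNReal.ofReal_ne_top, neg_add_cancel,
      ENNReal.rpow_zero, mul_one]
  · rw [dualMeasure, weightMeasure, restrict_withDensity hE, restrict_withDensity hE,
      lintegral_withDensity_eq_lintegral_mul₀ (hwm.pow_const _).restrict (hm.pow_const _).restrict,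
      lintegral_withDensity_eq_lintegral_mul₀ hwm.restrict (hF.pow_const _).restrict]
    refine lintegral_congr_ae (ae_restrict_of_ae ?_)
    filter_upwards [hw.pos] with x hx
    have h0 : ENNReal.ofReal (w x) ≠ 0 := by simpa using hx
    simp only [Pi.mul_apply]
    rw [ENNReal.mul_rpow_of_nonneg _ _ (by linarith), ← ENNReal.rpow_mul, mul_left_comm,
      ← ENNReal.rpow_add _ _ h0 ENNReal.ofReal_ne_top, mul_comm]
    have : e + -e * p = 1 := by rw [he]; field_simp; ring
    rw [this, ENNReal.rpow_one]

theorem setLIntegral_le (hw : IsWeight w) (hp : 1 < p) {F : RSpace n → ℝ≥0∞}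
    (hF : AEMeasurable F volume) {E : Set (RSpace n)} (hE : MeasurableSet E) :
    ∫⁻ x in E, F x ≤ (∫⁻ x in E, F x ^ p ∂(weightMeasure w)) ^ (1 / p) *
      dualMeasure p w E ^ (1 - 1 / p) := by
  obtain ⟨h, hm, h1, h2⟩ := exists_dual_density (p := p) hw hp hF
  rw [← h1 E hE, ← h2 E hE]
  have hpq : p.HolderConjugate (p / (p - 1)) := Real.HolderConjugate.conjExponent hp
  have := ENNReal.lintegral_mul_le_Lp_mul_Lq ((dualMeasure p w).restrict E) hpq hm.restrict
    (aemeasurable_const (b := (1 : ℝ≥0∞)))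
  have h3 : 1 / (p / (p - 1)) = 1 - 1 / p := by
    have : p - 1 ≠ 0 := by linarith
    field_simp
  simpa [h3] using this

theorem isApPair (hw : IsMuckenhouptAp p w) (hp : 1 < p) :
    ∃ C, IsApPair p (weightMeasure w) (dualMeasure p w) C := by
  have hp1 : p - 1 ≠ 0 := by linarith
  have hp0 : 0 < p := by linarith
  have hpp : 0 < 1 - 1 / p := by rw [sub_pos, div_lt_one hp0]; exact hp
  have h3 : 1 / (p / (p - 1)) = 1 - 1 / p := by field_simp
  obtain ⟨C, hC⟩ := hw.bound
  have hC' : ∀ c r, 0 < r → ((volume (ball c r))⁻¹ * weightMeasure w (ball c r)) ^ (1 / p) *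
      ((volume (ball c r))⁻¹ * dualMeasure p w (ball c r)) ^ (1 - 1 / p) ≤ C := by
    intro c r hr
    have := hC c r hr
    rwa [h3, ← withDensity_apply _ measurableSet_ball, ← withDensity_apply _ measurableSet_ball]
      at this
  have hac : volume ≪ dualMeasure p w := by
    refine withDensity_absolutelyContinuous' (hw.isWeight.aemeasurable.ennreal_ofReal.pow_const _) ?_
    filter_upwards [hw.isWeight.pos] with x hx
    simp [ENNReal.rpow_eq_zero_iff, hx.not_ge]
  refine ⟨C, fun c r hr => hw.isWeight.measure_ball_ne_zero c hr,
    fun c r => hw.isWeight.measure_ball_ne_top c r,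
    fun c r hr h => volume_ball_ne_zero c hr (hac h), fun c r => ?_, fun E hE => ?_,
    fun c r hr => ?_⟩
  -- Finiteness of σ on balls is part of the `A_p` bound: the factor coming from w is positive, so
  -- σ(ball) = ∞ would make the product infinite.
  · by_cases hr : 0 < r
    · intro htop
      have := hC' c r hr
      rw [htop, ENNReal.mul_top (ENNReal.inv_ne_zero.2 (volume_ball_ne_top c r)),
        ENNReal.top_rpow_of_pos hpp, ENNReal.mul_top] at this
      · exact absurd this (by simp)
      · refine (ENNReal.rpow_pos (ENNReal.mul_pos (ENNReal.inv_ne_zero.2 (volume_ball_ne_top c r))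
          (hw.isWeight.measure_ball_ne_zero c hr)) ?_).ne'
        exact ENNReal.mul_ne_top (ENNReal.inv_ne_top.2 (volume_ball_ne_zero c hr))
          (hw.isWeight.measure_ball_ne_top c r)
    · rw [ball_eq_empty.2 (not_lt.1 hr)]; simp
  · simpa using setLIntegral_le (p := p) hw.isWeight hp (F := fun _ => 1) aemeasurable_const hE
  · have h := hC' c r hr
    have hv0 := volume_ball_ne_zero c hr
    have hvt := volume_ball_ne_top c r
    rw [ENNReal.mul_rpow_of_nonneg _ _ (by positivity), ENNReal.mul_rpow_of_nonneg _ _ hpp.le,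
      mul_mul_mul_comm, ← ENNReal.rpow_add _ _ (ENNReal.inv_ne_zero.2 hvt)
      (ENNReal.inv_ne_top.2 hv0), add_sub_cancel, ENNReal.rpow_one,
      ENNReal.inv_mul_le_iff hv0 hvt, mul_comm (volume (ball c r))] at h
    exact h

end IsMuckenhouptAp

end

section

/-! ### Dyadic cubes -/

/-- The dyadic cube `(k, m)` is `∏ [m_i 2^(-k), (m_i + 1) 2^(-k))`. -/
abbrev DyadicCube (n : ℕ) : Type := ℤ × (Fin n → ℤ)

namespace DyadicCube

variable {n : ℕ}

/-- The set of points of a dyadic cube. -/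
def cell (Q : DyadicCube n) : Set (RSpace n) := {x | ∀ i, ⌊x i * 2 ^ Q.1⌋ = Q.2 i}

/-- The lower corner of a dyadic cube. -/
noncomputable def corner (Q : DyadicCube n) : RSpace n :=
  WithLp.toLp 2 fun i => (Q.2 i : ℝ) * 2 ^ (-Q.1)

/-- The radius of a ball around the corner that contains the cube. -/
noncomputable def rad (Q : DyadicCube n) : ℝ := (n + 1) * 2 ^ (-Q.1)

/-- The dyadic cube of generation `k` that contains `x`. -/
noncomputable def cellAt (k : ℤ) (x : RSpace n) : DyadicCube n := (k, fun i => ⌊x i * 2 ^ k⌋)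

theorem rad_pos (Q : DyadicCube n) : 0 < Q.rad := by unfold rad; positivity

theorem mem_cell_iff {Q : DyadicCube n} {x : RSpace n} : x ∈ Q.cell ↔ cellAt Q.1 x = Q := by
  obtain ⟨k, m⟩ := Q
  simp [cell, cellAt, funext_iff]

theorem mem_cell_cellAt (k : ℤ) (x : RSpace n) : x ∈ (cellAt k x).cell := fun _ => rfl

theorem cellAt_fst (k : ℤ) (x : RSpace n) : (cellAt k x).1 = k := rfl

theorem corner_mem_cell (Q : DyadicCube n) : Q.corner ∈ Q.cell := by
  intro i
  simp only [corner]
  rw [mul_assoc, ← zpow_add₀ two_ne_zero, neg_add_cancel, zpow_zero, mul_one, Int.floor_intCast]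

/-- The floor at scale `k` is determined by the floor at the finer scale `k + d`; this is the
nesting of dyadic cubes. -/
theorem le_floor_mul_iff (k : ℤ) (d : ℕ) (a : ℝ) (m : ℤ) :
    m ≤ ⌊a * 2 ^ k⌋ ↔ m * 2 ^ d ≤ ⌊a * 2 ^ (k + d)⌋ := by
  rw [Int.le_floor, Int.le_floor, zpow_add₀ two_ne_zero, ← mul_assoc, zpow_natCast]
  push_cast
  rw [mul_le_mul_iff_left₀ (by positivity)]

theorem cellAt_eq_of_mem {k l : ℤ} (hkl : k ≤ l) {x y : RSpace n} (h : cellAt l x = cellAt l y) :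
    cellAt k x = cellAt k y := by
  obtain ⟨d, rfl⟩ := Int.le.dest hkl
  have h' : ∀ i, ⌊x i * 2 ^ (k + d)⌋ = ⌊y i * 2 ^ (k + d)⌋ := fun i =>
    congrFun (congrArg Prod.snd h) i
  refine Prod.ext rfl (funext fun i => ?_)
  simp only [cellAt]
  refine eq_of_forall_le_iff fun m => ?_
  rw [le_floor_mul_iff k d, le_floor_mul_iff k d, h' i]

theorem cellAt_eq_of_mem_cell {Q : DyadicCube n} {k : ℤ} (hk : k ≤ Q.1) {x y : RSpace n}
    (hx : x ∈ Q.cell) (hy : y ∈ Q.cell) : cellAt k x = cellAt k y :=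
  cellAt_eq_of_mem hk ((mem_cell_iff.1 hx).trans (mem_cell_iff.1 hy).symm)

theorem cell_subset_of_mem {P Q : DyadicCube n} (h : Q.1 ≤ P.1) {x : RSpace n} (hP : x ∈ P.cell)
    (hQ : x ∈ Q.cell) : P.cell ⊆ Q.cell := fun y hy => by
  rw [mem_cell_iff, cellAt_eq_of_mem_cell h hy hP]
  exact mem_cell_iff.1 hQ

theorem eq_of_mem {P Q : DyadicCube n} (h : Q.1 = P.1) {x : RSpace n} (hP : x ∈ P.cell)
    (hQ : x ∈ Q.cell) : P = Q := by
  rw [← mem_cell_iff.1 hP, ← mem_cell_iff.1 hQ, h]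

theorem measurableSet_cell (Q : DyadicCube n) : MeasurableSet Q.cell := by
  have : Q.cell = ⋂ i, {x : RSpace n | ⌊x i * 2 ^ Q.1⌋ = Q.2 i} := by
    ext x; simp [cell]
  rw [this]
  refine MeasurableSet.iInter fun i => ?_
  have hm : Measurable fun x : RSpace n => ⌊x i * 2 ^ Q.1⌋ := by
    have : Measurable fun x : RSpace n => x i * (2 : ℝ) ^ Q.1 := by fun_prop
    exact this.floor
  exact hm (measurableSet_singleton _)

theorem volume_cell (Q : DyadicCube n) : volume Q.cell = ENNReal.ofReal (2 ^ (-Q.1)) ^ n := by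
  have h2 : (0 : ℝ) < 2 ^ Q.1 := by positivity
  have : Q.cell = (MeasurableEquiv.toLp 2 (Fin n → ℝ)).symm ⁻¹'
      (Set.pi univ fun i => Ico ((Q.2 i : ℝ) * 2 ^ (-Q.1)) ((Q.2 i + 1 : ℝ) * 2 ^ (-Q.1))) := by
    ext x
    simp only [cell, mem_preimage, Set.mem_pi, mem_univ, true_imp_iff, mem_Ico]
    refine forall_congr' fun i => ?_
    rw [Int.floor_eq_iff, zpow_neg, ← div_eq_mul_inv, ← div_eq_mul_inv, div_le_iff₀ h2, lt_div_iff₀ h2]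
    rfl
  rw [this, (EuclideanSpace.volume_preserving_symm_measurableEquiv_toLp (Fin n)).measure_preimage
    (MeasurableSet.univ_pi fun i => measurableSet_Ico).nullMeasurableSet, volume_pi_pi]
  have : ∀ i, volume (Ico ((Q.2 i : ℝ) * 2 ^ (-Q.1)) ((Q.2 i + 1 : ℝ) * 2 ^ (-Q.1))) =
      ENNReal.ofReal (2 ^ (-Q.1)) := fun i => by
    rw [Real.volume_Ico]; congr 1; ring
  rw [Finset.prod_congr rfl fun i _ => this i, Finset.prod_const, Finset.card_univ, Fintype.card_fin]

theorem volume_cell_ne_zero (Q : DyadicCube n) : volume Q.cell ≠ 0 := by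
  rw [volume_cell]
  refine pow_ne_zero _ ?_
  have : (0 : ℝ) < 2 ^ (-Q.1) := by positivity
  simpa using this

theorem volume_cell_ne_top (Q : DyadicCube n) : volume Q.cell ≠ ∞ := by
  rw [volume_cell]; finiteness

theorem cell_subset_ball (Q : DyadicCube n) : Q.cell ⊆ ball Q.corner Q.rad := by
  intro x hx
  have h2 : (0 : ℝ) < 2 ^ Q.1 := by positivity
  have hi : ∀ i, ‖(x - Q.corner) i‖ ≤ 2 ^ (-Q.1) := by
    intro i
    obtain ⟨h1, h1'⟩ := Int.floor_eq_iff.1 (hx i)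
    have e : (x - Q.corner) i = x i - (Q.2 i : ℝ) * 2 ^ (-Q.1) := rfl
    rw [e, zpow_neg, ← div_eq_mul_inv, Real.norm_eq_abs, abs_le]
    have h3 := (div_le_iff₀ h2).2 h1
    have h4 := (lt_div_iff₀ h2).2 h1'
    rw [add_div, one_div] at h4
    have : (0 : ℝ) < (2 ^ Q.1)⁻¹ := by positivity
    constructor <;> linarith
  rw [mem_ball, dist_eq_norm]
  have h3 : ‖x - Q.corner‖ ≤ ∑ i, ‖(x - Q.corner) i‖ := by
    rw [EuclideanSpace.norm_eq]
    refine Real.sqrt_le_iff.2 ⟨by positivity, ?_⟩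
    exact Finset.sum_sq_le_sq_sum_of_nonneg fun i _ => norm_nonneg _
  refine h3.trans_lt ((Finset.sum_le_sum fun i _ => hi i).trans_lt ?_)
  have : (0 : ℝ) < 2 ^ (-Q.1) := by positivity
  simp only [Finset.sum_const, Finset.card_univ, Fintype.card_fin, nsmul_eq_mul, rad]
  nlinarith

/-- The ratio of the measures of the ball of radius `t * Q.rad` and of the cube `Q`. -/
noncomputable def ballRatio (n : ℕ) (t : ℝ) : ℝ≥0 :=
  ((t * (n + 1)) ^ n).toNNReal * (volume (ball (0 : RSpace n) 1)).toNNReal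

theorem volume_ball_rad (Q : DyadicCube n) (c : RSpace n) {t : ℝ} (ht : 0 < t) :
    volume (ball c (t * Q.rad)) = ballRatio n t * volume Q.cell := by
  have h2 : (0 : ℝ) < 2 ^ (-Q.1) := by positivity
  have : t * Q.rad = (t * (n + 1) * 2 ^ (-Q.1)) * 1 := by rw [rad]; ring
  rw [this, volume_ball_mul c 0 (by positivity), ballRatio, ENNReal.coe_mul,
    ENNReal.coe_toNNReal (volume_ball_ne_top _ _), volume_cell, mul_pow,
    ENNReal.ofReal_mul (by positivity), ENNReal.ofReal_pow h2.le]
  rw [ENNReal.ofReal]; ring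

theorem rad_le_of_lt {P Q : DyadicCube n} (h : Q.1 < P.1) : 2 * P.rad ≤ Q.rad := by
  have : (2 : ℝ) * 2 ^ (-P.1) ≤ 2 ^ (-Q.1) := by
    rw [← zpow_one_add₀ two_ne_zero]
    exact zpow_le_zpow_right₀ (by norm_num) (by linarith)
  simp only [rad]
  have hn : (0 : ℝ) ≤ n + 1 := by positivity
  nlinarith

/-- One generation at least halves the radius, and the corner of `P` lies within `Q.rad` of that of
`Q`. Thus enlarged balls of strictly smaller subcubes stay nested, which allows f χ_{Q*} to be split
as f χ_{P*} plus a part far from P. -/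
theorem ball_subset_ball_of_subset {P Q : DyadicCube n} (h : Q.1 < P.1) (hPQ : P.cell ⊆ Q.cell) :
    ball P.corner (2 * P.rad) ⊆ ball Q.corner (2 * Q.rad) := by
  refine ball_subset_ball' ?_
  have h1 := Q.cell_subset_ball (hPQ P.corner_mem_cell)
  have h2 := rad_le_of_lt h
  rw [mem_ball] at h1
  linarith

theorem volume_cell_pred {Q : DyadicCube n} (x : RSpace n) :
    volume (cellAt (Q.1 - 1) x).cell = 2 ^ n * volume Q.cell := by
  rw [volume_cell, volume_cell, cellAt_fst, ← mul_pow]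
  congr 1
  have h : (2 : ℝ) ^ (-(Q.1 - 1)) = 2 * 2 ^ (-Q.1) := by
    rw [← zpow_one_add₀ two_ne_zero]; congr 1; ring
  rw [h, ENNReal.ofReal_mul (by norm_num), ENNReal.ofReal_ofNat]

/-! ### Stopping cubes -/

/-- The maximal dyadic cubes on which the average of `F` exceeds `t`. -/
def IsStopping (F : RSpace n → ℝ≥0∞) (t : ℝ≥0∞) (Q : DyadicCube n) : Prop :=
  t * volume Q.cell < ∫⁻ x in Q.cell, F x ∧
    ∀ k < Q.1, ∫⁻ x in (cellAt k Q.corner).cell, F x ≤ t * volume (cellAt k Q.corner).cell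

variable {F : RSpace n → ℝ≥0∞} {t : ℝ≥0∞}

theorem IsStopping.eq_of_mem {P Q : DyadicCube n} (hP : IsStopping F t P) (hQ : IsStopping F t Q)
    {x : RSpace n} (hxP : x ∈ P.cell) (hxQ : x ∈ Q.cell) : P = Q := by
  have aux : ∀ P Q : DyadicCube n, IsStopping F t P → IsStopping F t Q → x ∈ P.cell →
      x ∈ Q.cell → Q.1 ≤ P.1 := by
    intro P Q hP hQ hxP hxQ
    by_contra! h
    have h1 := hQ.2 P.1 h
    have h2 : cellAt P.1 Q.corner = P := by
      rw [cellAt_eq_of_mem_cell h.le Q.corner_mem_cell hxQ]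
      exact mem_cell_iff.1 hxP
    rw [h2] at h1
    exact absurd hP.1 (not_lt.2 h1)
  exact DyadicCube.eq_of_mem (le_antisymm (aux P Q hP hQ hxP hxQ) (aux Q P hQ hP hxQ hxP)) hxP hxQ

theorem pairwiseDisjoint_isStopping (F : RSpace n → ℝ≥0∞) (t : ℝ≥0∞) :
    {Q | IsStopping F t Q}.PairwiseDisjoint cell := by
  intro P hP Q hQ hPQ
  rw [Function.onFun, Set.disjoint_left]
  exact fun x hxP hxQ => hPQ (IsStopping.eq_of_mem hP hQ hxP hxQ)

/-- The dyadic parent is not selected, and its volume is 2^n times larger. -/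
theorem IsStopping.lintegral_le {Q : DyadicCube n} (hQ : IsStopping F t Q) :
    ∫⁻ x in Q.cell, F x ≤ 2 ^ n * t * volume Q.cell := by
  have h1 := hQ.2 (Q.1 - 1) (by linarith)
  rw [volume_cell_pred] at h1
  refine (lintegral_mono_set ?_).trans (h1.trans_eq (by ring))
  exact cell_subset_of_mem (by rw [cellAt_fst]; linarith) Q.corner_mem_cell (mem_cell_cellAt _ _)

theorem exists_isStopping (hn : 1 ≤ n) (hF : ∫⁻ x, F x ≠ ∞) (ht : t ≠ 0) {x : RSpace n} {k : ℤ}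
    (hk : t * volume (cellAt k x).cell < ∫⁻ y in (cellAt k x).cell, F y) :
    ∃ Q, IsStopping F t Q ∧ x ∈ Q.cell := by
  -- Cubes of side at least 2^N have mean at most t, because F is integrable and n ≥ 1; so there is
  -- a coarsest generation in which the mean around x exceeds t.
  obtain ⟨N, hN⟩ : ∃ N : ℕ, ∫⁻ x, F x ≤ t * 2 ^ N := by
    by_cases htt : t = ∞
    · exact ⟨0, by simp [htt]⟩
    obtain ⟨N, hN⟩ := ENNReal.exists_nat_gt (ENNReal.div_ne_top hF ht)
    refine ⟨N, ?_⟩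
    rw [mul_comm, ← ENNReal.div_le_iff_le_mul (Or.inl ht) (Or.inl htt)]
    refine hN.le.trans ?_
    exact_mod_cast Nat.lt_two_pow_self.le
  obtain ⟨l, hl, hmin⟩ := Int.exists_least_of_bdd
    (P := fun k => t * volume (cellAt k x).cell < ∫⁻ y in (cellAt k x).cell, F y)
    ⟨-N, fun z hz => by
      by_contra! hlt
      refine absurd (hz.trans_le (setLIntegral_le_lintegral _ _)) (not_lt.2 (hN.trans ?_))
      gcongr
      rw [volume_cell, cellAt_fst]
      have h1 : (2 : ℝ≥0∞) ^ N ≤ ENNReal.ofReal (2 ^ (-z)) := by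
        rw [← ENNReal.ofReal_ofNat, ← ENNReal.ofReal_pow (by norm_num)]
        apply ENNReal.ofReal_le_ofReal
        rw [← zpow_natCast]
        exact zpow_le_zpow_right₀ (by norm_num) (by linarith)
      calc (2 : ℝ≥0∞) ^ N ≤ ENNReal.ofReal (2 ^ (-z)) ^ 1 := by rwa [pow_one]
        _ ≤ _ := pow_le_pow_right₀ (le_trans (one_le_pow₀ (by norm_num)) h1) hn⟩ ⟨k, hk⟩
  refine ⟨cellAt l x, ⟨hl, fun j hj => ?_⟩, mem_cell_cellAt _ _⟩
  rw [cellAt_fst] at hj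
  have : cellAt j (cellAt l x).corner = cellAt j x :=
    cellAt_eq_of_mem_cell (Q := cellAt l x) hj.le (corner_mem_cell _) (mem_cell_cellAt _ _)
  rw [this]
  by_contra! hcon
  exact absurd (hmin j hcon) (not_le.2 hj)

/-- Lebesgue differentiation. The balls around the corners shrink to x and contain it without being
centred there, which the Vitali family permits; the mean oscillation over a cube is at most
`ballRatio n 2` times that over its ball and tends to zero. -/
theorem ae_enorm_le_of_forall_cellAt {G : Type*} [NormedAddCommGroup G] {f : RSpace n → G}
    (hf : LocallyIntegrable f volume) (t : ℝ≥0∞) :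
    ∀ᵐ x, (∀ k : ℕ, ∫⁻ y in (cellAt k x).cell, ‖f y‖ₑ ≤ t * volume (cellAt k x).cell) →
      ‖f x‖ₑ ≤ t := by
  filter_upwards [(IsUnifLocDoublingMeasure.vitaliFamily (volume : Measure (RSpace n))
    1).ae_tendsto_lintegral_enorm_sub_div hf] with x hx hk
  have hrad : Tendsto (fun k : ℕ => (cellAt k x).rad) atTop (𝓝[>] 0) := by
    refine tendsto_nhdsWithin_iff.2 ⟨?_, Eventually.of_forall fun k => rad_pos _⟩
    have : (fun k : ℕ => (cellAt k x).rad) = fun k : ℕ => ((n : ℝ) + 1) * (1 / 2) ^ k := by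
      ext k
      simp [rad, cellAt_fst]
    rw [this, ← mul_zero ((n : ℝ) + 1)]
    exact (tendsto_pow_atTop_nhds_zero_of_lt_one (by norm_num) (by norm_num)).const_mul _
  have hlim := hx.comp (IsUnifLocDoublingMeasure.tendsto_closedBall_filterAt volume
    (fun k : ℕ => (cellAt k x).corner) (fun k => (cellAt k x).rad) hrad
    (Eventually.of_forall fun k => by
      rw [one_mul]
      exact ball_subset_closedBall (cell_subset_ball _ (mem_cell_cellAt _ _))))
  have hlim2 : Tendsto (fun k : ℕ => t + ballRatio n 2 *
      ((∫⁻ y in closedBall (cellAt k x).corner (cellAt k x).rad, ‖f y - f x‖ₑ) /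
        volume (closedBall (cellAt k x).corner (cellAt k x).rad))) atTop (𝓝 t) := by
    have := (ENNReal.Tendsto.const_mul hlim (Or.inr (ENNReal.coe_ne_top (r := ballRatio n 2)))).const_add t
    simpa using this
  refine ge_of_tendsto hlim2 (Eventually.of_forall fun k => ?_)
  set Q := cellAt (k : ℤ) x with hQ
  have hv0 := volume_cell_ne_zero Q
  have hvt := volume_cell_ne_top Q
  have hsub : Q.cell ⊆ closedBall Q.corner Q.rad := Q.cell_subset_ball.trans ball_subset_closedBall
  have h1 : ‖f x‖ₑ * volume Q.cell ≤
      (t + (∫⁻ y in closedBall Q.corner Q.rad, ‖f y - f x‖ₑ) / volume Q.cell) * volume Q.cell := by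
    rw [add_mul, ENNReal.div_mul_cancel hv0 hvt]
    calc ‖f x‖ₑ * volume Q.cell = ∫⁻ y in Q.cell, ‖f x‖ₑ := by rw [setLIntegral_const]
      _ ≤ ∫⁻ y in Q.cell, (‖f y‖ₑ + ‖f y - f x‖ₑ) := by
        gcongr with y
        calc ‖f x‖ₑ = ‖f y - (f y - f x)‖ₑ := by rw [sub_sub_cancel]
          _ ≤ _ := enorm_sub_le
      _ ≤ (∫⁻ y in Q.cell, ‖f y‖ₑ) + ∫⁻ y in Q.cell, ‖f y - f x‖ₑ := by
        rw [lintegral_add_left' hf.aestronglyMeasurable.enorm.restrict]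
      _ ≤ _ := by
        gcongr
        exact hk k
  refine ((ENNReal.mul_le_mul_iff_left hv0 hvt).1 h1).trans ?_
  gcongr
  have hcb0 : volume (closedBall Q.corner Q.rad) ≠ 0 := (measure_closedBall_pos _ _ Q.rad_pos).ne'
  have hcbt : volume (closedBall Q.corner Q.rad) ≠ ∞ := measure_closedBall_lt_top.ne
  have hle : volume (closedBall Q.corner Q.rad) ≤ ballRatio n 2 * volume Q.cell := by
    rw [← volume_ball_rad Q Q.corner two_pos]
    exact measure_mono (closedBall_subset_ball (by linarith [Q.rad_pos]))
  rw [div_eq_mul_inv, div_eq_mul_inv, mul_left_comm]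
  gcongr
  rw [ENNReal.inv_le_iff_le_mul (fun _ => hv0) (fun h => absurd h hvt)]
  rw [← mul_assoc, ← div_eq_mul_inv, ENNReal.le_div_iff_mul_le (Or.inl hcb0) (Or.inl hcbt), one_mul, mul_comm]
  exact hle

theorem ae_enorm_le_of_forall_not_isStopping (hn : 1 ≤ n) {G : Type*} [NormedAddCommGroup G]
    {f : RSpace n → G} (hf : Integrable f volume) (ht : t ≠ 0) :
    ∀ᵐ x, (∀ Q, IsStopping (fun y => ‖f y‖ₑ) t Q → x ∉ Q.cell) → ‖f x‖ₑ ≤ t := by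
  filter_upwards [ae_enorm_le_of_forall_cellAt hf.locallyIntegrable t] with x hx hQ
  refine hx fun k => ?_
  by_contra! hcon
  obtain ⟨Q, hQ1, hQ2⟩ := exists_isStopping hn hf.2.ne ht hcon
  exact hQ Q hQ1 hQ2

theorem tsum_volume_isStopping_le (F : RSpace n → ℝ≥0∞) (t : ℝ≥0∞) :
    t * ∑' Q : {Q : DyadicCube n | IsStopping F t Q}, volume Q.1.cell ≤ ∫⁻ x, F x := by
  rw [← ENNReal.tsum_mul_left]
  calc _ ≤ ∑' Q : {Q : DyadicCube n | IsStopping F t Q}, ∫⁻ x in Q.1.cell, F x := by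
        gcongr with Q
        exact Q.2.1.le
    _ = ∫⁻ x in ⋃ Q ∈ {Q : DyadicCube n | IsStopping F t Q}, Q.cell, F x :=
        (lintegral_biUnion (to_countable _) (fun Q _ => Q.measurableSet_cell)
          (pairwiseDisjoint_isStopping F t) _).symm
    _ ≤ _ := setLIntegral_le_lintegral _ _

end DyadicCube

end

section

/-! ### The Dini sum -/

/-- The dyadic sum `∑ θ(2^(-k-1))` of a modulus of continuity. -/
noncomputable def diniSum (θ : ℝ → ℝ) : ℝ≥0∞ := ∑' k : ℕ, ENNReal.ofReal (θ ((1 / 2) ^ (k + 1)))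

/-- By monotonicity θ(2^(-k-1)) is at most 2 ∫ θ(t)/t dt over (2^(-k-1), 2^(-k)), and these
intervals are disjoint in (0, 1). -/
theorem IsDiniModulus.diniSum_ne_top {θ : ℝ → ℝ} (hθ : IsDiniModulus θ) : diniSum θ ≠ ∞ := by
  set I : ℕ → Set ℝ := fun k => Ioo ((1 / 2) ^ (k + 1)) ((1 / 2) ^ k) with hI
  have hdisj : Pairwise (Function.onFun Disjoint I) := by
    have aux : ∀ i j, i < j → Disjoint (I i) (I j) := by
      intro i j hij
      rw [Set.disjoint_left]
      intro x hxi hxj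
      have : (1 / 2 : ℝ) ^ j ≤ (1 / 2) ^ (i + 1) :=
        pow_le_pow_of_le_one (by norm_num) (by norm_num) hij
      exact absurd (hxj.2.trans_le this) (not_lt.2 hxi.1.le)
    intro i j hij
    rcases lt_or_gt_of_ne hij with h | h
    · exact aux i j h
    · exact (aux j i h).symm
  have hsub : (⋃ k, I k) ⊆ Ioo 0 1 := by
    refine iUnion_subset fun k x hx => ⟨lt_trans (by positivity) hx.1, hx.2.trans_le ?_⟩
    exact pow_le_one₀ (by norm_num) (by norm_num)
  have hterm : ∀ k : ℕ, ENNReal.ofReal (θ ((1 / 2) ^ (k + 1))) ≤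
      2 * ∫⁻ t in I k, ENNReal.ofReal (θ t / t) := by
    intro k
    have hp : (0 : ℝ) < (1 / 2) ^ k := by positivity
    have hp' : (0 : ℝ) < (1 / 2) ^ (k + 1) := by positivity
    calc ENNReal.ofReal (θ ((1 / 2) ^ (k + 1)))
        = 2 * (ENNReal.ofReal (θ ((1 / 2) ^ (k + 1)) / (1 / 2) ^ k) * volume (I k)) := by
          rw [Real.volume_Ioo, show (2 : ℝ≥0∞) = ENNReal.ofReal 2 by simp,
            ← ENNReal.ofReal_mul' (by rw [pow_succ]; linarith), ← ENNReal.ofReal_mul (by norm_num)]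
          congr 1
          rw [pow_succ]
          field_simp
          ring
      _ = 2 * ∫⁻ t in I k, ENNReal.ofReal (θ ((1 / 2) ^ (k + 1)) / (1 / 2) ^ k) := by
          rw [setLIntegral_const]
      _ ≤ _ := by
          gcongr 2 * ?_
          refine setLIntegral_mono' measurableSet_Ioo fun t ht => ?_
          apply ENNReal.ofReal_le_ofReal
          have ht0 : 0 < t := hp'.trans ht.1
          exact div_le_div₀ (hθ.nonneg _ ht0) (hθ.monotone hp' ht0 ht.1.le) ht0 ht.2.le
  refine ne_top_of_le_ne_top ?_ (ENNReal.tsum_le_tsum hterm)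
  rw [ENNReal.tsum_mul_left, ← lintegral_iUnion (fun k => measurableSet_Ioo) hdisj]
  refine ENNReal.mul_ne_top (by simp) (ne_top_of_le_ne_top hθ.dini.2.ne ?_)
  exact (lintegral_mono_set hsub).trans (lintegral_mono fun t => Real.ofReal_le_enorm _)

theorem lintegral_compl_ball_le_tsum {n : ℕ} (c : RSpace n) {r : ℝ} (hr : 0 < r)
    (G : RSpace n → ℝ≥0∞) :
    ∫⁻ z in (ball c r)ᶜ, G z ≤
      ∑' k : ℕ, ∫⁻ z in ball c (2 ^ (k + 1) * r) \ ball c (2 ^ k * r), G z := by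
  refine (lintegral_mono_set ?_).trans (lintegral_iUnion_le _ _)
  intro z hz
  rw [mem_compl_iff, mem_ball, not_lt] at hz
  obtain ⟨k, hk, hk'⟩ := exists_nat_pow_near ((one_le_div hr).2 hz) (one_lt_two (α := ℝ))
  refine mem_iUnion.2 ⟨k, ?_, ?_⟩
  · rwa [mem_ball, ← div_lt_iff₀ hr]
  · rwa [mem_ball, not_lt, ← le_div_iff₀ hr]

/-- On the annulus s ≤ |z - c| < 2s with s = 2^k · 2ρ the modulus is at most θ(2^(-k-1)), and s^(-n)
cancels the volume of the ball of radius 2s. With h = 1 this gives Hörmander's condition; with h =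
|f| and A a maximal function it controls the oscillation of T f. -/
theorem lintegral_dini_le {n : ℕ} {θ : ℝ → ℝ} (hθ : IsDiniModulus θ) {c : RSpace n} {ρ : ℝ}
    (hρ : 0 < ρ) {h : RSpace n → ℝ≥0∞} {A : ℝ≥0∞}
    (hA : ∀ s, ρ ≤ s → ∫⁻ z in ball c s, h z ≤ A * volume (ball c s)) :
    ∫⁻ z in (ball c (2 * ρ))ᶜ, ENNReal.ofReal (θ (ρ / ‖z - c‖) / ‖z - c‖ ^ n) * h z ≤
      ENNReal.ofReal (2 ^ n) * volume (ball (0 : RSpace n) 1) * diniSum θ * A := by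
  refine (lintegral_compl_ball_le_tsum c (by positivity) _).trans ?_
  have hterm : ∀ k : ℕ, ∫⁻ z in ball c (2 ^ (k + 1) * (2 * ρ)) \ ball c (2 ^ k * (2 * ρ)),
        ENNReal.ofReal (θ (ρ / ‖z - c‖) / ‖z - c‖ ^ n) * h z ≤
      ENNReal.ofReal (θ ((1 / 2) ^ (k + 1))) *
        (ENNReal.ofReal (2 ^ n) * volume (ball (0 : RSpace n) 1) * A) := by
    intro k
    set s : ℝ := 2 ^ k * (2 * ρ) with hs
    have hs0 : 0 < s := by positivity
    have h2s : 2 ^ (k + 1) * (2 * ρ) = 2 * s := by rw [hs, pow_succ]; ring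
    have hρs : ρ ≤ 2 * s := by
      have : (1 : ℝ) ≤ 2 ^ k := one_le_pow₀ (by norm_num)
      nlinarith
    rw [h2s]
    calc _ ≤ ∫⁻ z in ball c (2 * s) \ ball c s,
          ENNReal.ofReal (θ ((1 / 2) ^ (k + 1)) / s ^ n) * h z := by
          refine setLIntegral_mono' (measurableSet_ball.diff measurableSet_ball) fun z hz => ?_
          have hz2 : s ≤ ‖z - c‖ := by
            have := hz.2
            rwa [mem_ball, not_lt, dist_eq_norm] at this
          have hz0 : 0 < ‖z - c‖ := hs0.trans_le hz2
          gcongr ENNReal.ofReal ?_ * _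
          refine div_le_div₀ (hθ.nonneg _ (by positivity)) (hθ.monotone ?_ ?_ ?_) (by positivity)
            (by gcongr)
          · exact mem_Ioi.2 (by positivity)
          · exact mem_Ioi.2 (by positivity)
          · rw [div_le_iff₀ hz0]
            calc ρ = (1 / 2) ^ (k + 1) * s := by
                  rw [hs, pow_succ, div_pow]; field_simp; simp
              _ ≤ _ := by gcongr
      _ = ENNReal.ofReal (θ ((1 / 2) ^ (k + 1)) / s ^ n) * ∫⁻ z in ball c (2 * s) \ ball c s, h z :=
          lintegral_const_mul' _ _ (by finiteness)
      _ ≤ ENNReal.ofReal (θ ((1 / 2) ^ (k + 1)) / s ^ n) * (A * volume (ball c (2 * s))) := by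
          gcongr
          exact (lintegral_mono_set sdiff_subset).trans (hA _ hρs)
      _ = _ := by
          have e : 2 * s = (2 * s) * 1 := by ring
          rw [e, volume_ball_mul c 0 (by positivity), mul_pow 2 s n, ENNReal.ofReal_mul (by positivity),
            div_eq_mul_inv, ENNReal.ofReal_mul (hθ.nonneg _ (by positivity)),
            ENNReal.ofReal_inv_of_pos (by positivity)]
          have hne : ENNReal.ofReal (s ^ n) ≠ 0 := by
            have : 0 < s ^ n := by positivity
            simpa using this
          rw [show ∀ a b c d e v : ℝ≥0∞, a * b * (c * (d * e * v)) = a * (d * v * c) * (b * e) by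
            intros; ring, ENNReal.inv_mul_cancel hne ENNReal.ofReal_ne_top, mul_one]
  refine (ENNReal.tsum_le_tsum hterm).trans ?_
  rw [ENNReal.tsum_mul_right, diniSum]
  exact le_of_eq (by ring)

/-! ### Kernel estimates -/

namespace IsThetaKernel

variable {n : ℕ} {θ : ℝ → ℝ} {K : RSpace n → RSpace n → ℂ}

/-- The form in which regularity is used: |x - c| < ρ ≤ |z - c|/2 is the separation required of the
kernel, and monotonicity replaces |x - c| by ρ inside θ. -/
theorem exists_bounds (hK : IsThetaKernel θ K) (hθ : IsDiniModulus θ) : ∃ C : ℝ, 0 ≤ C ∧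
    (∀ x y : RSpace n, x ≠ y → ‖K x y‖ ≤ C / ‖x - y‖ ^ n) ∧
    (∀ c x z : RSpace n, ∀ ρ : ℝ, x ∈ ball c ρ → z ∉ ball c (2 * ρ) →
      ‖K x z - K c z‖ₑ ≤
        ENNReal.ofReal C * ENNReal.ofReal (θ (ρ / ‖z - c‖) / ‖z - c‖ ^ n) ∧
      ‖K z x - K z c‖ₑ ≤
        ENNReal.ofReal C * ENNReal.ofReal (θ (ρ / ‖z - c‖) / ‖z - c‖ ^ n)) := by
  obtain ⟨C, hC1, hC2⟩ := hK.bounds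
  refine ⟨max C 0, le_max_right _ _, fun x y hxy => (hC1 x y hxy).trans ?_,
    fun c x z ρ hx hz => ?_⟩
  · gcongr; exact le_max_left _ _
  have hρ : 0 < ρ := pos_of_mem_ball hx
  rw [mem_ball, dist_eq_norm] at hx
  rw [mem_ball, not_lt, dist_eq_norm] at hz
  have hz0 : 0 < ‖z - c‖ := by linarith
  by_cases hxc : c = x
  · subst hxc; simp
  have hcx : 0 < ‖c - x‖ := norm_pos_iff.2 (sub_ne_zero.2 hxc)
  have h := hC2 c z x hxc (by rw [norm_sub_rev c x, norm_sub_rev c z]; linarith)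
  rw [norm_sub_rev c z, norm_sub_rev c x, norm_sub_rev (K c z), norm_sub_rev (K z c)] at h
  rw [norm_sub_rev c x] at hcx
  have hθ0 : 0 ≤ θ (‖x - c‖ / ‖z - c‖) := hθ.nonneg _ (by positivity)
  have hmono : θ (‖x - c‖ / ‖z - c‖) ≤ θ (ρ / ‖z - c‖) :=
    hθ.monotone (mem_Ioi.2 (by positivity)) (mem_Ioi.2 (by positivity)) (by gcongr)
  have h' : ‖K x z - K c z‖ + ‖K z x - K z c‖ ≤
      max C 0 * (θ (ρ / ‖z - c‖) / ‖z - c‖ ^ n) := by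
    refine h.trans ?_
    calc C / ‖z - c‖ ^ n * θ (‖x - c‖ / ‖z - c‖)
        ≤ max C 0 / ‖z - c‖ ^ n * θ (ρ / ‖z - c‖) := by
          gcongr; exact le_max_left _ _
      _ = _ := by ring
  rw [← ENNReal.ofReal_mul (le_max_right _ _), ← ofReal_norm, ← ofReal_norm]
  constructor
  · exact ENNReal.ofReal_le_ofReal (le_trans (le_add_of_nonneg_right (norm_nonneg _)) h')
  · exact ENNReal.ofReal_le_ofReal (le_trans (le_add_of_nonneg_left (norm_nonneg _)) h')

/-- A jointly measurable function that agrees with the kernel off the diagonal. -/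
theorem exists_measurable (hK : IsThetaKernel θ K) :
    ∃ K' : RSpace n × RSpace n → ℂ, Measurable K' ∧ ∀ x y, x ≠ y → K' (x, y) = K x y := by
  have hs : MeasurableSet {z : RSpace n × RSpace n | z.1 ≠ z.2} :=
    (measurableSet_eq_fun measurable_fst measurable_snd).compl
  classical
  refine ⟨fun z => if h : z.1 ≠ z.2 then K z.1 z.2 else 0, ?_, fun x y hxy => by simp [hxy]⟩
  exact Measurable.dite (s := {z : RSpace n × RSpace n | z.1 ≠ z.2})
    (f := fun z => K z.1.1 z.1.2) (g := fun _ => 0) hK.measurable measurable_const hs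

theorem aestronglyMeasurable (hn : 1 ≤ n) (hK : IsThetaKernel θ K) (x : RSpace n) :
    AEStronglyMeasurable (K x) volume := by
  obtain ⟨K', hK', hKK'⟩ := hK.exists_measurable
  have : Nonempty (Fin n) := ⟨⟨0, hn⟩⟩
  refine ⟨fun y => K' (x, y), (hK'.comp measurable_prodMk_left).stronglyMeasurable, ?_⟩
  have h0 : ∀ᵐ y : RSpace n, y ≠ x := by
    rw [ae_iff]; simp
  filter_upwards [h0] with y hy
  exact (hKK' x y hy.symm).symm

/-- Here |x - z| ≥ |z - c|/3, by the triangle inequality. The radius 3/2 ρ, rather than 2ρ, leaves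
room for smooth cutoffs between the two. -/
theorem enorm_le_of_notMem (hK : ∃ C : ℝ, 0 ≤ C ∧
    ∀ x y : RSpace n, x ≠ y → ‖K x y‖ ≤ C / ‖x - y‖ ^ n) :
    ∃ C : ℝ≥0, ∀ c x z : RSpace n, ∀ ρ : ℝ, x ∈ ball c ρ → z ∉ ball c (3 / 2 * ρ) →
      ‖K x z‖ₑ ≤ C * ENNReal.ofReal (1 / ‖z - c‖ ^ n) := by
  obtain ⟨C, hC0, hC⟩ := hK
  refine ⟨(C * 3 ^ n).toNNReal, fun c x z ρ hx hz => ?_⟩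
  have hρ : 0 < ρ := pos_of_mem_ball hx
  rw [mem_ball, dist_eq_norm] at hx
  rw [mem_ball, not_lt, dist_eq_norm] at hz
  have hz0 : 0 < ‖z - c‖ := by linarith
  have htri : ‖z - c‖ ≤ ‖x - z‖ + ‖x - c‖ := by
    calc ‖z - c‖ = ‖(x - c) - (x - z)‖ := by congr 1; abel
      _ ≤ ‖x - c‖ + ‖x - z‖ := norm_sub_le _ _
      _ = _ := add_comm _ _
  have h3 : ‖z - c‖ / 3 ≤ ‖x - z‖ := by linarith
  have hne : x ≠ z := by
    rintro rfl
    rw [sub_self, norm_zero] at h3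
    linarith
  rw [← ENNReal.ofReal_coe_nnreal, ← ENNReal.ofReal_mul (by positivity), ← ofReal_norm]
  apply ENNReal.ofReal_le_ofReal
  rw [Real.coe_toNNReal _ (by positivity)]
  calc ‖K x z‖ ≤ C / ‖x - z‖ ^ n := hC x z hne
    _ ≤ C / (‖z - c‖ / 3) ^ n := by gcongr
    _ = _ := by rw [div_pow]; field_simp

end IsThetaKernel

end

section

/-! ### Operators on `L²` acting on functions -/

section L2Apply

variable {n : ℕ} {T₂ : Lp ℂ 2 (volume : Measure (RSpace n)) →L[ℂ] Lp ℂ 2 (volume : Measure (RSpace n))}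
  {f g : RSpace n → ℂ}

open Classical in
/-- The value of an operator on `L²` at a square integrable function (and `0` elsewhere). -/
noncomputable def l2Apply
    (T₂ : Lp ℂ 2 (volume : Measure (RSpace n)) →L[ℂ] Lp ℂ 2 (volume : Measure (RSpace n)))
    (f : RSpace n → ℂ) : RSpace n → ℂ :=
  if h : MemLp f 2 volume then T₂ (h.toLp f) else 0

theorem l2Apply_of_memLp (hf : MemLp f 2 volume) : l2Apply T₂ f = T₂ (hf.toLp f) := by
  rw [l2Apply, dif_pos hf]

theorem l2Apply_schwartz (φ : 𝓢(RSpace n, ℂ)) : l2Apply T₂ φ = T₂ (φ.toLp 2 volume) :=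
  l2Apply_of_memLp (φ.memLp 2 volume)

theorem stronglyMeasurable_l2Apply : StronglyMeasurable (l2Apply T₂ f) := by
  unfold l2Apply
  split_ifs with h
  · exact Lp.stronglyMeasurable _
  · exact stronglyMeasurable_zero

theorem l2Apply_add (hf : MemLp f 2 volume) (hg : MemLp g 2 volume) :
    l2Apply T₂ (f + g) =ᵐ[volume] l2Apply T₂ f + l2Apply T₂ g := by
  rw [l2Apply_of_memLp hf, l2Apply_of_memLp hg, l2Apply_of_memLp (hf.add hg), MemLp.toLp_add,
    map_add]
  exact Lp.coeFn_add _ _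

theorem l2Apply_sub (hf : MemLp f 2 volume) (hg : MemLp g 2 volume) :
    l2Apply T₂ (f - g) =ᵐ[volume] l2Apply T₂ f - l2Apply T₂ g := by
  rw [l2Apply_of_memLp hf, l2Apply_of_memLp hg, l2Apply_of_memLp (hf.sub hg), MemLp.toLp_sub,
    map_sub]
  exact Lp.coeFn_sub _ _

theorem l2Apply_zero : l2Apply T₂ (0 : RSpace n → ℂ) =ᵐ[volume] 0 := by
  rw [l2Apply_of_memLp MemLp.zero, MemLp.toLp_zero, map_zero]
  exact Lp.coeFn_zero _ _ _

theorem l2Apply_sum {ι : Type*} (s : Finset ι) {F : ι → RSpace n → ℂ}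
    (hF : ∀ i ∈ s, MemLp (F i) 2 volume) :
    l2Apply T₂ (∑ i ∈ s, F i) =ᵐ[volume] ∑ i ∈ s, l2Apply T₂ (F i) := by
  classical
  induction s using Finset.induction_on with
  | empty => simpa using l2Apply_zero
  | insert a s ha ih =>
    rw [Finset.sum_insert ha, Finset.sum_insert ha]
    have h1 := hF a (Finset.mem_insert_self _ _)
    have h2 : ∀ i ∈ s, MemLp (F i) 2 volume := fun i hi => hF i (Finset.mem_insert_of_mem hi)
    refine (l2Apply_add h1 (memLp_finsetSum' s h2)).trans ?_
    filter_upwards [ih h2] with x hx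
    simp only [Pi.add_apply, hx]

theorem eLpNorm_l2Apply_le (f : RSpace n → ℂ) :
    eLpNorm (l2Apply T₂ f) 2 volume ≤ ‖T₂‖ₑ * eLpNorm f 2 volume := by
  by_cases hf : MemLp f 2 volume
  · rw [l2Apply_of_memLp hf, ← Lp.enorm_def, ← Lp.enorm_toLp hf]
    exact T₂.le_opENorm _
  · rw [l2Apply, dif_neg hf, eLpNorm_zero]
    exact zero_le

end L2Apply

/-! ### Approximation by test functions -/

/-- Multiplying any smooth approximant g by η costs nothing: ηg - h = η(g - h) and |η| ≤ 1. The
approximants then vanish wherever η does. -/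
theorem exists_testFunction_tendsto {n : ℕ} {μ : Measure (RSpace n)} [IsFiniteMeasureOnCompacts μ]
    {p : ℝ≥0∞} (hp : p ≠ ∞) (hp1 : 1 ≤ p) {h : RSpace n → ℂ} (hh : MemLp h p μ) {η : RSpace n → ℝ}
    (hη : ContDiff ℝ ((⊤ : ℕ∞) : WithTop ℕ∞) η) (hη1 : ∀ x, |η x| ≤ 1)
    (hηh : ∀ x, (η x : ℂ) * h x = h x) :
    ∃ φ : ℕ → 𝓢(RSpace n, ℂ), (∀ k, HasCompactSupport (φ k)) ∧ (∀ k x, η x = 0 → φ k x = 0) ∧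
      Tendsto (fun k => eLpNorm (fun x => φ k x - h x) p μ) atTop (𝓝 0) := by
  have hex : ∀ k : ℕ, ∃ φ : 𝓢(RSpace n, ℂ), HasCompactSupport φ ∧ (∀ x, η x = 0 → φ x = 0) ∧
      eLpNorm (fun x => φ x - h x) p μ ≤ ENNReal.ofReal (1 / (k + 1)) := by
    intro k
    obtain ⟨g, hg1, hg2, hg3⟩ := hh.exist_eLpNorm_sub_le hp hp1 (ε := 1 / (k + 1)) (by positivity)
    have hs1 : HasCompactSupport fun x => (η x : ℂ) * g x := hg1.mul_left
    have hs2 : ContDiff ℝ ((⊤ : ℕ∞) : WithTop ℕ∞) fun x => (η x : ℂ) * g x :=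
      (Complex.ofRealCLM.contDiff.comp hη).mul hg2
    refine ⟨hs1.toSchwartzMap hs2, ?_, fun x hx => ?_, le_trans ?_ hg3⟩
    · exact hs1
    · simp [hx]
    · refine eLpNorm_mono_ae (Eventually.of_forall fun x => ?_)
      have : (η x : ℂ) * g x - h x = η x * (g x - h x) := by rw [mul_sub, hηh]
      rw [HasCompactSupport.toSchwartzMap_toFun, this, norm_mul, Pi.sub_apply, norm_sub_rev (h x)]
      have h1 : ‖(η x : ℂ)‖ ≤ 1 := by simpa using hη1 x
      exact mul_le_of_le_one_left (norm_nonneg _) h1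
  choose φ hφ1 hφ2 hφ3 using hex
  refine ⟨φ, hφ1, hφ2, ?_⟩
  refine tendsto_of_tendsto_of_tendsto_of_le_of_le tendsto_const_nhds ?_ (fun k => zero_le) hφ3
  rw [← ENNReal.ofReal_zero]
  exact ENNReal.tendsto_ofReal tendsto_one_div_add_atTop_nhds_zero_nat

/-- A smooth cutoff function vanishing on `ball c (3 / 2 * r)` and equal to `1` off
`ball c (2 * r)`. -/
theorem exists_cutoff_compl {n : ℕ} (c : RSpace n) {r : ℝ} (hr : 0 < r) :
    ∃ η : RSpace n → ℝ, ContDiff ℝ ((⊤ : ℕ∞) : WithTop ℕ∞) η ∧ (∀ x, |η x| ≤ 1) ∧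
      (∀ x ∈ ball c (3 / 2 * r), η x = 0) ∧ ∀ x ∉ ball c (2 * r), η x = 1 := by
  let b : ContDiffBump c := ⟨3 / 2 * r, 2 * r, by positivity, by linarith⟩
  refine ⟨fun x => 1 - b x, contDiff_const.sub b.contDiff, fun x => ?_, fun x hx => ?_,
    fun x hx => ?_⟩
  · rw [abs_le]
    constructor <;> linarith [b.nonneg (x := x), b.le_one (x := x)]
  · show 1 - b x = 0
    rw [b.one_of_mem_closedBall (ball_subset_closedBall hx), sub_self]
  · have : b x = 0 := b.zero_of_le_dist (by simpa using hx)
    show 1 - b x = 1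
    rw [this, sub_zero]

/-- A smooth cutoff function vanishing off `ball c (2 * r)` and equal to `1` on `ball c r`. -/
theorem exists_cutoff {n : ℕ} (c : RSpace n) {r : ℝ} (hr : 0 < r) :
    ∃ η : RSpace n → ℝ, ContDiff ℝ ((⊤ : ℕ∞) : WithTop ℕ∞) η ∧ (∀ x, |η x| ≤ 1) ∧
      (∀ x ∈ ball c r, η x = 1) ∧ ∀ x ∉ ball c (2 * r), η x = 0 := by
  let b : ContDiffBump c := ⟨r, 2 * r, by positivity, by linarith⟩
  refine ⟨b, b.contDiff, fun x => ?_, fun x hx => ?_, fun x hx => ?_⟩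
  · rw [abs_le]
    constructor <;> linarith [b.nonneg (x := x), b.le_one (x := x)]
  · exact b.one_of_mem_closedBall (ball_subset_closedBall hx)
  · exact b.zero_of_le_dist (by simpa using hx)

/-! ### The kernel representation off the support -/

namespace IsThetaCZO

variable {n : ℕ} {θ : ℝ → ℝ} {T : 𝓢(RSpace n, ℂ) →ₗ[ℂ] 𝓢'(RSpace n, ℂ)}
  {T₂ : Lp ℂ 2 (volume : Measure (RSpace n)) →L[ℂ] Lp ℂ 2 (volume : Measure (RSpace n))}
  {K : RSpace n → RSpace n → ℂ}

/-- For test functions vanishing on the 3/2 ρ-ball the representation holds on the ρ-ball, which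
stays clear of their closed supports. On that ball |K(x, z)| is dominated by |z - c|^(-n), so
convergence in this weighted L¹ passes to the kernel integrals. It serves both L² and L^p(w) limits.
-/
theorem ae_eq_integral_of_tendsto (hT : IsThetaCZO θ T T₂ K) (hθ : IsDiniModulus θ) (hn : 1 ≤ n)
    {c : RSpace n} {ρ : ℝ} (hρ : 0 < ρ) {φ : ℕ → 𝓢(RSpace n, ℂ)}
    (hφ : ∀ k, HasCompactSupport (φ k)) (hφ0 : ∀ k, ∀ x ∈ ball c (3 / 2 * ρ), φ k x = 0)
    {h g : RSpace n → ℂ} (hh : AEStronglyMeasurable h volume)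
    (hh0 : ∀ x ∈ ball c (3 / 2 * ρ), h x = 0)
    (hlim : Tendsto (fun k => ∫⁻ z in (ball c (3 / 2 * ρ))ᶜ,
      ENNReal.ofReal (1 / ‖z - c‖ ^ n) * ‖φ k z - h z‖ₑ) atTop (𝓝 0))
    (hg : ∀ᵐ x, x ∈ ball c ρ → Tendsto (fun k => l2Apply T₂ (φ k) x) atTop (𝓝 (g x))) :
    ∀ᵐ x, x ∈ ball c ρ → Integrable (fun z => K x z * h z) volume ∧ g x = ∫ z, K x z * h z := by
  obtain ⟨C₀, hC₀, hC1, -⟩ := hT.isThetaKernel.exists_bounds hθ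
  obtain ⟨C, hC⟩ := IsThetaKernel.enorm_le_of_notMem ⟨C₀, hC₀, hC1⟩
  have hrepr : ∀ᵐ x, ∀ k, x ∉ tsupport (φ k) → T₂ ((φ k).toLp 2 volume) x = ∫ y, K x y * φ k y :=
    ae_all_iff.2 fun k => hT.repr (φ k) (hφ k)
  filter_upwards [hrepr, hg] with x hx hgx hxc
  have hsupp : ∀ k, x ∉ tsupport (φ k) := by
    intro k hxk
    have hsub : tsupport (φ k) ⊆ (ball c (3 / 2 * ρ))ᶜ := by
      refine closure_minimal (fun z hz hz' => hz (hφ0 k z hz')) isOpen_ball.isClosed_compl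
    exact hsub hxk (ball_subset_ball (by linarith) hxc)
  have hKm := hT.isThetaKernel.aestronglyMeasurable hn x
  have hbound : ∀ u : RSpace n → ℂ, (∀ z ∈ ball c (3 / 2 * ρ), u z = 0) →
      ∫⁻ z, ‖K x z * u z‖ₑ ≤
        C * ∫⁻ z in (ball c (3 / 2 * ρ))ᶜ, ENNReal.ofReal (1 / ‖z - c‖ ^ n) * ‖u z‖ₑ := by
    intro u hu
    rw [← lintegral_const_mul' _ _ ENNReal.coe_ne_top,
      ← lintegral_indicator measurableSet_ball.compl]
    refine lintegral_mono fun z => ?_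
    by_cases hz : z ∈ ball c (3 / 2 * ρ)
    · simp [hu z hz]
    · rw [indicator_of_mem (by exact hz), enorm_mul, ← mul_assoc]
      gcongr
      exact hC c x z ρ hxc hz
  have hdiff : ∀ k, ∀ z ∈ ball c (3 / 2 * ρ), φ k z - h z = 0 := fun k z hz => by
    rw [hφ0 k z hz, hh0 z hz, sub_zero]
  have hφint : ∀ k, Integrable (fun z => K x z * φ k z) volume := by
    intro k
    refine ⟨hKm.mul (φ k).continuous.aestronglyMeasurable, ?_⟩
    refine (hbound (φ k) (hφ0 k)).trans_lt (ENNReal.mul_lt_top ENNReal.coe_lt_top ?_)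
    calc ∫⁻ z in (ball c (3 / 2 * ρ))ᶜ, ENNReal.ofReal (1 / ‖z - c‖ ^ n) * ‖φ k z‖ₑ
        ≤ ∫⁻ z in (ball c (3 / 2 * ρ))ᶜ, ENNReal.ofReal (1 / ρ ^ n) * ‖φ k z‖ₑ := by
          refine setLIntegral_mono' measurableSet_ball.compl fun z hz => ?_
          rw [mem_compl_iff, mem_ball, not_lt, dist_eq_norm] at hz
          gcongr
          linarith
      _ ≤ ENNReal.ofReal (1 / ρ ^ n) * ∫⁻ z, ‖φ k z‖ₑ := by
          rw [lintegral_const_mul' _ _ ENNReal.ofReal_ne_top]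
          gcongr
          exact Measure.restrict_le_self
      _ < ∞ := ENNReal.mul_lt_top ENNReal.ofReal_lt_top (φ k).integrable.2
  have hdlim : Tendsto (fun k => ∫⁻ z, ‖K x z * (φ k z - h z)‖ₑ) atTop (𝓝 0) := by
    have := ENNReal.Tendsto.const_mul hlim (Or.inr (ENNReal.coe_ne_top (r := C)))
    rw [mul_zero] at this
    exact tendsto_of_tendsto_of_tendsto_of_le_of_le tendsto_const_nhds this (fun k => zero_le)
      fun k => hbound _ (hdiff k)
  have hKh : AEStronglyMeasurable (fun z => K x z * h z) volume := hKm.mul hh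
  obtain ⟨k, hk⟩ := (hdlim.eventually_lt_const ENNReal.zero_lt_top).exists
  have hint : Integrable (fun z => K x z * h z) volume := by
    have h1 : Integrable (fun z => K x z * (φ k z - h z)) volume :=
      ⟨hKm.mul ((φ k).continuous.aestronglyMeasurable.sub hh), hk⟩
    refine ((hφint k).sub h1).congr (Eventually.of_forall fun z => ?_)
    simp only [Pi.sub_apply]; ring
  refine ⟨hint, tendsto_nhds_unique (hgx hxc) ?_⟩
  have hlim2 := tendsto_integral_of_L1 (fun z => K x z * h z) hint.aestronglyMeasurable (F := fun k z => K x z * φ k z)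
    (l := atTop) (Eventually.of_forall hφint)
    (hdlim.congr fun k => lintegral_congr fun z => by rw [mul_sub])
  refine hlim2.congr fun k => ?_
  rw [l2Apply_schwartz, hx k (hsupp k)]

/-- The annulus of index k contributes at most a multiple of 2^(-nk) ≤ 2^(-k). Through
Cauchy–Schwarz this turns L² convergence into the weighted L¹ convergence needed above. -/
theorem lintegral_norm_pow_ne_top {n : ℕ} (hn : 1 ≤ n) (c : RSpace n) {r : ℝ} (hr : 0 < r) :
    ∫⁻ z in (ball c r)ᶜ, ENNReal.ofReal (1 / ‖z - c‖ ^ n) ^ (2 : ℝ) ≠ ∞ := by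
  refine ne_top_of_le_ne_top ?_ (lintegral_compl_ball_le_tsum c hr _)
  have hterm : ∀ k : ℕ, ∫⁻ z in ball c (2 ^ (k + 1) * r) \ ball c (2 ^ k * r),
      ENNReal.ofReal (1 / ‖z - c‖ ^ n) ^ (2 : ℝ) ≤
      (1 / 2) ^ k * (ENNReal.ofReal ((2 / r) ^ n) * volume (ball (0 : RSpace n) 1)) := by
    intro k
    set s : ℝ := 2 ^ k * r with hs
    have hs0 : 0 < s := by positivity
    have h2s : 2 ^ (k + 1) * r = (2 * s) * 1 := by rw [hs, pow_succ]; ring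
    rw [h2s]
    calc _ ≤ ∫⁻ z in ball c (2 * s * 1) \ ball c s, ENNReal.ofReal (1 / s ^ n) ^ (2 : ℝ) := by
          refine setLIntegral_mono' (measurableSet_ball.diff measurableSet_ball) fun z hz => ?_
          have hz2 : s ≤ ‖z - c‖ := by
            have := hz.2
            rwa [mem_ball, not_lt, dist_eq_norm] at this
          gcongr
      _ ≤ ENNReal.ofReal (1 / s ^ n) ^ (2 : ℝ) * volume (ball c (2 * s * 1)) := by
          rw [setLIntegral_const]
          gcongr
          exact sdiff_subset
      _ = ENNReal.ofReal ((1 / 2 ^ n) ^ k * (2 / r) ^ n) * volume (ball (0 : RSpace n) 1) := by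
          rw [volume_ball_mul c 0 (by positivity), ← mul_assoc]
          congr 1
          rw [ENNReal.rpow_ofNat, ← ENNReal.ofReal_pow (by positivity),
            ← ENNReal.ofReal_mul (by positivity)]
          congr 1
          have e : (2 : ℝ) ^ n ≠ 0 := by positivity
          have e2 : ((2 : ℝ) ^ k) ^ n = (2 ^ n) ^ k := by rw [← pow_mul, ← pow_mul, mul_comm]
          rw [hs, mul_pow, mul_pow, mul_pow, e2, div_pow, div_pow]
          field_simp
          simp only [one_pow, div_pow]
          field_simp
      _ ≤ _ := by
          rw [ENNReal.ofReal_mul (by positivity), mul_assoc]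
          gcongr
          rw [ENNReal.ofReal_pow (by positivity)]
          gcongr
          rw [ENNReal.ofReal_div_of_pos (by positivity), ENNReal.ofReal_one]
          gcongr
          rw [← ENNReal.ofReal_ofNat]
          apply ENNReal.ofReal_le_ofReal
          calc (OfNat.ofNat 2 : ℝ) = 2 ^ 1 := by norm_num
            _ ≤ 2 ^ n := pow_le_pow_right₀ (by norm_num) hn
  refine ne_top_of_le_ne_top ?_ (ENNReal.tsum_le_tsum hterm)
  rw [ENNReal.tsum_mul_right, ENNReal.tsum_geometric]
  have := volume_ball_ne_top (0 : RSpace n) 1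
  have h1 : (1 - 1 / 2 : ℝ≥0∞)⁻¹ ≠ ∞ := by
    rw [ENNReal.inv_ne_top, one_div]
    exact (tsub_pos_of_lt ENNReal.one_half_lt_one).ne'
  finiteness

/-- Approximants cut off near c converge in L²; boundedness of the operator and a subsequence give
convergence of the images a.e., and Cauchy–Schwarz gives convergence of the kernel integrals. -/
theorem l2Apply_eq_integral_ball (hT : IsThetaCZO θ T T₂ K) (hθ : IsDiniModulus θ) (hn : 1 ≤ n)
    {c : RSpace n} {ρ : ℝ} (hρ : 0 < ρ) {h : RSpace n → ℂ} (hh : MemLp h 2 volume)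
    (hh0 : ∀ x ∈ ball c (2 * ρ), h x = 0) :
    ∀ᵐ x, x ∈ ball c ρ → Integrable (fun z => K x z * h z) volume ∧
      l2Apply T₂ h x = ∫ z, K x z * h z := by
  obtain ⟨η, hη, hη1, hη0, hη2⟩ := exists_cutoff_compl c hρ
  obtain ⟨φ, hφ, hφ0, hlim⟩ := exists_testFunction_tendsto (by norm_num) (by norm_num) hh hη hη1
    (fun x => by
      by_cases hx : x ∈ ball c (2 * ρ)
      · simp [hh0 x hx]
      · simp [hη2 x hx])
  have hTlim : Tendsto (fun k => eLpNorm (l2Apply T₂ (φ k) - l2Apply T₂ h) 2 volume)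
      atTop (𝓝 0) := by
    have := ENNReal.Tendsto.const_mul hlim (Or.inr (enorm_ne_top (x := T₂)))
    rw [mul_zero] at this
    refine tendsto_of_tendsto_of_tendsto_of_le_of_le tendsto_const_nhds this (fun k => zero_le)
      fun k => ?_
    rw [← eLpNorm_congr_ae (l2Apply_sub ((φ k).memLp 2 volume) hh)]
    exact eLpNorm_l2Apply_le _
  obtain ⟨ns, hns, hae⟩ := (tendstoInMeasure_of_tendsto_eLpNorm (by norm_num)
    (fun k => stronglyMeasurable_l2Apply.aestronglyMeasurable)
    stronglyMeasurable_l2Apply.aestronglyMeasurable hTlim).exists_seq_tendsto_ae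
  refine ae_eq_integral_of_tendsto hT hθ hn hρ (φ := fun k => φ (ns k)) (fun k => hφ _)
    (fun k x hx => hφ0 _ x (hη0 x hx)) hh.1
    (fun x hx => hh0 x (ball_subset_ball (by linarith) hx)) ?_ (hae.mono fun x hx _ => hx)
  have hA := lintegral_norm_pow_ne_top hn c (r := 3 / 2 * ρ) (by positivity)
  set A := ∫⁻ z in (ball c (3 / 2 * ρ))ᶜ, ENNReal.ofReal (1 / ‖z - c‖ ^ n) ^ (2 : ℝ)
  have hlim' := ENNReal.Tendsto.const_mul (hlim.comp hns.tendsto_atTop)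
    (Or.inr (ENNReal.rpow_ne_top_of_nonneg (by norm_num : (0 : ℝ) ≤ 1 / 2) hA))
  rw [mul_zero] at hlim'
  refine tendsto_of_tendsto_of_tendsto_of_le_of_le tendsto_const_nhds hlim' (fun k => zero_le)
    fun k => ?_
  have hm : AEMeasurable (fun z => ‖φ (ns k) z - h z‖ₑ) volume :=
    ((φ (ns k)).continuous.aestronglyMeasurable.sub hh.1).enorm
  have hH := ENNReal.lintegral_mul_le_Lp_mul_Lq (volume.restrict (ball c (3 / 2 * ρ))ᶜ)
    (by norm_num [Real.holderConjugate_iff] : (2 : ℝ).HolderConjugate 2)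
    (f := fun z => ENNReal.ofReal (1 / ‖z - c‖ ^ n)) (by fun_prop) hm.restrict
  refine hH.trans ?_
  simp only [Function.comp]
  gcongr
  rw [eLpNorm_eq_lintegral_rpow_enorm_toReal (by norm_num) (by norm_num)]
  simp only [ENNReal.toReal_ofNat]
  gcongr
  exact Measure.restrict_le_self

/-- Off the support of a square integrable function the operator is given by its kernel. -/
theorem l2Apply_eq_integral (hT : IsThetaCZO θ T T₂ K) (hθ : IsDiniModulus θ) (hn : 1 ≤ n)
    {U : Set (RSpace n)} (hU : IsOpen U) {h : RSpace n → ℂ} (hh : MemLp h 2 volume)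
    (hh0 : ∀ x ∈ U, h x = 0) :
    ∀ᵐ x, x ∈ U → Integrable (fun z => K x z * h z) volume ∧
      l2Apply T₂ h x = ∫ z, K x z * h z := by
  have hex : ∀ x : U, ∃ r > 0, ball x.1 (2 * r) ⊆ U := fun x => by
    obtain ⟨r, hr, hrU⟩ := Metric.isOpen_iff.1 hU x.1 x.2
    exact ⟨r / 2, by positivity, by rwa [mul_div_cancel₀ r two_ne_zero]⟩
  choose r hr hrU using hex
  -- Lindelöf: countably many balls suffice, so the exceptional null sets may be united.
  obtain ⟨s, hs, hcov⟩ := TopologicalSpace.isOpen_iUnion_countable (fun x : U => ball x.1 (r x))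
    fun _ => isOpen_ball
  have : ∀ᵐ x, ∀ a ∈ s, x ∈ ball a.1 (r a) → Integrable (fun z => K x z * h z) volume ∧
      l2Apply T₂ h x = ∫ z, K x z * h z :=
    (ae_ball_iff hs).2 fun a _ =>
      l2Apply_eq_integral_ball hT hθ hn (hr a) hh fun x hx => hh0 x (hrU a hx)
  filter_upwards [this] with x hx hxU
  have hmem : x ∈ ⋃ a ∈ s, ball a.1 (r a) := by
    rw [hcov]
    exact mem_iUnion.2 ⟨⟨x, hxU⟩, mem_ball_self (hr _)⟩
  obtain ⟨a, ha, hxa⟩ := mem_iUnion₂.1 hmem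
  exact hx a ha hxa

end IsThetaCZO

end

section

/-! ### The Calderón–Zygmund decomposition and the weak type `(1, 1)` bound -/

namespace DyadicCube

variable {n : ℕ}

/-- The part of `f` on the cube `Q`, with its mean subtracted. -/
noncomputable def oscillation (f : RSpace n → ℂ) (Q : DyadicCube n) : RSpace n → ℂ :=
  Q.cell.indicator fun x => f x - ⨍ y in Q.cell, f y

theorem enorm_average_mul_le (f : RSpace n → ℂ) (Q : DyadicCube n) :
    ‖⨍ y in Q.cell, f y‖ₑ * volume Q.cell ≤ ∫⁻ y in Q.cell, ‖f y‖ₑ := by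
  have hv0 := volume_cell_ne_zero Q
  have hvt := volume_cell_ne_top Q
  rw [setAverage_eq, enorm_smul]
  have : ‖(volume.real Q.cell)⁻¹‖ₑ = (volume Q.cell)⁻¹ := by
    rw [Real.enorm_eq_ofReal (by positivity), measureReal_def,
      ENNReal.ofReal_inv_of_pos (ENNReal.toReal_pos hv0 hvt), ENNReal.ofReal_toReal hvt]
  rw [this, mul_comm, ← mul_assoc, ENNReal.mul_inv_cancel hv0 hvt, one_mul]
  exact enorm_integral_le_lintegral_enorm _

theorem memLp_oscillation {f : RSpace n → ℂ} (hf : MemLp f 2 volume) (Q : DyadicCube n) :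
    MemLp (oscillation f Q) 2 volume := by
  have : oscillation f Q = Q.cell.indicator f - Q.cell.indicator fun _ => ⨍ y in Q.cell, f y := by
    rw [oscillation, ← indicator_sub']; rfl
  rw [this]
  exact (hf.indicator Q.measurableSet_cell).sub
    (memLp_indicator_const _ Q.measurableSet_cell _ (Or.inr Q.volume_cell_ne_top))

theorem integral_oscillation {f : RSpace n → ℂ} (hf : Integrable f volume) (Q : DyadicCube n) :
    ∫ x, oscillation f Q x = 0 := by
  have hv0 := volume_cell_ne_zero Q
  have hvt := volume_cell_ne_top Q
  rw [oscillation, integral_indicator Q.measurableSet_cell,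
    integral_sub hf.integrableOn (integrableOn_const hvt), setIntegral_const, setAverage_eq,
    smul_inv_smul₀, sub_self]
  rw [measureReal_def]
  exact (ENNReal.toReal_pos hv0 hvt).ne'

theorem lintegral_oscillation_le (f : RSpace n → ℂ)
    (Q : DyadicCube n) : ∫⁻ x, ‖oscillation f Q x‖ₑ ≤ 2 * ∫⁻ x in Q.cell, ‖f x‖ₑ := by
  have h : ∀ x, ‖oscillation f Q x‖ₑ =
      Q.cell.indicator (fun x => ‖f x - ⨍ y in Q.cell, f y‖ₑ) x := fun x => by
    rw [oscillation, enorm_indicator_eq_indicator_enorm]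
  simp_rw [h]
  rw [lintegral_indicator Q.measurableSet_cell]
  calc _ ≤ ∫⁻ x in Q.cell, (‖f x‖ₑ + ‖⨍ y in Q.cell, f y‖ₑ) := by
        gcongr with x; exact enorm_sub_le
    _ = (∫⁻ x in Q.cell, ‖f x‖ₑ) + ‖⨍ y in Q.cell, f y‖ₑ * volume Q.cell := by
        rw [lintegral_add_right' _ aemeasurable_const, setLIntegral_const]
    _ ≤ _ := by
        rw [two_mul]; gcongr; exact enorm_average_mul_le f Q

/-- The good part in the Calderón–Zygmund decomposition relative to a family `S` of cubes, with
only the cubes from the finite subfamily `F` taken into account. -/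
noncomputable def goodPart (f : RSpace n → ℂ) (S : Set (DyadicCube n)) (F : Finset S) :
    RSpace n → ℂ :=
  (⋃ Q ∈ S, Q.cell)ᶜ.indicator f +
    ∑ Q ∈ F, Q.1.cell.indicator fun _ => ⨍ y in Q.1.cell, f y

/-- The part of `f` on the cubes from `S` that are not in the finite subfamily `F`. -/
noncomputable def remainderPart (f : RSpace n → ℂ) (S : Set (DyadicCube n)) (F : Finset S) :
    RSpace n → ℂ :=
  (⋃ Q : {Q : S // Q ∉ F}, Q.1.1.cell).indicator f

variable {f : RSpace n → ℂ} {S : Set (DyadicCube n)} {F : Finset S}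

theorem goodPart_apply_of_notMem {x : RSpace n} (hx : x ∉ ⋃ Q ∈ S, Q.cell) :
    goodPart f S F x = f x := by
  have h : ∀ Q ∈ F, Q.1.cell.indicator (fun _ => ⨍ y in Q.1.cell, f y) x = 0 := fun Q _ =>
    indicator_of_notMem (fun h => hx (mem_biUnion Q.2 h)) _
  rw [goodPart, Pi.add_apply, Finset.sum_apply, Finset.sum_eq_zero h, add_zero,
    indicator_of_mem (by exact hx)]

theorem sum_indicator_apply_of_mem {G : Type*} [AddCommMonoid G] (hS : S.PairwiseDisjoint cell)
    (u : S → RSpace n → G) {P : S} {x : RSpace n} (hx : x ∈ P.1.cell) [Decidable (P ∈ F)] :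
    (∑ Q ∈ F, Q.1.cell.indicator (u Q) x) = if P ∈ F then u P x else 0 := by
  have h : ∀ Q ∈ F, Q ≠ P → Q.1.cell.indicator (u Q) x = 0 := fun Q _ hQP =>
    indicator_of_notMem (fun h => Set.disjoint_left.1
      (hS Q.2 P.2 fun e => hQP (Subtype.ext e)) h hx) _
  split_ifs with hP
  · rw [Finset.sum_eq_single_of_mem P hP h, indicator_of_mem hx]
  · exact Finset.sum_eq_zero fun Q hQ => h Q hQ fun e => hP (e ▸ hQ)

/-- Only finitely many cubes are split off, so that linearity of the operator suffices. The
remainder is f itself on the other cubes; its L² norm tends to zero as the finite family grows. -/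
theorem decomposition (hS : S.PairwiseDisjoint cell) (f : RSpace n → ℂ) (F : Finset S) :
    f = goodPart f S F + ∑ Q ∈ F, oscillation f Q.1 + remainderPart f S F := by
  classical
  ext x
  by_cases hx : x ∈ ⋃ Q ∈ S, Q.cell
  · obtain ⟨P, hP, hxP⟩ := mem_iUnion₂.1 hx
    have h1 := sum_indicator_apply_of_mem (F := F) hS (fun Q _ => ⨍ y in Q.1.cell, f y)
      (P := ⟨P, hP⟩) hxP
    have h2 := sum_indicator_apply_of_mem (F := F) hS (fun Q x => f x - ⨍ y in Q.1.cell, f y)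
      (P := ⟨P, hP⟩) hxP
    simp only [Pi.add_apply, goodPart, Finset.sum_apply, oscillation, remainderPart]
    rw [h1, h2, indicator_of_notMem (not_not.2 hx), zero_add]
    by_cases hPF : (⟨P, hP⟩ : S) ∈ F
    · rw [if_pos hPF, if_pos hPF, indicator_of_notMem]
      · ring
      · intro h
        obtain ⟨Q, hQ⟩ := mem_iUnion.1 h
        refine Set.disjoint_left.1 (hS Q.1.2 hP fun e => Q.2 ?_) hQ hxP
        have : Q.1 = ⟨P, hP⟩ := Subtype.ext e
        rwa [this]
    · rw [if_neg hPF, if_neg hPF, indicator_of_mem]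
      · ring
      · exact mem_iUnion.2 ⟨⟨⟨P, hP⟩, hPF⟩, hxP⟩
  · rw [Pi.add_apply, Pi.add_apply, goodPart_apply_of_notMem hx, Finset.sum_apply,
      Finset.sum_eq_zero, remainderPart, indicator_of_notMem]
    · ring
    · intro h
      obtain ⟨Q, hQ⟩ := mem_iUnion.1 h
      exact hx (mem_biUnion Q.1.2 hQ)
    · exact fun Q _ => indicator_of_notMem (fun h => hx (mem_biUnion Q.2 h)) _

theorem measurableSet_biUnion_cell (S : Set (DyadicCube n)) : MeasurableSet (⋃ Q ∈ S, Q.cell) :=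
  MeasurableSet.biUnion (to_countable _) fun Q _ => Q.measurableSet_cell

theorem memLp_goodPart (hf : MemLp f 2 volume) : MemLp (goodPart f S F) 2 volume :=
  (hf.indicator (measurableSet_biUnion_cell S).compl).add (memLp_finsetSum' _ fun Q _ =>
    memLp_indicator_const _ Q.1.measurableSet_cell _ (Or.inr Q.1.volume_cell_ne_top))

theorem memLp_remainderPart (hf : MemLp f 2 volume) : MemLp (remainderPart f S F) 2 volume :=
  hf.indicator (MeasurableSet.iUnion fun Q => Q.1.1.measurableSet_cell)

theorem sum_lintegral_cell_le (hS : S.PairwiseDisjoint cell) (G : RSpace n → ℝ≥0∞) :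
    ∑' Q : S, ∫⁻ x in Q.1.cell, G x ≤ ∫⁻ x, G x := by
  rw [← lintegral_biUnion (to_countable _) (fun Q _ => Q.measurableSet_cell) hS]
  exact setLIntegral_le_lintegral _ _

/-- The good part is at most 2^n t a.e., and its L¹ norm is at most 2 ‖f‖₁: one ‖f‖₁ from the
complement of the cubes, one from the means. -/
theorem lintegral_goodPart_sq_le {t : ℝ≥0∞} (hf : Integrable f volume)
    (hS : S.PairwiseDisjoint cell)
    (hSt : ∀ Q ∈ S, ∫⁻ x in Q.cell, ‖f x‖ₑ ≤ 2 ^ n * t * volume Q.cell)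
    (hft : ∀ᵐ x, x ∉ (⋃ Q ∈ S, Q.cell) → ‖f x‖ₑ ≤ t) :
    ∫⁻ x, ‖goodPart f S F x‖ₑ ^ 2 ≤ 2 ^ n * t * (2 * ∫⁻ x, ‖f x‖ₑ) := by
  classical
  set v : DyadicCube n → ℂ := fun Q => ⨍ y in Q.cell, f y with hv
  have hvt : ∀ Q ∈ S, ‖v Q‖ₑ ≤ 2 ^ n * t := fun Q hQ =>
    (ENNReal.mul_le_mul_iff_left Q.volume_cell_ne_zero Q.volume_cell_ne_top).1
      ((enorm_average_mul_le f Q).trans (hSt Q hQ))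
  have hpt : ∀ᵐ x, ‖goodPart f S F x‖ₑ ^ 2 ≤ 2 ^ n * t *
      (‖f x‖ₑ + ∑ Q ∈ F, Q.1.cell.indicator (fun _ => ‖v Q.1‖ₑ) x) := by
    filter_upwards [hft] with x hx
    by_cases hxS : x ∈ ⋃ Q ∈ S, Q.cell
    · obtain ⟨P, hP, hxP⟩ := mem_iUnion₂.1 hxS
      have h1 := sum_indicator_apply_of_mem (F := F) hS (fun Q _ => v Q.1) (P := ⟨P, hP⟩) hxP
      have h2 := sum_indicator_apply_of_mem (F := F) hS (fun Q _ => ‖v Q.1‖ₑ) (P := ⟨P, hP⟩) hxP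
      have h3 : goodPart f S F x = if (⟨P, hP⟩ : S) ∈ F then v P else 0 := by
        rw [goodPart, Pi.add_apply, indicator_of_notMem (not_not.2 hxS), zero_add,
          Finset.sum_apply]
        exact h1
      rw [h3, h2]
      split_ifs
      · rw [sq]
        gcongr
        · exact hvt P hP
        · exact le_add_self
      · simp
    · rw [goodPart_apply_of_notMem hxS, sq]
      gcongr
      · refine (hx hxS).trans ?_
        exact le_mul_of_one_le_left' (one_le_pow₀ (by norm_num))
      · exact le_self_add
  refine (lintegral_mono_ae hpt).trans ?_
  have hm : ∀ Q ∈ F, Measurable (Q.1.cell.indicator fun _ : RSpace n => ‖v Q.1‖ₑ) := fun Q _ =>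
    measurable_const.indicator Q.1.measurableSet_cell
  have hm' : AEMeasurable (fun x => ‖f x‖ₑ +
      ∑ Q ∈ F, Q.1.cell.indicator (fun _ => ‖v Q.1‖ₑ) x) volume :=
    hf.1.enorm.add (Finset.measurable_fun_sum _ hm).aemeasurable
  rw [lintegral_const_mul'' _ hm', lintegral_add_left' hf.1.enorm,
    lintegral_finsetSum' _ fun Q hQ => (hm Q hQ).aemeasurable, two_mul]
  gcongr
  calc ∑ Q ∈ F, ∫⁻ x, Q.1.cell.indicator (fun _ => ‖v Q.1‖ₑ) x
      ≤ ∑ Q ∈ F, ∫⁻ x in Q.1.cell, ‖f x‖ₑ := by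
        refine Finset.sum_le_sum fun Q hQ => ?_
        rw [lintegral_indicator Q.1.measurableSet_cell, setLIntegral_const]
        exact enorm_average_mul_le f Q.1
    _ ≤ ∑' Q : S, ∫⁻ x in Q.1.cell, ‖f x‖ₑ := ENNReal.sum_le_tsum _
    _ ≤ _ := sum_lintegral_cell_le hS _

theorem lintegral_remainderPart_sq_le :
    ∫⁻ x, ‖remainderPart f S F x‖ₑ ^ 2 ≤ ∑' Q : {Q : S // Q ∉ F}, ∫⁻ x in Q.1.1.cell, ‖f x‖ₑ ^ 2 := by
  refine le_trans (le_of_eq ?_) (lintegral_iUnion_le _ _)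
  rw [← lintegral_indicator (MeasurableSet.iUnion fun Q => Q.1.1.measurableSet_cell)]
  refine lintegral_congr fun x => ?_
  rw [remainderPart, enorm_indicator_eq_indicator_enorm]
  by_cases hx : x ∈ ⋃ Q : {Q : S // Q ∉ F}, Q.1.1.cell
  · rw [indicator_of_mem hx, indicator_of_mem hx]
  · rw [indicator_of_notMem hx, indicator_of_notMem hx]; simp

end DyadicCube

namespace IsThetaCZO

variable {n : ℕ} {θ : ℝ → ℝ} {T : 𝓢(RSpace n, ℂ) →ₗ[ℂ] 𝓢'(RSpace n, ℂ)}
  {T₂ : Lp ℂ 2 (volume : Measure (RSpace n)) →L[ℂ] Lp ℂ 2 (volume : Measure (RSpace n))}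
  {K : RSpace n → RSpace n → ℂ}

/-- Since b has mean zero, K(x, c) may be subtracted under the integral. Integrating the regularity
bound over x outside the doubled ball leaves the Dini sum. -/
theorem exists_lintegral_compl_ball_le (hT : IsThetaCZO θ T T₂ K) (hθ : IsDiniModulus θ)
    (hn : 1 ≤ n) : ∃ C : ℝ≥0, ∀ (c : RSpace n) (ρ : ℝ) (b : RSpace n → ℂ), 0 < ρ →
      MemLp b 2 volume → Integrable b volume → (∀ x ∉ ball c ρ, b x = 0) → ∫ x, b x = 0 →
      ∫⁻ x in (ball c (2 * ρ))ᶜ, ‖l2Apply T₂ b x‖ₑ ≤ C * ∫⁻ x, ‖b x‖ₑ := by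
  obtain ⟨C₀, hC₀, -, hC⟩ := hT.isThetaKernel.exists_bounds hθ
  set A : ℝ≥0∞ := ENNReal.ofReal C₀ *
    (ENNReal.ofReal (2 ^ n) * volume (ball (0 : RSpace n) 1) * diniSum θ * 1) with hA
  have hAt : A ≠ ∞ := by
    have h1 := hθ.diniSum_ne_top
    have h2 := volume_ball_ne_top (0 : RSpace n) 1
    finiteness
  refine ⟨A.toNNReal, fun c ρ b hρ hb hbi hb0 hbint => ?_⟩
  rw [ENNReal.coe_toNNReal hAt]
  have hrep := hT.l2Apply_eq_integral hθ hn (U := (closedBall c ρ)ᶜ) isClosed_closedBall.isOpen_compl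
    hb (fun x hx => hb0 x fun h => hx (ball_subset_closedBall h))
  calc ∫⁻ x in (ball c (2 * ρ))ᶜ, ‖l2Apply T₂ b x‖ₑ
      ≤ ∫⁻ x in (ball c (2 * ρ))ᶜ, (ENNReal.ofReal C₀ * ∫⁻ z, ‖b z‖ₑ) *
          (ENNReal.ofReal (θ (ρ / ‖x - c‖) / ‖x - c‖ ^ n) * 1) := by
        refine setLIntegral_mono_ae' measurableSet_ball.compl ?_
        filter_upwards [hrep] with x hx hxB
        have hxU : x ∈ (closedBall c ρ)ᶜ := by
          rw [mem_compl_iff, mem_ball, not_lt] at hxB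
          rw [mem_compl_iff, mem_closedBall, not_le]
          linarith
        obtain ⟨hint, hval⟩ := hx hxU
        have h0 : ∫ z, K x c * b z = 0 := by
          rw [integral_const_mul, hbint, mul_zero]
        have hval2 : l2Apply T₂ b x = ∫ z, (K x z - K x c) * b z := by
          rw [hval, ← sub_zero (∫ z, K x z * b z), ← h0, ← integral_sub hint (hbi.const_mul _)]
          simp_rw [sub_mul]
        rw [hval2]
        refine (enorm_integral_le_lintegral_enorm _).trans ?_
        calc ∫⁻ z, ‖(K x z - K x c) * b z‖ₑ
            ≤ ∫⁻ z, (ENNReal.ofReal C₀ * ENNReal.ofReal (θ (ρ / ‖x - c‖) / ‖x - c‖ ^ n)) *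
                ‖b z‖ₑ := by
              refine lintegral_mono fun z => ?_
              by_cases hz : z ∈ ball c ρ
              · rw [enorm_mul]
                gcongr
                exact (hC c z x ρ hz hxB).2
              · simp [hb0 z hz]
          _ = _ := by
              rw [lintegral_const_mul' _ _ (by finiteness)]; ring
    _ = (ENNReal.ofReal C₀ * ∫⁻ z, ‖b z‖ₑ) * ∫⁻ x in (ball c (2 * ρ))ᶜ,
          (ENNReal.ofReal (θ (ρ / ‖x - c‖) / ‖x - c‖ ^ n) * 1) := by
        rw [lintegral_const_mul']
        exact ENNReal.mul_ne_top ENNReal.ofReal_ne_top hbi.2.ne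
    _ ≤ (ENNReal.ofReal C₀ * ∫⁻ z, ‖b z‖ₑ) *
          (ENNReal.ofReal (2 ^ n) * volume (ball (0 : RSpace n) 1) * diniSum θ * 1) := by
        gcongr
        exact lintegral_dini_le hθ hρ (h := fun _ => 1) (A := 1) (fun s _ => by simp)
    _ = _ := by rw [hA]; ring

theorem sq_mul_volume_le {T₂ : Lp ℂ 2 (volume : Measure (RSpace n)) →L[ℂ]
    Lp ℂ 2 (volume : Measure (RSpace n))} (g : RSpace n → ℂ) (t : ℝ≥0∞) :
    t ^ 2 * volume {x | t < ‖l2Apply T₂ g x‖ₑ} ≤ ‖T₂‖ₑ ^ 2 * ∫⁻ x, ‖g x‖ₑ ^ 2 := by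
  have h := mul_meas_ge_le_pow_eLpNorm' (p := 2) (volume : Measure (RSpace n)) (by norm_num)
    (by norm_num) (stronglyMeasurable_l2Apply (T₂ := T₂) (f := g)).aestronglyMeasurable t
  simp only [ENNReal.toReal_ofNat, ENNReal.rpow_ofNat] at h
  have h2 : eLpNorm g 2 volume ^ 2 = ∫⁻ x, ‖g x‖ₑ ^ 2 := by
    rw [eLpNorm_eq_lintegral_rpow_enorm_toReal (by norm_num) (by norm_num), ← ENNReal.rpow_ofNat,
      ← ENNReal.rpow_mul]
    simp
  calc _ ≤ t ^ 2 * volume {x | t ≤ ‖l2Apply T₂ g x‖ₑ} := by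
        gcongr with x; exact fun h => h.le
    _ ≤ _ := h
    _ ≤ (‖T₂‖ₑ * eLpNorm g 2 volume) ^ 2 := by gcongr; exact eLpNorm_l2Apply_le g
    _ = _ := by rw [mul_pow, h2]

open DyadicCube in
-- Calderón–Zygmund decomposition at height t. The good part is estimated by Chebyshev in L², the
-- bad part by Chebyshev in L¹ off the enlarged balls `B`, and t |B| directly by ‖f‖₁. The threshold
-- 3t leaves t for each of the good, bad and remainder parts.
theorem weak_type_aux (hT : IsThetaCZO θ T T₂ K) (hθ : IsDiniModulus θ) (hn : 1 ≤ n) :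
    ∃ C : ℝ≥0, ∀ f : RSpace n → ℂ, MemLp f 2 volume → Integrable f volume →
      ∀ t : ℝ≥0∞, t ≠ 0 → t ≠ ∞ →
        t * volume {x | 3 * t < ‖l2Apply T₂ f x‖ₑ} ≤ C * ∫⁻ x, ‖f x‖ₑ := by
  obtain ⟨Cb, hCb⟩ := hT.exists_lintegral_compl_ball_le hθ hn
  refine ⟨‖T₂‖₊ ^ 2 * 2 ^ n * 2 + Cb * 2 + ballRatio n 2, fun f hf hfi t ht0 htt => ?_⟩
  set S : Set (DyadicCube n) := {Q | IsStopping (fun y => ‖f y‖ₑ) t Q} with hS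
  have hdisj : S.PairwiseDisjoint cell := pairwiseDisjoint_isStopping _ _
  set B : Set (RSpace n) := ⋃ Q ∈ S, ball Q.corner (2 * Q.rad) with hB
  have hBm : MeasurableSet B := (isOpen_biUnion fun _ _ => isOpen_ball).measurableSet
  set I := ∫⁻ x, ‖f x‖ₑ with hI
  have hft : ∀ᵐ x, x ∉ (⋃ Q ∈ S, Q.cell) → ‖f x‖ₑ ≤ t := by
    filter_upwards [ae_enorm_le_of_forall_not_isStopping hn hfi ht0] with x hx hxS
    exact hx fun Q hQ hxQ => hxS (mem_biUnion (show Q ∈ S from hQ) hxQ)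
  have hBvol : t * volume B ≤ ballRatio n 2 * I :=
    calc t * volume B ≤ t * ∑' Q : S, volume (ball Q.1.corner (2 * Q.1.rad)) := by
          gcongr; exact measure_biUnion_le _ (to_countable _) _
      _ = ballRatio n 2 * (t * ∑' Q : S, volume Q.1.cell) := by
          rw [tsum_congr fun Q : S => volume_ball_rad Q.1 Q.1.corner two_pos,
            ENNReal.tsum_mul_left]
          ring
      _ ≤ _ := by gcongr; exact tsum_volume_isStopping_le _ _
  -- The bound holds for every finite subfamily `F`, with an L² error from the cubes left out;
  -- letting `F` grow removes the error.
  have main : ∀ F : Finset S, t * volume {x | 3 * t < ‖l2Apply T₂ f x‖ₑ} ≤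
      (‖T₂‖ₑ ^ 2 * 2 ^ n * 2 + Cb * 2 + ballRatio n 2) * I +
        t⁻¹ * (‖T₂‖ₑ ^ 2 * ∑' Q : {Q : S // Q ∉ F}, ∫⁻ x in Q.1.1.cell, ‖f x‖ₑ ^ 2) := by
    intro F
    set g := goodPart f S F with hg
    set b : S → RSpace n → ℂ := fun Q => oscillation f Q.1 with hb
    set r := remainderPart f S F with hr
    have hg2 : MemLp g 2 volume := memLp_goodPart hf
    have hb2 : ∀ Q : S, MemLp (b Q) 2 volume := fun Q => memLp_oscillation hf Q.1
    have hbs2 : MemLp (∑ Q ∈ F, b Q) 2 volume := memLp_finsetSum' _ fun Q _ => hb2 Q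
    have hr2 : MemLp r 2 volume := memLp_remainderPart hf
    have hTf : l2Apply T₂ f =ᵐ[volume]
        l2Apply T₂ g + ∑ Q ∈ F, l2Apply T₂ (b Q) + l2Apply T₂ r := by
      have h1 := l2Apply_add (T₂ := T₂) (hg2.add hbs2) hr2
      have h2 := l2Apply_add (T₂ := T₂) hg2 hbs2
      have h3 := l2Apply_sum (T₂ := T₂) F fun Q _ => hb2 Q
      rw [← decomposition hdisj f F] at h1
      filter_upwards [h1, h2, h3] with x h1 h2 h3
      rw [h1, Pi.add_apply, h2, Pi.add_apply, h3]; rfl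
    have hsub : volume {x | 3 * t < ‖l2Apply T₂ f x‖ₑ} ≤
        volume {x | t < ‖l2Apply T₂ g x‖ₑ} +
          volume ({x | t ≤ Bᶜ.indicator (fun x => ‖(∑ Q ∈ F, l2Apply T₂ (b Q)) x‖ₑ) x}) +
          volume B + volume {x | t < ‖l2Apply T₂ r x‖ₑ} := by
      refine le_trans (measure_mono_ae ?_) ((measure_union_le _ _).trans
        (add_le_add_left ((measure_union_le _ _).trans
          (add_le_add_left (measure_union_le _ _) _)) _))
      filter_upwards [hTf] with x hx hx3
      have hx3' : 3 * t < ‖l2Apply T₂ f x‖ₑ := hx3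
      show x ∈ ((_ ∪ _) ∪ B) ∪ _
      by_contra! hcon
      simp only [mem_union, not_or] at hcon
      obtain ⟨⟨⟨h1, h2⟩, h3⟩, h4⟩ := hcon
      have h1' : ‖l2Apply T₂ g x‖ₑ ≤ t := not_lt.1 h1
      have h4' : ‖l2Apply T₂ r x‖ₑ ≤ t := not_lt.1 h4
      have h2' : ‖(∑ Q ∈ F, l2Apply T₂ (b Q)) x‖ₑ ≤ t := by
        have := not_le.1 (show ¬ t ≤ _ from h2)
        rw [indicator_of_mem (by exact h3)] at this
        exact this.le
      rw [hx] at hx3'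
      refine absurd hx3' (not_lt.2 ?_)
      calc _ ≤ ‖l2Apply T₂ g x‖ₑ + ‖(∑ Q ∈ F, l2Apply T₂ (b Q)) x‖ₑ + ‖l2Apply T₂ r x‖ₑ :=
            (enorm_add_le _ _).trans (by gcongr; exact enorm_add_le _ _)
        _ ≤ t + t + t := by gcongr
        _ = 3 * t := by ring
    have hgood : t * volume {x | t < ‖l2Apply T₂ g x‖ₑ} ≤ ‖T₂‖ₑ ^ 2 * 2 ^ n * 2 * I := by
      have h1 := (sq_mul_volume_le (T₂ := T₂) g t).trans (mul_le_mul_right (lintegral_goodPart_sq_le hfi hdisj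
        (fun Q hQ => IsStopping.lintegral_le hQ) hft) _)
      rw [← ENNReal.mul_le_mul_iff_right ht0 htt]
      calc _ = t ^ 2 * volume {x | t < ‖l2Apply T₂ g x‖ₑ} := by ring
        _ ≤ _ := h1
        _ = _ := by ring
    have hrem : t * volume {x | t < ‖l2Apply T₂ r x‖ₑ} ≤
        t⁻¹ * (‖T₂‖ₑ ^ 2 * ∑' Q : {Q : S // Q ∉ F}, ∫⁻ x in Q.1.1.cell, ‖f x‖ₑ ^ 2) := by
      have h1 := (sq_mul_volume_le (T₂ := T₂) r t).trans
        (mul_le_mul_right lintegral_remainderPart_sq_le _)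
      rw [← ENNReal.mul_le_mul_iff_right ht0 htt, ← mul_assoc t t⁻¹, ENNReal.mul_inv_cancel ht0 htt,
        one_mul]
      calc _ = t ^ 2 * volume {x | t < ‖l2Apply T₂ r x‖ₑ} := by ring
        _ ≤ _ := h1
    have hbad : t * volume ({x | t ≤ Bᶜ.indicator
        (fun x => ‖(∑ Q ∈ F, l2Apply T₂ (b Q)) x‖ₑ) x}) ≤ Cb * 2 * I := by
      have hm : ∀ Q : S, Measurable fun x => ‖l2Apply T₂ (b Q) x‖ₑ := fun Q =>
        stronglyMeasurable_l2Apply.measurable.enorm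
      have hms : StronglyMeasurable (∑ Q ∈ F, l2Apply T₂ (b Q)) :=
        Finset.stronglyMeasurable_sum _ fun Q _ => stronglyMeasurable_l2Apply
      refine (mul_meas_ge_le_lintegral₀ (hms.measurable.enorm.indicator
        hBm.compl).aemeasurable t).trans ?_
      rw [lintegral_indicator hBm.compl]
      calc ∫⁻ x in Bᶜ, ‖(∑ Q ∈ F, l2Apply T₂ (b Q)) x‖ₑ
          ≤ ∫⁻ x in Bᶜ, ∑ Q ∈ F, ‖l2Apply T₂ (b Q) x‖ₑ := by
            gcongr with x
            rw [Finset.sum_apply]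
            exact enorm_sum_le _ _
        _ = ∑ Q ∈ F, ∫⁻ x in Bᶜ, ‖l2Apply T₂ (b Q) x‖ₑ :=
            lintegral_finsetSum' _ fun Q _ => (hm Q).aemeasurable
        _ ≤ ∑ Q ∈ F, Cb * (2 * ∫⁻ x in Q.1.cell, ‖f x‖ₑ) := by
            gcongr with Q hQ
            refine (lintegral_mono_set (compl_subset_compl.2 (subset_biUnion_of_mem
              (u := fun Q : DyadicCube n => ball Q.corner (2 * Q.rad)) Q.2))).trans ?_
            refine (hCb Q.1.corner Q.1.rad (b Q) Q.1.rad_pos (hb2 Q) ?_ ?_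
              (integral_oscillation hfi Q.1)).trans (by gcongr; exact lintegral_oscillation_le f Q.1)
            · refine ⟨(hb2 Q).1, (lintegral_oscillation_le f Q.1).trans_lt ?_⟩
              exact ENNReal.mul_lt_top (by simp) ((setLIntegral_le_lintegral _ _).trans_lt hfi.2)
            · exact fun x hx => indicator_of_notMem (fun h => hx (Q.1.cell_subset_ball h)) _
        _ = Cb * 2 * ∑ Q ∈ F, ∫⁻ x in Q.1.cell, ‖f x‖ₑ := by
            rw [Finset.mul_sum]; exact Finset.sum_congr rfl fun _ _ => by ring
        _ ≤ _ := by
            gcongr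
            exact (ENNReal.sum_le_tsum _).trans (sum_lintegral_cell_le hdisj _)
    calc _ ≤ t * (volume {x | t < ‖l2Apply T₂ g x‖ₑ} +
          volume ({x | t ≤ Bᶜ.indicator (fun x => ‖(∑ Q ∈ F, l2Apply T₂ (b Q)) x‖ₑ) x}) +
          volume B + volume {x | t < ‖l2Apply T₂ r x‖ₑ}) := by gcongr
      _ = t * volume {x | t < ‖l2Apply T₂ g x‖ₑ} + t * volume ({x | t ≤ Bᶜ.indicator
            (fun x => ‖(∑ Q ∈ F, l2Apply T₂ (b Q)) x‖ₑ) x}) + t * volume B +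
          t * volume {x | t < ‖l2Apply T₂ r x‖ₑ} := by ring
      _ ≤ ‖T₂‖ₑ ^ 2 * 2 ^ n * 2 * I + Cb * 2 * I + ballRatio n 2 * I +
          t⁻¹ * (‖T₂‖ₑ ^ 2 * ∑' Q : {Q : S // Q ∉ F}, ∫⁻ x in Q.1.1.cell, ‖f x‖ₑ ^ 2) := by
          gcongr
      _ = _ := by ring
  -- Square integrability of f is what makes the sum over the omitted cubes tend to zero.
  have hsq : ∑' Q : S, ∫⁻ x in Q.1.cell, ‖f x‖ₑ ^ 2 ≠ ∞ := by
    refine ne_top_of_le_ne_top ?_ (sum_lintegral_cell_le hdisj _)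
    have := lintegral_rpow_enorm_lt_top_of_eLpNorm_lt_top (by norm_num) (by norm_num) hf.2
    simpa using this.ne
  have hlim : Tendsto (fun F : Finset S => (‖T₂‖ₑ ^ 2 * 2 ^ n * 2 + Cb * 2 + ballRatio n 2) * I +
        t⁻¹ * (‖T₂‖ₑ ^ 2 * ∑' Q : {Q : S // Q ∉ F}, ∫⁻ x in Q.1.1.cell, ‖f x‖ₑ ^ 2)) atTop
      (𝓝 ((‖T₂‖ₑ ^ 2 * 2 ^ n * 2 + Cb * 2 + ballRatio n 2) * I + t⁻¹ * (‖T₂‖ₑ ^ 2 * 0))) := by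
    refine tendsto_const_nhds.add (ENNReal.Tendsto.const_mul (ENNReal.Tendsto.const_mul
      (ENNReal.tendsto_tsum_compl_atTop_zero hsq) (Or.inr (by finiteness)))
      (Or.inr (ENNReal.inv_ne_top.2 ht0)))
  have hfin := ge_of_tendsto hlim (Eventually.of_forall main)
  rw [mul_zero, mul_zero, add_zero] at hfin
  refine hfin.trans (le_of_eq ?_)
  push_cast
  rfl

/-- The weak type `(1, 1)` bound. -/
theorem weak_type (hT : IsThetaCZO θ T T₂ K) (hθ : IsDiniModulus θ) (hn : 1 ≤ n) :
    ∃ C : ℝ≥0, ∀ f : RSpace n → ℂ, MemLp f 2 volume → Integrable f volume →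
      ∀ t : ℝ≥0∞, t * volume {x | t < ‖l2Apply T₂ f x‖ₑ} ≤ C * ∫⁻ x, ‖f x‖ₑ := by
  obtain ⟨C, hC⟩ := weak_type_aux hT hθ hn
  refine ⟨3 * C, fun f hf hfi t => ?_⟩
  by_cases ht0 : t = 0
  · simp [ht0]
  by_cases htt : t = ∞
  · simp [htt]
  have h3 : 3 * (t / 3) = t := ENNReal.mul_div_cancel (by norm_num) (by norm_num)
  have h := hC f hf hfi (t / 3) (ENNReal.div_ne_zero.2 ⟨ht0, by norm_num⟩)
    (ENNReal.div_ne_top htt (by norm_num))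
  rw [h3] at h
  calc t * volume {x | t < ‖l2Apply T₂ f x‖ₑ}
      = 3 * (t / 3 * volume {x | t < ‖l2Apply T₂ f x‖ₑ}) := by rw [← mul_assoc, h3]
    _ ≤ 3 * (C * ∫⁻ x, ‖f x‖ₑ) := by gcongr
    _ = _ := by push_cast; ring

end IsThetaCZO

end

section

/-! ### Sparse domination: the selection of subcubes -/

namespace DyadicCube

variable {n : ℕ}

/-- The ball with the same centre and twice the radius of the ball around a cube. -/
noncomputable def dilate (Q : DyadicCube n) : Set (RSpace n) := ball Q.corner (2 * Q.rad)

/-- The mean of `|f|` over the dilated ball of a cube. -/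
noncomputable def dilateAvg (f : RSpace n → ℂ) (Q : DyadicCube n) : ℝ≥0∞ :=
  (volume Q.dilate)⁻¹ * ∫⁻ x in Q.dilate, ‖f x‖ₑ

theorem measurableSet_dilate (Q : DyadicCube n) : MeasurableSet Q.dilate := measurableSet_ball

theorem volume_dilate (Q : DyadicCube n) :
    volume Q.dilate = ballRatio n 2 * volume Q.cell := volume_ball_rad Q Q.corner two_pos

theorem volume_dilate_ne_zero (Q : DyadicCube n) : volume Q.dilate ≠ 0 :=
  volume_ball_ne_zero _ (by linarith [Q.rad_pos])

theorem volume_dilate_ne_top (Q : DyadicCube n) : volume Q.dilate ≠ ∞ := volume_ball_ne_top _ _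

theorem lintegral_dilate (f : RSpace n → ℂ) (Q : DyadicCube n) :
    ∫⁻ x, ‖Q.dilate.indicator f x‖ₑ = dilateAvg f Q * volume Q.dilate := by
  rw [dilateAvg, mul_comm, ← mul_assoc, ENNReal.mul_inv_cancel Q.volume_dilate_ne_zero
    Q.volume_dilate_ne_top, one_mul, ← lintegral_indicator Q.measurableSet_dilate]
  simp_rw [enorm_indicator_eq_indicator_enorm]

/-- The operator applied to the part of `f` near the cube `Q`. -/
noncomputable def localPiece
    (T₂ : Lp ℂ 2 (volume : Measure (RSpace n)) →L[ℂ] Lp ℂ 2 (volume : Measure (RSpace n)))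
    (f : RSpace n → ℂ) (Q : DyadicCube n) : RSpace n → ℂ :=
  l2Apply T₂ (Q.dilate.indicator f)

end DyadicCube

theorem isBallDoubling_volume (n : ℕ) :
    ∃ D, IsBallDoubling (volume : Measure (RSpace n)) D :=
  ⟨(5 ^ n : ℝ).toNNReal, fun c r hr => volume_ball_ne_zero c hr, fun c r => volume_ball_ne_top c r,
    fun c r _ => (volume_ball_mul c c (by norm_num)).le⟩

/-- The weak bound at level A a, with the mean a cancelled. For a = 0 nothing can be cancelled; the
weak bound at all levels 1/(k+1) then shows that g vanishes a.e. -/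
theorem mul_volume_lt_le_of_weak {n : ℕ} {g : RSpace n → ℝ≥0∞} {C : ℝ≥0} {I a V A : ℝ≥0∞}
    (hg : ∀ t, t * volume {x | t < g x} ≤ C * I) (hI : I = a * V) (ha : a ≠ ∞) :
    A * volume {x | A * a < g x} ≤ C * V := by
  by_cases ha0 : a = 0
  · have h0 : volume {x | 0 < g x} = 0 := by
      have : {x | 0 < g x} = ⋃ k : ℕ, {x | (k + 1 : ℝ≥0∞)⁻¹ < g x} := by
        ext x
        simp only [mem_ofPred_eq, mem_iUnion]
        constructor
        · intro h
          obtain ⟨k, hk⟩ := ENNReal.exists_inv_nat_lt h.ne'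
          refine ⟨k, lt_of_le_of_lt ?_ hk⟩
          gcongr
          exact le_self_add
        · rintro ⟨k, hk⟩
          exact (zero_le).trans_lt hk
      rw [this, measure_iUnion_null_iff]
      intro k
      have h := hg (k + 1 : ℝ≥0∞)⁻¹
      rw [hI, ha0, zero_mul, mul_zero, le_zero_iff, mul_eq_zero] at h
      refine h.resolve_left ?_
      rw [ENNReal.inv_eq_zero]
      finiteness
    simp [ha0, h0]
  · have h := hg (A * a)
    rw [hI] at h
    rw [← ENNReal.mul_le_mul_iff_right ha0 ha]
    calc _ = A * a * volume {x | A * a < g x} := by ring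
      _ ≤ _ := h
      _ = _ := by ring

namespace IsThetaCZO

variable {n : ℕ} {θ : ℝ → ℝ} {T : 𝓢(RSpace n, ℂ) →ₗ[ℂ] 𝓢'(RSpace n, ℂ)}
  {T₂ : Lp ℂ 2 (volume : Measure (RSpace n)) →L[ℂ] Lp ℂ 2 (volume : Measure (RSpace n))}
  {K : RSpace n → RSpace n → ℂ}

open DyadicCube

/-- The oscillation of `T h` near the centre of a ball off which `h` is supported. -/
theorem exists_enorm_sub_le (hT : IsThetaCZO θ T T₂ K) (hθ : IsDiniModulus θ) (hn : 1 ≤ n) :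
    ∃ C : ℝ≥0, ∀ (c : RSpace n) (ρ : ℝ) (h : RSpace n → ℂ), 0 < ρ → MemLp h 2 volume →
      (∀ x ∈ ball c (2 * ρ), h x = 0) →
      ∃ G : Set (RSpace n), (∀ᵐ x, x ∈ G) ∧ ∀ x ∈ G ∩ ball c ρ, ∀ x' ∈ G ∩ ball c ρ,
        ‖l2Apply T₂ h x - l2Apply T₂ h x'‖ₑ ≤ C * ballMaximal volume (fun y => ‖h y‖ₑ) x' := by
  obtain ⟨C₀, hC₀, -, hC⟩ := hT.isThetaKernel.exists_bounds hθ
  set A : ℝ≥0∞ := ENNReal.ofReal (2 ^ n) * volume (ball (0 : RSpace n) 1) * diniSum θ with hA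
  have hAt : A ≠ ∞ := by
    have h1 := hθ.diniSum_ne_top
    have h2 := volume_ball_ne_top (0 : RSpace n) 1
    finiteness
  refine ⟨2 * C₀.toNNReal * A.toNNReal, fun c ρ h hρ hh hh0 => ?_⟩
  refine ⟨{x | x ∈ ball c ρ → Integrable (fun z => K x z * h z) volume ∧
    l2Apply T₂ h x = ∫ z, K x z * h z}, hT.l2Apply_eq_integral_ball hθ hn hρ hh hh0, ?_⟩
  rintro x ⟨hxG, hx⟩ x' ⟨hxG', hx'⟩
  obtain ⟨hi, hv⟩ := hxG hx
  obtain ⟨hi', hv'⟩ := hxG' hx'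
  set M := ballMaximal volume (fun y => ‖h y‖ₑ) x'
  -- Every ball around c of radius at least ρ contains x', so the uncentred maximal function at x'
  -- bounds all these means at once.
  have hM : ∀ s, ρ ≤ s → ∫⁻ z in ball c s, ‖h z‖ₑ ≤ M * volume (ball c s) := by
    intro s hs
    have h1 := le_ballMaximal volume (fun y => ‖h y‖ₑ) (ball_subset_ball hs hx')
    rwa [ENNReal.inv_mul_le_iff (volume_ball_ne_zero c (hρ.trans_le hs)) (volume_ball_ne_top c s),
      mul_comm] at h1
  rw [hv, hv', ← integral_sub hi hi']
  refine (enorm_integral_le_lintegral_enorm _).trans ?_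
  calc ∫⁻ z, ‖K x z * h z - K x' z * h z‖ₑ
      ≤ ∫⁻ z in (ball c (2 * ρ))ᶜ, 2 * ENNReal.ofReal C₀ *
          (ENNReal.ofReal (θ (ρ / ‖z - c‖) / ‖z - c‖ ^ n) * ‖h z‖ₑ) := by
        rw [← lintegral_indicator measurableSet_ball.compl]
        refine lintegral_mono fun z => ?_
        by_cases hz : z ∈ ball c (2 * ρ)
        · simp [hh0 z hz]
        · rw [indicator_of_mem (by exact hz), ← sub_mul, enorm_mul, ← mul_assoc]
          gcongr
          calc ‖K x z - K x' z‖ₑ = ‖(K x z - K c z) - (K x' z - K c z)‖ₑ := by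
                rw [sub_sub_sub_cancel_right]
            _ ≤ ‖K x z - K c z‖ₑ + ‖K x' z - K c z‖ₑ := enorm_sub_le
            _ ≤ _ + _ := add_le_add (hC c x z ρ hx hz).1 (hC c x' z ρ hx' hz).1
            _ = _ := by ring
    _ = 2 * ENNReal.ofReal C₀ * ∫⁻ z in (ball c (2 * ρ))ᶜ,
          (ENNReal.ofReal (θ (ρ / ‖z - c‖) / ‖z - c‖ ^ n) * ‖h z‖ₑ) :=
        lintegral_const_mul' _ _ (by finiteness)
    _ ≤ 2 * ENNReal.ofReal C₀ * (A * M) := by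
        gcongr
        exact lintegral_dini_le hθ hρ hM
    _ = _ := by
        push_cast
        rw [ENNReal.coe_toNNReal hAt, ← mul_assoc]; rfl

/-- Let E be the part of Q where |T(f χ_{Q*})| or the maximal function of f χ_{Q*} exceeds A₀ times
the mean of |f| over Q*; by the weak bounds E is a small part of Q. The children are the stopping
cubes of χ_E: they cover E up to a null set, are few, and each meets E in at most half of its
volume. On a child P write T(f χ_{Q*}) = T(f χ_{P*}) + T h with h = f χ_{Q* \ P*}. At a good point
x' of P both local terms are under control, hence so is T h(x'); as h vanishes on P*, T h varies on
P by no more than a maximal function at x'. -/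
theorem exists_sparse_step (hT : IsThetaCZO θ T T₂ K) (hθ : IsDiniModulus θ) (hn : 1 ≤ n) :
    ∃ A : ℝ≥0, ∀ f : RSpace n → ℂ, MemLp f 2 volume → Integrable f volume → ∀ Q : DyadicCube n,
      ∃ ch : Set (DyadicCube n), ch.PairwiseDisjoint cell ∧
        (∀ P ∈ ch, Q.1 < P.1 ∧ P.cell ⊆ Q.cell) ∧
        2 * volume (⋃ P ∈ ch, P.cell) ≤ volume Q.cell ∧
        ∀ᵐ x, x ∈ Q.cell →
          (x ∉ (⋃ P ∈ ch, P.cell) → ‖localPiece T₂ f Q x‖ₑ ≤ A * dilateAvg f Q) ∧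
          ∀ P ∈ ch, x ∈ P.cell → ‖localPiece T₂ f Q x‖ₑ ≤
            A * dilateAvg f Q + A * dilateAvg f P + ‖localPiece T₂ f P x‖ₑ := by
  obtain ⟨Cw, hCw⟩ := hT.weak_type hθ hn
  obtain ⟨D, hD⟩ := isBallDoubling_volume n
  obtain ⟨Co, hCo⟩ := hT.exists_enorm_sub_le hθ hn
  -- Chosen so that the exceptional sets occupy at most 2^(-(n+2)) of the cube; the summand 1 keeps
  -- the constant nonzero.
  set A₀ : ℝ≥0 := 2 ^ (n + 2) * ((Cw + D) * ballRatio n 2) + 1 with hA₀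
  have hA₀0 : (A₀ : ℝ≥0∞) ≠ 0 := by rw [hA₀]; positivity
  refine ⟨(Co + 1) * A₀, fun f hf hfi Q => ?_⟩
  have havg : ∀ P : DyadicCube n, dilateAvg f P ≠ ∞ := fun P =>
    ENNReal.mul_ne_top (ENNReal.inv_ne_top.2 P.volume_dilate_ne_zero)
      ((setLIntegral_le_lintegral _ _).trans_lt hfi.2).ne
  have hf2 : ∀ P : DyadicCube n, MemLp (P.dilate.indicator f) 2 volume := fun P =>
    hf.indicator P.measurableSet_dilate
  have hweakT : ∀ P : DyadicCube n,
      A₀ * volume {x | A₀ * dilateAvg f P < ‖localPiece T₂ f P x‖ₑ} ≤ Cw * volume P.dilate :=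
    fun P => mul_volume_lt_le_of_weak
      (hCw _ (hf2 P) (hfi.indicator P.measurableSet_dilate)) (lintegral_dilate f P) (havg P)
  set M : RSpace n → ℝ≥0∞ := ballMaximal volume fun y => ‖Q.dilate.indicator f y‖ₑ with hM
  have hweakM : A₀ * volume {x | A₀ * dilateAvg f Q < M x} ≤ D * volume Q.dilate :=
    mul_volume_lt_le_of_weak (ballMaximal_weak hD _) (lintegral_dilate f Q) (havg Q)
  have hsmall : ∀ (P : DyadicCube n) (E : Set (RSpace n)),
      A₀ * volume E ≤ (Cw + D) * volume P.dilate → 2 ^ (n + 2) * volume E ≤ volume P.cell := by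
    intro P E hE
    rw [← ENNReal.mul_le_mul_iff_right hA₀0 ENNReal.coe_ne_top]
    rw [volume_dilate] at hE
    calc A₀ * (2 ^ (n + 2) * volume E) = 2 ^ (n + 2) * (A₀ * volume E) := by ring
      _ ≤ 2 ^ (n + 2) * ((Cw + D) * (ballRatio n 2 * volume P.cell)) := by gcongr
      _ = ((2 ^ (n + 2) * ((Cw + D) * ballRatio n 2) : ℝ≥0) : ℝ≥0∞) * volume P.cell := by
          push_cast; ring
      _ ≤ A₀ * volume P.cell := by
          gcongr
          rw [hA₀]
          exact le_self_add
  set E : Set (RSpace n) := Q.cell ∩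
    ({x | A₀ * dilateAvg f Q < ‖localPiece T₂ f Q x‖ₑ} ∪ {x | A₀ * dilateAvg f Q < M x}) with hE
  have hEm : MeasurableSet E :=
    Q.measurableSet_cell.inter ((measurableSet_lt measurable_const
      stronglyMeasurable_l2Apply.measurable.enorm).union
      (measurableSet_lt measurable_const (measurable_ballMaximal _ _)))
  have hEvol : 2 ^ (n + 2) * volume E ≤ volume Q.cell := by
    refine hsmall Q E ?_
    calc A₀ * volume E ≤ A₀ * (volume {x | A₀ * dilateAvg f Q < ‖localPiece T₂ f Q x‖ₑ} +
          volume {x | A₀ * dilateAvg f Q < M x}) := by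
          gcongr
          exact (measure_mono inter_subset_right).trans (measure_union_le _ _)
      _ ≤ Cw * volume Q.dilate + D * volume Q.dilate := by
          rw [mul_add]; exact add_le_add (hweakT Q) hweakM
      _ = _ := by ring
  set f₀ : RSpace n → ℝ := E.indicator fun _ => 1 with hf₀
  have hf₀e : ∀ x, ‖f₀ x‖ₑ = E.indicator (fun _ => (1 : ℝ≥0∞)) x := fun x => by
    rw [hf₀, enorm_indicator_eq_indicator_enorm]; simp
  have hint : ∀ S : Set (RSpace n), ∫⁻ x in S, ‖f₀ x‖ₑ = volume (E ∩ S) := fun S => by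
    simp_rw [hf₀e]
    rw [lintegral_indicator hEm, setLIntegral_one, Measure.restrict_apply hEm]
  -- With this height 2^n τ = 1/2 bounds the share of E in each child, while |E| ≤ (τ/2) |Q| makes
  -- the children cover at most half of Q.
  set τ : ℝ≥0∞ := (2 ^ (n + 1))⁻¹ with hτ
  have hp0 : (2 : ℝ≥0∞) ^ (n + 1) ≠ 0 := by positivity
  have hpt : (2 : ℝ≥0∞) ^ (n + 1) ≠ ∞ := by finiteness
  have hτ0 : τ ≠ 0 := ENNReal.inv_ne_zero.2 hpt
  have hτt : τ ≠ ∞ := ENNReal.inv_ne_top.2 hp0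
  have hτ2 : 2 ^ n * τ = 2⁻¹ := by
    have h2 : (2 : ℝ≥0∞) ^ n ≠ 0 := by positivity
    rw [hτ, pow_succ, ENNReal.mul_inv (Or.inl h2) (Or.inl (by finiteness)), ← mul_assoc,
      ENNReal.mul_inv_cancel h2 (by finiteness), one_mul]
  have hEvol' : volume E ≤ τ * (2⁻¹ * volume Q.cell) := by
    rw [hτ, ← mul_assoc, ← ENNReal.mul_inv (Or.inl hp0) (Or.inl hpt), ← pow_succ, ← ENNReal.div_eq_inv_mul,
      ENNReal.le_div_iff_mul_le (Or.inl (by positivity)) (Or.inl (by finiteness)), mul_comm]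
    exact hEvol
  have hEfin : volume E ≠ ∞ := ne_top_of_le_ne_top Q.volume_cell_ne_top
    (measure_mono inter_subset_left)
  have hf₀i : Integrable f₀ volume := (integrable_indicator_iff hEm).2 (integrableOn_const hEfin)
  set ch : Set (DyadicCube n) := {P | IsStopping (fun y => ‖f₀ y‖ₑ) τ P} with hch
  have hch1 : ∀ P ∈ ch, τ * volume P.cell < volume (E ∩ P.cell) := fun P hP => by
    rw [← hint]; exact hP.1
  have hch2 : ∀ P ∈ ch, volume (E ∩ P.cell) ≤ 2⁻¹ * volume P.cell := fun P hP => by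
    rw [← hint, ← hτ2]; exact IsStopping.lintegral_le hP
  have hsub : ∀ P ∈ ch, Q.1 < P.1 ∧ P.cell ⊆ Q.cell := by
    intro P hP
    obtain ⟨x, hxE, hxP⟩ : (E ∩ P.cell).Nonempty :=
      nonempty_of_measure_ne_zero (zero_le.trans_lt (hch1 P hP)).ne'
    -- A stopping cube at least as large as Q would contain Q, and the mean of χ_E over it would be
    -- at most τ/2.
    have hlt : Q.1 < P.1 := by
      by_contra! hle
      have hQP : Q.cell ⊆ P.cell := cell_subset_of_mem hle hxE.1 hxP
      refine absurd (hch1 P hP) (not_lt.2 ?_)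
      calc volume (E ∩ P.cell) ≤ volume E := measure_mono inter_subset_left
        _ ≤ τ * (2⁻¹ * volume Q.cell) := hEvol'
        _ ≤ τ * (1 * volume P.cell) := by
            gcongr
            exact ENNReal.inv_le_one.2 (by norm_num)
        _ = _ := by rw [one_mul]
    exact ⟨hlt, cell_subset_of_mem hlt.le hxP hxE.1⟩
  refine ⟨ch, pairwiseDisjoint_isStopping _ _, hsub, ?_, ?_⟩
  · have h1 := tsum_volume_isStopping_le (fun y => ‖f₀ y‖ₑ) τ
    rw [← setLIntegral_univ, hint, inter_univ] at h1
    have h2 := (mul_le_mul_right (measure_biUnion_le volume (to_countable ch) cell) τ).trans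
      (h1.trans hEvol')
    rw [ENNReal.mul_le_mul_iff_right hτ0 hτt] at h2
    calc _ ≤ 2 * (2⁻¹ * volume Q.cell) := by gcongr
      _ = _ := by rw [← mul_assoc, ENNReal.mul_inv_cancel (by norm_num) (by norm_num), one_mul]
  have hA₀le : (A₀ : ℝ≥0∞) ≤ ((Co + 1) * A₀ : ℝ≥0) := by
    rw [ENNReal.coe_le_coe]
    exact le_mul_of_one_le_left' le_add_self
  have hoff : ∀ᵐ x, x ∈ Q.cell → x ∉ (⋃ P ∈ ch, P.cell) →
      ‖localPiece T₂ f Q x‖ₑ ≤ ((Co + 1) * A₀ : ℝ≥0) * dilateAvg f Q := by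
    -- Outside the stopping cubes χ_E ≤ τ < 1 a.e., so almost every point of E lies in a child.
    filter_upwards [ae_enorm_le_of_forall_not_isStopping hn hf₀i hτ0] with x hx hxQ hxch
    have h1 : ‖f₀ x‖ₑ ≤ τ := hx fun P hP hxP => hxch (mem_biUnion (show P ∈ ch from hP) hxP)
    have hxE : x ∉ E := by
      intro hxE
      rw [hf₀e, indicator_of_mem hxE] at h1
      refine absurd h1 (not_le.2 ?_)
      rw [hτ, ENNReal.inv_lt_one]
      exact one_lt_pow₀ (by norm_num) (by simp)
    have h2 : ‖localPiece T₂ f Q x‖ₑ ≤ A₀ * dilateAvg f Q := by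
      by_contra! hcon
      exact hxE ⟨hxQ, Or.inl hcon⟩
    exact h2.trans (by gcongr)
  have hon : ∀ᵐ x, ∀ P ∈ ch, x ∈ P.cell → ‖localPiece T₂ f Q x‖ₑ ≤
      ((Co + 1) * A₀ : ℝ≥0) * dilateAvg f Q + ((Co + 1) * A₀ : ℝ≥0) * dilateAvg f P +
        ‖localPiece T₂ f P x‖ₑ := by
    refine (ae_ball_iff (to_countable ch)).2 fun P hP => ?_
    obtain ⟨hlt, hPQ⟩ := hsub P hP
    have hdil : P.dilate ⊆ Q.dilate := ball_subset_ball_of_subset hlt hPQ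
    set h : RSpace n → ℂ := (Q.dilate \ P.dilate).indicator f with hh
    have hh2 : MemLp h 2 volume :=
      hf.indicator (Q.measurableSet_dilate.diff P.measurableSet_dilate)
    have hsplit : Q.dilate.indicator f = P.dilate.indicator f + h := by
      have := indicator_union_of_disjoint (disjoint_sdiff_right (s := P.dilate) (t := Q.dilate)) f
      rw [union_sdiff_cancel hdil] at this
      exact this
    have hadd := l2Apply_add (T₂ := T₂) (hf2 P) hh2
    rw [← hsplit] at hadd
    obtain ⟨G, hG, hGb⟩ := hCo P.corner P.rad h P.rad_pos hh2 fun x hx =>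
      indicator_of_notMem (fun hx' => hx'.2 hx) _
    have hMle : ∀ x, ballMaximal volume (fun y => ‖h y‖ₑ) x ≤ M x := by
      intro x
      refine iSup_mono fun c => iSup_mono fun r => iSup_mono fun _ => ?_
      gcongr with y
      show ‖(Q.dilate \ P.dilate).indicator f y‖ₑ ≤ ‖Q.dilate.indicator f y‖ₑ
      by_cases hy : y ∈ Q.dilate \ P.dilate
      · rw [indicator_of_mem hy, indicator_of_mem hy.1]
      · rw [indicator_of_notMem hy]; simp
    -- In P the set E takes at most 1/2 of the volume and the exceptional set of T(f χ_{P*}) at most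
    -- 1/4; the other two conditions hold a.e. Since 3/4 < 1, a point meeting all of them exists.
    obtain ⟨x', hx'P, hx'E, hx'u, hx'G, hx'add⟩ : ∃ x' ∈ P.cell, x' ∉ E ∧
        ‖localPiece T₂ f P x'‖ₑ ≤ A₀ * dilateAvg f P ∧ x' ∈ G ∧
        localPiece T₂ f Q x' = localPiece T₂ f P x' + l2Apply T₂ h x' := by
      by_contra! hcon
      have hsubset : volume P.cell ≤ volume ((E ∩ P.cell) ∪
          {x | A₀ * dilateAvg f P < ‖localPiece T₂ f P x‖ₑ}) := by
        refine measure_mono_ae ?_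
        filter_upwards [hG, hadd] with x hxG hxadd hxP
        show x ∈ (E ∩ P.cell) ∪ {x | A₀ * dilateAvg f P < ‖localPiece T₂ f P x‖ₑ}
        by_contra! hx
        simp only [mem_union, not_or] at hx
        exact hcon x hxP (fun hxE => hx.1 ⟨hxE, hxP⟩) (not_lt.1 hx.2) hxG hxadd
      have h4 := hsmall P _ ((hweakT P).trans (by gcongr; exact le_self_add))
      have h4' : volume {x | A₀ * dilateAvg f P < ‖localPiece T₂ f P x‖ₑ} ≤
          4⁻¹ * volume P.cell := by
        rw [← ENNReal.div_eq_inv_mul, ENNReal.le_div_iff_mul_le (by norm_num) (by norm_num), mul_comm]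
        refine le_trans ?_ h4
        gcongr
        calc (4 : ℝ≥0∞) = 2 ^ 2 := by norm_num
          _ ≤ 2 ^ (n + 2) := pow_le_pow_right₀ (by norm_num) (by omega)
      have h5 : volume P.cell ≤ (2⁻¹ + 4⁻¹) * volume P.cell := by
        rw [add_mul]
        exact hsubset.trans ((measure_union_le _ _).trans (add_le_add (hch2 P hP) h4'))
      have h6 : (2⁻¹ + 4⁻¹ : ℝ≥0∞) < 1 := by
        rw [← ENNReal.inv_two_add_inv_two]
        refine ENNReal.add_lt_add_left (by simp) ?_
        rw [ENNReal.inv_lt_inv]; norm_num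
      have h7 := ENNReal.mul_lt_mul_left P.volume_cell_ne_zero P.volume_cell_ne_top h6
      rw [one_mul] at h7
      exact absurd h5 (not_le.2 h7)
    have hx'u' : ‖localPiece T₂ f Q x'‖ₑ ≤ A₀ * dilateAvg f Q := by
      by_contra! hcon
      exact hx'E ⟨hPQ hx'P, Or.inl hcon⟩
    have hx'M : M x' ≤ A₀ * dilateAvg f Q := by
      by_contra! hcon
      exact hx'E ⟨hPQ hx'P, Or.inr hcon⟩
    have hTh' : ‖l2Apply T₂ h x'‖ₑ ≤ A₀ * dilateAvg f Q + A₀ * dilateAvg f P := by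
      have : l2Apply T₂ h x' = localPiece T₂ f Q x' - localPiece T₂ f P x' := by
        rw [hx'add]; ring
      rw [this]
      exact enorm_sub_le.trans (add_le_add hx'u' hx'u)
    filter_upwards [hG, hadd] with x hxG hxadd hxP
    have hTh : ‖l2Apply T₂ h x‖ₑ ≤ Co * (A₀ * dilateAvg f Q) +
        (A₀ * dilateAvg f Q + A₀ * dilateAvg f P) := by
      calc ‖l2Apply T₂ h x‖ₑ = ‖(l2Apply T₂ h x - l2Apply T₂ h x') + l2Apply T₂ h x'‖ₑ := by
            rw [sub_add_cancel]
        _ ≤ ‖l2Apply T₂ h x - l2Apply T₂ h x'‖ₑ + ‖l2Apply T₂ h x'‖ₑ := enorm_add_le _ _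
        _ ≤ _ := by
          gcongr
          refine (hGb x ⟨hxG, P.cell_subset_ball hxP⟩ x' ⟨hx'G, P.cell_subset_ball hx'P⟩).trans ?_
          gcongr
          exact (hMle x').trans hx'M
    have hval : localPiece T₂ f Q x = localPiece T₂ f P x + l2Apply T₂ h x := hxadd
    rw [hval]
    calc _ ≤ ‖localPiece T₂ f P x‖ₑ + (Co * (A₀ * dilateAvg f Q) +
          (A₀ * dilateAvg f Q + A₀ * dilateAvg f P)) :=
          (enorm_add_le _ _).trans (by gcongr)
      _ = ((Co + 1) * A₀ : ℝ≥0) * dilateAvg f Q + A₀ * dilateAvg f P +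
          ‖localPiece T₂ f P x‖ₑ := by push_cast; ring
      _ ≤ _ := by gcongr
  filter_upwards [hoff, hon] with x h1 h2 hxQ
  exact ⟨h1 hxQ, h2⟩

end IsThetaCZO

end

section

/-! ### Sparse families of dyadic cubes -/

namespace DyadicCube

variable {n : ℕ}

/-- A rule which selects, for every dyadic cube, disjoint subcubes covering at most half of it. -/
structure IsSparseSelection (ch : DyadicCube n → Set (DyadicCube n)) : Prop where
  disjoint : ∀ Q, (ch Q).PairwiseDisjoint cell
  subset : ∀ Q, ∀ P ∈ ch Q, P.cell ⊆ Q.cell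
  small : ∀ Q, 2 * volume (⋃ P ∈ ch Q, P.cell) ≤ volume Q.cell

/-- The `m`-th generation of cubes selected below `Q`. -/
def generation (ch : DyadicCube n → Set (DyadicCube n)) (Q : DyadicCube n) :
    ℕ → Set (DyadicCube n)
  | 0 => {Q}
  | m + 1 => ⋃ P ∈ generation ch Q m, ch P

/-- The part of a cube that is not covered by the selected subcubes. -/
def core (ch : DyadicCube n → Set (DyadicCube n)) (Q : DyadicCube n) : Set (RSpace n) :=
  Q.cell \ ⋃ P ∈ ch Q, P.cell

theorem measurableSet_core (ch : DyadicCube n → Set (DyadicCube n)) (Q : DyadicCube n) :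
    MeasurableSet (core ch Q) := Q.measurableSet_cell.diff (measurableSet_biUnion_cell _)

theorem mem_generation_succ {ch : DyadicCube n → Set (DyadicCube n)} {Q P : DyadicCube n} {m : ℕ} :
    P ∈ generation ch Q (m + 1) ↔ ∃ R ∈ generation ch Q m, P ∈ ch R := by
  simp [generation]

namespace IsSparseSelection

variable {ch : DyadicCube n → Set (DyadicCube n)} (h : IsSparseSelection ch)
include h

theorem volume_cell_le (Q : DyadicCube n) : volume Q.cell ≤ 2 * volume (core ch Q) := by
  have hm := measurableSet_biUnion_cell (ch Q)
  have h1 := measure_sdiff_add_inter (μ := volume) Q.cell hm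
  have h2 : volume (Q.cell ∩ ⋃ P ∈ ch Q, P.cell) ≤ 2⁻¹ * volume Q.cell := by
    rw [← ENNReal.div_eq_inv_mul, ENNReal.le_div_iff_mul_le (by norm_num) (by norm_num), mul_comm]
    exact (by gcongr; exact inter_subset_right : _ ≤ _).trans (h.small Q)
  have h3 : 2⁻¹ * volume Q.cell ≤ volume (core ch Q) := by
    have h4 : volume Q.cell = 2⁻¹ * volume Q.cell + 2⁻¹ * volume Q.cell := by
      rw [← add_mul, ENNReal.inv_two_add_inv_two, one_mul]
    have h5 : 2⁻¹ * volume Q.cell + 2⁻¹ * volume Q.cell ≤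
        volume (core ch Q) + 2⁻¹ * volume Q.cell := by
      rw [← h4, ← h1]
      gcongr
      · exact le_rfl
      · rw [h1]; exact h2
    refine (ENNReal.add_le_add_iff_right ?_).1 h5
    exact ENNReal.mul_ne_top (by simp) Q.volume_cell_ne_top
  calc volume Q.cell = 2 * (2⁻¹ * volume Q.cell) := by
        rw [← mul_assoc, ENNReal.mul_inv_cancel (by norm_num) (by norm_num), one_mul]
    _ ≤ _ := by gcongr

theorem generation_disjoint (Q : DyadicCube n) (m : ℕ) :
    (generation ch Q m).PairwiseDisjoint cell := by
  induction m with
  | zero => exact pairwiseDisjoint_singleton _ _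
  | succ m ih =>
    intro P hP P' hP' hne
    obtain ⟨R, hR, hPR⟩ := mem_generation_succ.1 hP
    obtain ⟨R', hR', hPR'⟩ := mem_generation_succ.1 hP'
    by_cases hRR : R = R'
    · subst hRR
      exact h.disjoint R hPR hPR' hne
    · exact (ih hR hR' hRR).mono (h.subset R P hPR) (h.subset R' P' hPR')

theorem iUnion_generation_succ_subset (Q : DyadicCube n) (m : ℕ) :
    (⋃ P ∈ generation ch Q (m + 1), P.cell) ⊆ ⋃ P ∈ generation ch Q m, P.cell := by
  refine iUnion₂_subset fun P hP => ?_
  obtain ⟨R, hR, hPR⟩ := mem_generation_succ.1 hP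
  exact (h.subset R P hPR).trans (subset_biUnion_of_mem (u := cell) hR)

theorem iUnion_generation_antitone (Q : DyadicCube n) :
    Antitone fun m => ⋃ P ∈ generation ch Q m, P.cell :=
  antitone_nat_of_succ_le (h.iUnion_generation_succ_subset Q)

theorem volume_generation_le (Q : DyadicCube n) (m : ℕ) :
    2 ^ m * volume (⋃ P ∈ generation ch Q m, P.cell) ≤ volume Q.cell := by
  induction m with
  | zero => simp [generation]
  | succ m ih =>
    refine le_trans ?_ ih
    rw [pow_succ, mul_assoc]
    gcongr
    calc 2 * volume (⋃ P ∈ generation ch Q (m + 1), P.cell)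
        ≤ 2 * ∑' R : generation ch Q m, volume (⋃ P ∈ ch R.1, P.cell) := by
          gcongr
          refine le_trans (measure_mono ?_) (measure_iUnion_le _)
          refine iUnion₂_subset fun P hP => ?_
          obtain ⟨R, hR, hPR⟩ := mem_generation_succ.1 hP
          exact (subset_biUnion_of_mem (u := cell) hPR).trans
            (subset_iUnion (fun R : generation ch Q m => ⋃ P ∈ ch R.1, P.cell) ⟨R, hR⟩)
      _ ≤ ∑' R : generation ch Q m, volume R.1.cell := by
          rw [← ENNReal.tsum_mul_left]
          exact ENNReal.tsum_le_tsum fun R => h.small R.1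
      _ = volume (⋃ P ∈ generation ch Q m, P.cell) :=
          (measure_biUnion (to_countable _) (h.generation_disjoint Q m)
            fun P _ => P.measurableSet_cell).symm

/-- The m-th generation covers at most 2^(-m) |Q|, so the points lying in all generations form a
null set and the descent stops almost everywhere. -/
theorem ae_exists_notMem_generation (Q : DyadicCube n) :
    ∀ᵐ x, ∃ m, x ∉ ⋃ P ∈ generation ch Q m, P.cell := by
  rw [ae_iff]
  have h0 : ∀ m : ℕ, volume {x | ¬∃ m, x ∉ ⋃ P ∈ generation ch Q m, P.cell} ≤
      volume Q.cell * (2⁻¹) ^ m := by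
    intro m
    rw [← ENNReal.inv_pow, ← div_eq_mul_inv, ENNReal.le_div_iff_mul_le (by simp) (by simp), mul_comm]
    refine le_trans ?_ (h.volume_generation_le Q m)
    gcongr
    intro x hx
    have hx' : ¬∃ m, x ∉ ⋃ P ∈ generation ch Q m, P.cell := hx
    push Not at hx'
    exact hx' m
  have hlim : Tendsto (fun m : ℕ => volume Q.cell * (2⁻¹ : ℝ≥0∞) ^ m) atTop
      (𝓝 (volume Q.cell * 0)) :=
    ENNReal.Tendsto.const_mul (ENNReal.tendsto_pow_atTop_nhds_zero_of_lt_one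
      (ENNReal.inv_lt_one.2 (by norm_num))) (Or.inr Q.volume_cell_ne_top)
  rw [mul_zero] at hlim
  exact le_zero_iff.1 (ge_of_tendsto hlim (Eventually.of_forall h0))

/-- Every cube of a later generation inside P is contained in a child of P, and the core of P omits
its children. -/
theorem core_disjoint (Q : DyadicCube n) :
    Pairwise (Function.onFun Disjoint fun i : (m : ℕ) × generation ch Q m => core ch i.2.1) := by
  have aux : ∀ i j : (m : ℕ) × generation ch Q m, i.1 < j.1 →
      Disjoint (core ch i.2.1) (core ch j.2.1) := by
    rintro ⟨m, P, hP⟩ ⟨m', P', hP'⟩ hlt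
    rw [Set.disjoint_left]
    rintro x ⟨hxP, hx⟩ ⟨hxP', -⟩
    have hx1 : x ∈ ⋃ P ∈ generation ch Q (m + 1), P.cell :=
      h.iUnion_generation_antitone Q (Nat.succ_le_of_lt hlt)
        (mem_biUnion (show P' ∈ generation ch Q m' from hP') hxP')
    obtain ⟨R, hR, hxR⟩ := mem_iUnion₂.1 hx1
    obtain ⟨P'', hP'', hRP⟩ := mem_generation_succ.1 hR
    have : P'' = P := by
      by_contra hne
      exact Set.disjoint_left.1 (h.generation_disjoint Q m hP'' hP hne)
        (h.subset P'' R hRP hxR) hxP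
    subst this
    exact hx (mem_biUnion hRP hxR)
  rintro ⟨m, P, hP⟩ ⟨m', P', hP'⟩ hne
  rcases lt_trichotomy m m' with hlt | heq | hlt
  · exact aux ⟨m, P, hP⟩ ⟨m', P', hP'⟩ hlt
  · subst heq
    refine (h.generation_disjoint Q m hP hP' fun e => hne ?_).mono sdiff_subset sdiff_subset
    subst e; rfl
  · exact (aux ⟨m', P', hP'⟩ ⟨m, P, hP⟩ hlt).symm

/-- Pointwise domination by the sum over all generations. -/
theorem ae_le_tsum {u : DyadicCube n → RSpace n → ℝ≥0∞} {a : DyadicCube n → ℝ≥0∞}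
    (hu : ∀ᵐ x, ∀ Q : DyadicCube n, x ∈ Q.cell → (x ∉ (⋃ P ∈ ch Q, P.cell) → u Q x ≤ a Q) ∧
      ∀ P ∈ ch Q, x ∈ P.cell → u Q x ≤ a Q + a P + u P x) (Q : DyadicCube n) :
    ∀ᵐ x, x ∈ Q.cell → u Q x ≤ 2 * ∑' i : (m : ℕ) × generation ch Q m,
      i.2.1.cell.indicator (fun _ => a i.2.1) x := by
  filter_upwards [hu, h.ae_exists_notMem_generation Q] with x hx hex hxQ
  set s : ℕ → ℝ≥0∞ := fun m => ∑' P : generation ch Q m, P.1.cell.indicator (fun _ => a P.1) x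
  have hs : ∀ m, ∀ P ∈ generation ch Q m, x ∈ P.cell → a P ≤ s m := by
    intro m P hP hxP
    have := ENNReal.le_tsum (f := fun P : generation ch Q m => P.1.cell.indicator
      (fun _ => a P.1) x) ⟨P, hP⟩
    rwa [indicator_of_mem hxP] at this
  -- A step from a cube to its child costs the values `a` of both, so every generation passed is
  -- counted twice and the current one once.
  have key : ∀ m, ∀ P ∈ generation ch Q m, x ∈ P.cell →
      u Q x ≤ ∑ j ∈ Finset.range m, 2 * s j + s m + u P x := by
    intro m
    induction m with
    | zero =>
      intro P hP _
      have : P = Q := hP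
      rw [this]
      exact le_add_self
    | succ m ih =>
      intro P hP hxP
      obtain ⟨R, hR, hPR⟩ := mem_generation_succ.1 hP
      have hxR := h.subset R P hPR hxP
      calc u Q x ≤ ∑ j ∈ Finset.range m, 2 * s j + s m + u R x := ih R hR hxR
        _ ≤ ∑ j ∈ Finset.range m, 2 * s j + s m + (s m + s (m + 1) + u P x) := by
            gcongr
            refine ((hx R hxR).2 P hPR hxP).trans ?_
            gcongr
            · exact hs m R hR hxR
            · exact hs (m + 1) P hP hxP
        _ = _ := by rw [Finset.sum_range_succ]; ring
  classical
  -- Let m = k + 1 be the first generation that misses x. Then x lies in a cube of generation k but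
  -- in none of its children, and the terminal estimate applies there.
  have hm := Nat.find_spec hex
  set m := Nat.find hex with hmdef
  have hm0 : m ≠ 0 := by
    intro h0
    rw [h0] at hm
    exact hm (mem_biUnion (show Q ∈ generation ch Q 0 from rfl) hxQ)
  obtain ⟨k, hk⟩ := Nat.exists_eq_succ_of_ne_zero hm0
  have hxk : x ∈ ⋃ P ∈ generation ch Q k, P.cell := by
    by_contra hcon
    have := Nat.find_min' hex hcon
    omega
  obtain ⟨P, hP, hxP⟩ := mem_iUnion₂.1 hxk
  have hxch : x ∉ ⋃ R ∈ ch P, R.cell := by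
    intro hcon
    obtain ⟨R, hR, hxR⟩ := mem_iUnion₂.1 hcon
    rw [hk] at hm
    exact hm (mem_biUnion (mem_generation_succ.2 ⟨P, hP, hR⟩) hxR)
  calc u Q x ≤ ∑ j ∈ Finset.range k, 2 * s j + s k + u P x := key k P hP hxP
    _ ≤ ∑ j ∈ Finset.range k, 2 * s j + s k + s k := by
        gcongr
        exact ((hx P hxP).1 hxch).trans (hs k P hP hxP)
    _ = ∑ j ∈ Finset.range (k + 1), 2 * s j := by rw [Finset.sum_range_succ]; ring
    _ ≤ ∑' j, 2 * s j := ENNReal.sum_le_tsum _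
    _ = _ := by
        rw [ENNReal.tsum_mul_left,
          ENNReal.tsum_sigma fun m (P : generation ch Q m) => P.1.cell.indicator (fun _ => a P.1) x]

end IsSparseSelection

end DyadicCube

/-! ### Weighted bounds for sparse forms -/

theorem ENNReal.tsum_rpow_mul_rpow_le {ι : Type*} {p : ℝ} (hp : 1 < p) (α β : ι → ℝ≥0∞) :
    ∑' i, α i ^ (1 / p) * β i ^ (1 - 1 / p) ≤ (∑' i, α i) ^ (1 / p) * (∑' i, β i) ^ (1 - 1 / p) := by
  let _ : MeasurableSpace ι := ⊤
  have hp1 : p - 1 ≠ 0 := by linarith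
  have hp0 : p ≠ 0 := by linarith
  have h3 : (p - 1) / p = 1 - p⁻¹ := by field_simp
  have h4 : (1 - p⁻¹) * (p / (p - 1)) = 1 := by field_simp
  have h := ENNReal.lintegral_mul_le_Lp_mul_Lq (Measure.count : Measure ι)
    (Real.HolderConjugate.conjExponent hp) (f := fun i => α i ^ (1 / p))
    (g := fun i => β i ^ (1 - 1 / p)) measurable_from_top.aemeasurable
    measurable_from_top.aemeasurable
  simpa [lintegral_count, ← ENNReal.rpow_mul, Real.conjExponent, h3, h4, hp0] using h

namespace IsApPair

variable {n : ℕ} {p : ℝ} {W σ : Measure (RSpace n)} {C : ℝ≥0}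

open DyadicCube

/-- The contribution of one cube to a sparse form is controlled by maximal functions on any
large part of the cube. -/
theorem exists_dilate_term_le (hA : IsApPair p W σ C) (hp : 1 < p) :
    ∃ c₀ : ℝ≥0, ∀ (P : DyadicCube n) (E : Set (RSpace n)), MeasurableSet E → E ⊆ P.cell →
      volume P.cell ≤ 2 * volume E → ∀ h G : RSpace n → ℝ≥0∞,
      ((volume P.dilate)⁻¹ * ∫⁻ x in P.dilate, h x ∂σ) * ∫⁻ x in P.cell, G x ∂W ≤
        c₀ * ((∫⁻ x in E, ballMaximal σ h x ^ p ∂σ) ^ (1 / p) *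
          (∫⁻ x in E, ballMaximal W G x ^ (p / (p - 1)) ∂W) ^ (1 - 1 / p)) := by
  have hp0 : 0 < p := by linarith
  have hp1 : p - 1 ≠ 0 := by linarith
  obtain ⟨p', hp'⟩ : ∃ p', p' = p / (p - 1) := ⟨_, rfl⟩
  have hp'1 : 1 < p' := by rw [hp', lt_div_iff₀ (by linarith)]; linarith
  have hp'0 : 0 < p' := by linarith
  have hconj : 1 - 1 / p = 1 / p' := by rw [hp']; field_simp
  have hs := hA.symm hp
  rw [← hp'] at hs ⊢
  obtain ⟨A₁, hA₁⟩ : ∃ A : ℝ≥0, A = (C * (ballRatio n 2 * 2)) ^ p := ⟨_, rfl⟩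
  obtain ⟨A₂, hA₂⟩ : ∃ A : ℝ≥0, A = (C * (ballRatio n 2 * 2)) ^ p' := ⟨_, rfl⟩
  obtain ⟨c₀, hc₀⟩ : ∃ c₀ : ℝ≥0∞, c₀ = C * ((A₂ : ℝ≥0∞) ^ (1 / p) * (A₁ : ℝ≥0∞) ^ (1 / p')) :=
    ⟨_, rfl⟩
  have hc₀t : c₀ ≠ ∞ := by
    have h1 : 0 ≤ 1 / p := by positivity
    have h2 : 0 ≤ 1 / p' := by positivity
    rw [hc₀]
    finiteness
  refine ⟨c₀.toNNReal, fun P E hEm hEcell hvolE h G => ?_⟩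
  rw [ENNReal.coe_toNNReal hc₀t, hconj]
  have hr : 0 < 2 * P.rad := by linarith [P.rad_pos]
  have hEsub : E ⊆ P.dilate := hEcell.trans (P.cell_subset_ball.trans
    (ball_subset_ball (by linarith [P.rad_pos])))
  have hvol : volume P.dilate ≤ (ballRatio n 2 * 2 : ℝ≥0) * volume E := by
    rw [volume_dilate, ENNReal.coe_mul, mul_assoc]
    gcongr
    exact hvolE
  have hW : W P.dilate ≤ A₁ * W E := hA₁ ▸ hA.measure_ball_le hp hr hEm hEsub hvol
  have hσ : σ P.dilate ≤ A₂ * σ E := hA₂ ▸ hs.measure_ball_le hp'1 hr hEm hEsub hvol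
  have hW0 : W P.dilate ≠ 0 := hA.pos_left _ _ hr
  have hWt : W P.dilate ≠ ∞ := hA.finite_left _ _
  have hσ0 : σ P.dilate ≠ 0 := hA.pos_right _ _ hr
  have hσt : σ P.dilate ≠ ∞ := hA.finite_right _ _
  obtain ⟨X, hX⟩ : ∃ X, X = (σ P.dilate)⁻¹ * ∫⁻ x in P.dilate, h x ∂σ := ⟨_, rfl⟩
  obtain ⟨Y, hY⟩ : ∃ Y, Y = (W P.dilate)⁻¹ * ∫⁻ x in P.dilate, G x ∂W := ⟨_, rfl⟩
  have hXeq : ∫⁻ x in P.dilate, h x ∂σ = σ P.dilate * X := by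
    rw [hX, ← mul_assoc, ENNReal.mul_inv_cancel hσ0 hσt, one_mul]
  have hYeq : ∫⁻ x in P.dilate, G x ∂W = W P.dilate * Y := by
    rw [hY, ← mul_assoc, ENNReal.mul_inv_cancel hW0 hWt, one_mul]
  have hXM : X * σ E ^ (1 / p) ≤ (∫⁻ x in E, ballMaximal σ h x ^ p ∂σ) ^ (1 / p) := by
    have : X ^ p * σ E ≤ ∫⁻ x in E, ballMaximal σ h x ^ p ∂σ := by
      rw [← setLIntegral_const]
      refine setLIntegral_mono' hEm fun x hx => ?_
      rw [hX]; gcongr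
      exact le_ballMaximal σ h (hEsub hx)
    calc X * σ E ^ (1 / p) = (X ^ p * σ E) ^ (1 / p) := by
          rw [ENNReal.mul_rpow_of_nonneg _ _ (by positivity), ← ENNReal.rpow_mul,
            mul_one_div_cancel hp0.ne', ENNReal.rpow_one]
      _ ≤ _ := by gcongr
  have hYM : Y * W E ^ (1 / p') ≤ (∫⁻ x in E, ballMaximal W G x ^ p' ∂W) ^ (1 / p') := by
    have : Y ^ p' * W E ≤ ∫⁻ x in E, ballMaximal W G x ^ p' ∂W := by
      rw [← setLIntegral_const]
      refine setLIntegral_mono' hEm fun x hx => ?_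
      rw [hY]; gcongr
      exact le_ballMaximal W G (hEsub hx)
    calc Y * W E ^ (1 / p') = (Y ^ p' * W E) ^ (1 / p') := by
          rw [ENNReal.mul_rpow_of_nonneg _ _ (by positivity), ← ENNReal.rpow_mul,
            mul_one_div_cancel hp'0.ne', ENNReal.rpow_one]
      _ ≤ _ := by gcongr
  have hAp := hA.bound P.corner (2 * P.rad) hr
  rw [hconj] at hAp
  -- Both measures are split into their 1/p and 1/p' powers: W^(1/p) σ^(1/p') is absorbed with
  -- |P*|⁻¹ by the `A_p` condition, and the remaining σ^(1/p), W^(1/p') are moved from P* to E at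
  -- the cost of a constant.
  have hsplitσ : σ P.dilate = σ P.dilate ^ (1 / p) * σ P.dilate ^ (1 / p') := by
    rw [← hconj, ← ENNReal.rpow_add _ _ hσ0 hσt, add_sub_cancel, ENNReal.rpow_one]
  have hsplitW : W P.dilate = W P.dilate ^ (1 / p) * W P.dilate ^ (1 / p') := by
    rw [← hconj, ← ENNReal.rpow_add _ _ hW0 hWt, add_sub_cancel, ENNReal.rpow_one]
  calc ((volume P.dilate)⁻¹ * ∫⁻ x in P.dilate, h x ∂σ) * ∫⁻ x in P.cell, G x ∂W
      ≤ ((volume P.dilate)⁻¹ * ∫⁻ x in P.dilate, h x ∂σ) * ∫⁻ x in P.dilate, G x ∂W := by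
        gcongr
        exact P.cell_subset_ball.trans (ball_subset_ball (by linarith [P.rad_pos]))
    _ = ((volume P.dilate)⁻¹ * (W P.dilate ^ (1 / p) * σ P.dilate ^ (1 / p'))) *
        ((X * σ P.dilate ^ (1 / p)) * (Y * W P.dilate ^ (1 / p'))) := by
        rw [hXeq, hYeq]
        nth_rewrite 1 [hsplitσ, hsplitW]
        ring
    _ ≤ C * ((X * (A₂ * σ E) ^ (1 / p)) * (Y * (A₁ * W E) ^ (1 / p'))) := by
        gcongr
        rw [ENNReal.inv_mul_le_iff P.volume_dilate_ne_zero P.volume_dilate_ne_top, mul_comm _ (C : ℝ≥0∞)]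
        exact hAp
    _ = c₀ * ((X * σ E ^ (1 / p)) * (Y * W E ^ (1 / p'))) := by
        rw [ENNReal.mul_rpow_of_nonneg _ _ (by positivity),
          ENNReal.mul_rpow_of_nonneg _ _ (by positivity), hc₀]
        ring
    _ ≤ _ := by gcongr

/-- The weighted bound for a sparse form. -/
theorem exists_sparse_form_le (hA : IsApPair p W σ C) [SFinite W] [SFinite σ] (hp : 1 < p) :
    ∃ B : ℝ≥0, ∀ ch : DyadicCube n → Set (DyadicCube n), IsSparseSelection ch →
      ∀ Q : DyadicCube n, ∀ h G : RSpace n → ℝ≥0∞, AEMeasurable h σ → AEMeasurable G W →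
      ∑' i : (m : ℕ) × generation ch Q m, ((volume i.2.1.dilate)⁻¹ *
          ∫⁻ x in i.2.1.dilate, h x ∂σ) * ∫⁻ x in i.2.1.cell, G x ∂W ≤
        B * ((∫⁻ x, h x ^ p ∂σ) ^ (1 / p) *
          (∫⁻ x, G x ^ (p / (p - 1)) ∂W) ^ (1 - 1 / p)) := by
  obtain ⟨c₀, hc₀⟩ := hA.exists_dilate_term_le hp
  have hp0 : 0 < p := by linarith
  have hp1 : p - 1 ≠ 0 := by linarith
  obtain ⟨p', hp'⟩ : ∃ p', p' = p / (p - 1) := ⟨_, rfl⟩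
  have hp'1 : 1 < p' := by rw [hp', lt_div_iff₀ (by linarith)]; linarith
  rw [← hp'] at hc₀ ⊢
  obtain ⟨D₁, hD₁⟩ := hA.isBallDoubling_left hp
  obtain ⟨D₂, hD₂⟩ := hA.isBallDoubling_right hp
  obtain ⟨M₁, hM₁⟩ := ballMaximal_strong hD₁ hp'1
  obtain ⟨M₂, hM₂⟩ := ballMaximal_strong hD₂ hp
  have h1 : 0 ≤ 1 / p := by positivity
  have h2 : 0 ≤ 1 - 1 / p := by
    rw [sub_nonneg, div_le_one hp0]
    exact hp.le
  obtain ⟨c₁, hc₁⟩ : ∃ c₁ : ℝ≥0∞,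
      c₁ = c₀ * ((M₂ : ℝ≥0∞) ^ (1 / p) * (M₁ : ℝ≥0∞) ^ (1 - 1 / p)) := ⟨_, rfl⟩
  have hc₁t : c₁ ≠ ∞ := by
    rw [hc₁]
    finiteness
  refine ⟨c₁.toNNReal, fun ch hch Q h G hh hG => ?_⟩
  rw [ENNReal.coe_toNNReal hc₁t]
  -- The cores are disjoint. This is the only place where sparseness yields summability; their large
  -- volume enters in `hterms`.
  have hsum : ∀ (ν : Measure (RSpace n)) (u : RSpace n → ℝ≥0∞),
      ∑' i : (m : ℕ) × generation ch Q m, ∫⁻ x in core ch i.2.1, u x ∂ν ≤ ∫⁻ x, u x ∂ν := by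
    intro ν u
    rw [← lintegral_iUnion (s := fun i : (m : ℕ) × generation ch Q m => core ch i.2.1)
      (fun i => measurableSet_core ch i.2.1) (hch.core_disjoint Q)]
    exact setLIntegral_le_lintegral _ _
  have hstep : ∑' i : (m : ℕ) × generation ch Q m,
      (∫⁻ x in core ch i.2.1, ballMaximal σ h x ^ p ∂σ) ^ (1 / p) *
        (∫⁻ x in core ch i.2.1, ballMaximal W G x ^ p' ∂W) ^ (1 - 1 / p) ≤
      (M₂ * ∫⁻ x, h x ^ p ∂σ) ^ (1 / p) * (M₁ * ∫⁻ x, G x ^ p' ∂W) ^ (1 - 1 / p) := by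
    refine (ENNReal.tsum_rpow_mul_rpow_le hp _ _).trans (mul_le_mul' ?_ ?_)
    · exact ENNReal.rpow_le_rpow ((hsum σ _).trans (hM₂ h hh)) h1
    · exact ENNReal.rpow_le_rpow ((hsum W _).trans (hM₁ G hG)) h2
  have hterms : ∑' i : (m : ℕ) × generation ch Q m, ((volume i.2.1.dilate)⁻¹ *
      ∫⁻ x in i.2.1.dilate, h x ∂σ) * ∫⁻ x in i.2.1.cell, G x ∂W ≤
      ∑' i : (m : ℕ) × generation ch Q m,
      c₀ * ((∫⁻ x in core ch i.2.1, ballMaximal σ h x ^ p ∂σ) ^ (1 / p) *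
        (∫⁻ x in core ch i.2.1, ballMaximal W G x ^ p' ∂W) ^ (1 - 1 / p)) := by
    refine ENNReal.tsum_le_tsum fun i => ?_
    exact hc₀ i.2.1 (core ch i.2.1) (measurableSet_core ch i.2.1) sdiff_subset
      (hch.volume_cell_le i.2.1) h G
  rw [ENNReal.tsum_mul_left] at hterms
  have hlast : (c₀ : ℝ≥0∞) * ((M₂ * ∫⁻ x, h x ^ p ∂σ) ^ (1 / p) *
      (M₁ * ∫⁻ x, G x ^ p' ∂W) ^ (1 - 1 / p)) =
      c₁ * ((∫⁻ x, h x ^ p ∂σ) ^ (1 / p) * (∫⁻ x, G x ^ p' ∂W) ^ (1 - 1 / p)) := by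
    rw [ENNReal.mul_rpow_of_nonneg _ _ h1, ENNReal.mul_rpow_of_nonneg _ _ h2, hc₁]
    ring
  rw [← hlast]
  exact hterms.trans (mul_le_mul_right hstep _)

end IsApPair

end

section

/-! ### The weighted bound -/

/-- Absorption: X^(1 - 1/p) is divided out, which requires X to be finite. Together with testing
against a power it replaces duality. -/
theorem ENNReal.le_of_le_mul_rpow {p : ℝ} (hp : 1 < p) {X c : ℝ≥0∞} (hX : X ≠ ∞)
    (h : X ≤ c * X ^ (1 - 1 / p)) : X ≤ c ^ p := by
  have hp0 : 0 < p := by linarith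
  by_cases h0 : X = 0
  · simp [h0]
  have h1 : X = X ^ (1 / p) * X ^ (1 - 1 / p) := by
    rw [← ENNReal.rpow_add _ _ h0 hX, add_sub_cancel, ENNReal.rpow_one]
  have h2 : X ^ (1 - 1 / p) ≠ 0 := by simp [h0, hX]
  have h3 : X ^ (1 - 1 / p) ≠ ∞ := by simp [h0, hX]
  have h4 : X ^ (1 / p) ≤ c := by
    nth_rewrite 1 [h1] at h
    exact (ENNReal.mul_le_mul_iff_left h2 h3).1 h
  calc X = (X ^ (1 / p)) ^ p := by
        rw [← ENNReal.rpow_mul, one_div_mul_cancel hp0.ne', ENNReal.rpow_one]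
    _ ≤ _ := by gcongr

theorem eLpNorm_ofReal_eq {X : Type*} [MeasurableSpace X] {ν : Measure X} {p : ℝ} (hp : 0 < p)
    (f : X → ℂ) : eLpNorm f (ENNReal.ofReal p) ν = (∫⁻ x, ‖f x‖ₑ ^ p ∂ν) ^ (1 / p) := by
  rw [eLpNorm_eq_lintegral_rpow_enorm_toReal (by simpa using hp) ENNReal.ofReal_ne_top,
    ENNReal.toReal_ofReal hp.le]

namespace DyadicCube

variable {n : ℕ}

/-- No single dyadic cube contains a ball around the origin; the 2^n cubes of side 2^N with corner
coordinates -2^N or 0 do so together. -/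
theorem ball_subset_iUnion_cell (N : ℕ) :
    ball (0 : RSpace n) (2 ^ N) ⊆
      ⋃ m ∈ Fintype.piFinset fun _ : Fin n => ({-1, 0} : Finset ℤ), cell (-(N : ℤ), m) := by
  intro x hx
  have hx' : ‖x‖ < 2 ^ N := by simpa using hx
  refine mem_biUnion (x := fun i => ⌊x i * 2 ^ (-(N : ℤ))⌋) ?_ fun i => rfl
  simp only [SetLike.mem_coe, Fintype.mem_piFinset, Finset.mem_insert, Finset.mem_singleton]
  intro i
  have h1 : |x i| < 2 ^ N := (by simpa using PiLp.norm_apply_le x i : |x i| ≤ ‖x‖).trans_lt hx'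
  obtain ⟨h2, h3⟩ := abs_lt.1 h1
  have h4 : (0 : ℝ) < 2 ^ N := by positivity
  have h5 : ⌊x i * 2 ^ (-(N : ℤ))⌋ < 1 := by
    rw [Int.floor_lt, zpow_neg, zpow_natCast, ← div_eq_mul_inv, div_lt_iff₀ h4]
    simpa using h3
  have h6 : -1 ≤ ⌊x i * 2 ^ (-(N : ℤ))⌋ := by
    rw [Int.le_floor, zpow_neg, zpow_natCast, ← div_eq_mul_inv, le_div_iff₀ h4]
    push_cast
    linarith
  omega

theorem ball_subset_dilate {N : ℕ} {m : Fin n → ℤ}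
    (hm : m ∈ Fintype.piFinset fun _ : Fin n => ({-1, 0} : Finset ℤ)) {R : ℝ} (hR : R ≤ 2 ^ N) :
    ball (0 : RSpace n) R ⊆ dilate (-(N : ℤ), m) := by
  have h4 : (0 : ℝ) < 2 ^ N := by positivity
  have hnorm : ‖corner ((-(N : ℤ), m) : DyadicCube n)‖ ≤ n * 2 ^ N := by
    rw [EuclideanSpace.norm_eq]
    refine Real.sqrt_le_iff.2 ⟨by positivity, ?_⟩
    calc ∑ i, ‖corner ((-(N : ℤ), m) : DyadicCube n) i‖ ^ 2 ≤ ∑ _i : Fin n, ((2 : ℝ) ^ N) ^ 2 := by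
          refine Finset.sum_le_sum fun i _ => ?_
          have hi := Fintype.mem_piFinset.1 hm i
          simp only [Finset.mem_insert, Finset.mem_singleton] at hi
          simp only [corner, neg_neg, zpow_natCast]
          rcases hi with hi | hi <;> simp [hi]
      _ = n * ((2 : ℝ) ^ N) ^ 2 := by simp
      _ ≤ (n * 2 ^ N) ^ 2 := by
          rw [mul_pow]
          gcongr
          exact_mod_cast Nat.le_self_pow two_ne_zero n
  intro x hx
  have hx' : ‖x‖ < R := by simpa using hx
  rw [dilate, mem_ball, dist_eq_norm, rad]
  have := norm_sub_le x (corner ((-(N : ℤ), m) : DyadicCube n))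
  simp only [neg_neg, zpow_natCast]
  have h5 : (0 : ℝ) ≤ n * 2 ^ N := by positivity
  nlinarith

end DyadicCube

namespace IsThetaCZO

variable {n : ℕ} {θ : ℝ → ℝ} {T : 𝓢(RSpace n, ℂ) →ₗ[ℂ] 𝓢'(RSpace n, ℂ)}
  {T₂ : Lp ℂ 2 (volume : Measure (RSpace n)) →L[ℂ] Lp ℂ 2 (volume : Measure (RSpace n))}
  {K : RSpace n → RSpace n → ℂ} {p : ℝ} {w : RSpace n → ℝ}

open DyadicCube

/-- Sparse domination in bilinear form. -/
theorem exists_lintegral_mul_le (hT : IsThetaCZO θ T T₂ K) (hθ : IsDiniModulus θ) (hn : 1 ≤ n)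
    (hp : 1 < p) (hw : IsMuckenhouptAp p w) :
    ∃ B : ℝ≥0, ∀ f : RSpace n → ℂ, MemLp f 2 volume → Integrable f volume → ∀ Q : DyadicCube n,
      ∀ G : RSpace n → ℝ≥0∞, Measurable G →
      ∫⁻ x in Q.cell, ‖localPiece T₂ f Q x‖ₑ * G x ∂(weightMeasure w) ≤
        B * ((∫⁻ x, ‖f x‖ₑ ^ p ∂(weightMeasure w)) ^ (1 / p) *
          (∫⁻ x, G x ^ (p / (p - 1)) ∂(weightMeasure w)) ^ (1 - 1 / p)) := by
  obtain ⟨A, hA⟩ := hT.exists_sparse_step hθ hn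
  obtain ⟨C, hC⟩ := hw.isApPair hp
  obtain ⟨B, hB⟩ := hC.exists_sparse_form_le hp
  refine ⟨2 * A * B, fun f hf hf1 Q G hG => ?_⟩
  -- For fixed f the children of all cubes are chosen at once, so that the step can be iterated as a
  -- selection rule.
  choose ch hdisj hsub hsmall hdom using hA f hf hf1
  have hch : IsSparseSelection ch := ⟨hdisj, fun Q P hP => (hsub Q P hP).2, hsmall⟩
  obtain ⟨h, hh, hh1, hhp⟩ := IsMuckenhouptAp.exists_dual_density hw.isWeight hp hf.1.enorm
  have hptw := hch.ae_le_tsum (u := fun Q x => ‖localPiece T₂ f Q x‖ₑ)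
    (a := fun Q => A * dilateAvg f Q) (ae_all_iff.2 hdom) Q
  have hptw' := (IsWeight.measure_absolutelyContinuous w).ae_le hptw
  have havg : ∀ P : DyadicCube n, dilateAvg f P =
      (volume P.dilate)⁻¹ * ∫⁻ x in P.dilate, h x ∂(dualMeasure p w) := fun P => by
    rw [dilateAvg, hh1 _ P.measurableSet_dilate]
  have hform := hB ch hch Q h G hh hG.aemeasurable
  have hhp' := hhp univ MeasurableSet.univ
  rw [setLIntegral_univ, setLIntegral_univ] at hhp'
  rw [hhp'] at hform
  calc ∫⁻ x in Q.cell, ‖localPiece T₂ f Q x‖ₑ * G x ∂(weightMeasure w)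
      ≤ ∫⁻ x in Q.cell, ∑' i : (m : ℕ) × generation ch Q m,
          2 * (A * dilateAvg f i.2.1) * i.2.1.cell.indicator G x ∂(weightMeasure w) := by
        refine setLIntegral_mono_ae' Q.measurableSet_cell ?_
        filter_upwards [hptw'] with x hx hxQ
        refine (mul_le_mul_left (hx hxQ) (G x)).trans (le_of_eq ?_)
        rw [← ENNReal.tsum_mul_left, ← ENNReal.tsum_mul_right]
        refine tsum_congr fun i => ?_
        by_cases hi : x ∈ i.2.1.cell
        · rw [indicator_of_mem hi, indicator_of_mem hi]
        · rw [indicator_of_notMem hi, indicator_of_notMem hi]; simp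
    _ ≤ ∫⁻ x, ∑' i : (m : ℕ) × generation ch Q m,
          2 * (A * dilateAvg f i.2.1) * i.2.1.cell.indicator G x ∂(weightMeasure w) :=
        setLIntegral_le_lintegral _ _
    _ = ∑' i : (m : ℕ) × generation ch Q m, 2 * A * (((volume i.2.1.dilate)⁻¹ *
          ∫⁻ x in i.2.1.dilate, h x ∂(dualMeasure p w)) *
            ∫⁻ x in i.2.1.cell, G x ∂(weightMeasure w)) := by
        rw [lintegral_tsum fun i =>
          ((hG.indicator i.2.1.measurableSet_cell).const_mul _).aemeasurable]
        refine tsum_congr fun i => ?_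
        rw [lintegral_const_mul _ (hG.indicator i.2.1.measurableSet_cell),
          lintegral_indicator i.2.1.measurableSet_cell, havg]
        ring
    _ ≤ _ := by
        rw [ENNReal.tsum_mul_left, ENNReal.coe_mul, ENNReal.coe_mul, mul_assoc (_ * _) (B : ℝ≥0∞)]
        exact mul_le_mul_right hform _

/-- The form is tested against G = v^(p-1) on Q, where v is |T(f χ_{Q*})| truncated at N. Then
G^(p') = v^p, so the same integral reappears to the power 1 - 1/p and is absorbed; it is finite
thanks to the truncation and w(Q) < ∞. -/
theorem exists_lintegral_localPiece_le (hT : IsThetaCZO θ T T₂ K) (hθ : IsDiniModulus θ)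
    (hn : 1 ≤ n) (hp : 1 < p) (hw : IsMuckenhouptAp p w) :
    ∃ B : ℝ≥0, ∀ f : RSpace n → ℂ, MemLp f 2 volume → Integrable f volume → ∀ Q : DyadicCube n,
      ∫⁻ x in Q.cell, ‖localPiece T₂ f Q x‖ₑ ^ p ∂(weightMeasure w) ≤
        B * ∫⁻ x, ‖f x‖ₑ ^ p ∂(weightMeasure w) := by
  have hp0 : 0 < p := by linarith
  have hp1 : 0 < p - 1 := by linarith
  obtain ⟨B, hB⟩ := hT.exists_lintegral_mul_le hθ hn hp hw
  refine ⟨B ^ p, fun f hf hf1 Q => ?_⟩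
  have hum : Measurable fun x => ‖localPiece T₂ f Q x‖ₑ := stronglyMeasurable_l2Apply.measurable.enorm
  refine lintegral_rpow_le_of_forall_min hp.le hum fun N => ?_
  obtain ⟨v, hv⟩ : ∃ v : RSpace n → ℝ≥0∞, v = fun x => min ‖localPiece T₂ f Q x‖ₑ N := ⟨_, rfl⟩
  have hvm : Measurable v := hv ▸ hum.min measurable_const
  have hX : ∫⁻ x in Q.cell, v x ^ p ∂(weightMeasure w) ≠ ∞ := by
    have : ∫⁻ x in Q.cell, v x ^ p ∂(weightMeasure w) ≤
        (N : ℝ≥0∞) ^ p * weightMeasure w Q.cell := by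
      rw [← setLIntegral_const]
      refine lintegral_mono fun x => ?_
      rw [hv]
      gcongr
      exact min_le_right _ _
    refine ne_top_of_le_ne_top (ENNReal.mul_ne_top (by finiteness) ?_) this
    exact ne_top_of_le_ne_top (hw.isWeight.measure_ball_ne_top _ _) (measure_mono Q.cell_subset_ball)
  have hGm : Measurable (Q.cell.indicator fun x => v x ^ (p - 1)) :=
    (hvm.pow_const _).indicator Q.measurableSet_cell
  have hGp : ∫⁻ x, Q.cell.indicator (fun x => v x ^ (p - 1)) x ^ (p / (p - 1)) ∂(weightMeasure w) =
      ∫⁻ x in Q.cell, v x ^ p ∂(weightMeasure w) := by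
    rw [← lintegral_indicator Q.measurableSet_cell]
    refine lintegral_congr fun x => ?_
    by_cases hx : x ∈ Q.cell
    · rw [indicator_of_mem hx, indicator_of_mem hx, ← ENNReal.rpow_mul, mul_div_cancel₀ _ hp1.ne']
    · rw [indicator_of_notMem hx, indicator_of_notMem hx, ENNReal.zero_rpow_of_pos (by positivity)]
  have hkey := hB f hf hf1 Q _ hGm
  rw [hGp, ← mul_assoc] at hkey
  have hle : ∫⁻ x in Q.cell, v x ^ p ∂(weightMeasure w) ≤
      ∫⁻ x in Q.cell, ‖localPiece T₂ f Q x‖ₑ * Q.cell.indicator (fun x => v x ^ (p - 1)) x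
        ∂(weightMeasure w) := by
    refine setLIntegral_mono' Q.measurableSet_cell fun x hx => ?_
    rw [indicator_of_mem hx]
    calc v x ^ p = v x ^ (1 + (p - 1)) := by rw [add_sub_cancel]
      _ = v x * v x ^ (p - 1) := by
          rw [ENNReal.rpow_add_of_nonneg _ _ zero_le_one hp1.le, ENNReal.rpow_one]
      _ ≤ _ := by
          gcongr
          rw [hv]
          exact min_le_left _ _
  have hfin := ENNReal.le_of_le_mul_rpow hp hX (hle.trans hkey)
  rw [ENNReal.mul_rpow_of_nonneg _ _ hp0.le, ← ENNReal.rpow_mul, one_div_mul_cancel hp0.ne',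
    ENNReal.rpow_one, ← ENNReal.coe_rpow_of_nonneg _ hp0.le] at hfin
  simpa only [hv] using hfin

/-- The weighted bound for square integrable functions with bounded support. -/
theorem exists_eLpNorm_l2Apply_le (hT : IsThetaCZO θ T T₂ K) (hθ : IsDiniModulus θ)
    (hn : 1 ≤ n) (hp : 1 < p) (hw : IsMuckenhouptAp p w) :
    ∃ B : ℝ≥0, ∀ f : RSpace n → ℂ, MemLp f 2 volume → ∀ R : ℝ, (∀ x ∉ ball 0 R, f x = 0) →
      eLpNorm (l2Apply T₂ f) (ENNReal.ofReal p) (weightMeasure w) ≤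
        B * eLpNorm f (ENNReal.ofReal p) (weightMeasure w) := by
  have hp0 : 0 < p := by linarith
  obtain ⟨B, hB⟩ := hT.exists_lintegral_localPiece_le hθ hn hp hw
  obtain ⟨S, hS⟩ : ∃ S, S = Fintype.piFinset fun _ : Fin n => ({-1, 0} : Finset ℤ) := ⟨_, rfl⟩
  refine ⟨(S.card * B) ^ (1 / p), fun f hf R hfR => ?_⟩
  have hsupp : (ball (0 : RSpace n) R).indicator f = f :=
    indicator_eq_self.2 fun x hx => by_contra fun hxR => hx (hfR x hxR)
  have hf1 : Integrable f volume := by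
    rw [← hsupp, integrable_indicator_iff measurableSet_ball]
    have : IsFiniteMeasure ((volume : Measure (RSpace n)).restrict (ball 0 R)) :=
      ⟨by simpa using (volume_ball_ne_top (0 : RSpace n) R).lt_top⟩
    exact (hf.restrict _).integrable (by norm_num)
  obtain ⟨N₀, hN₀⟩ := pow_unbounded_of_one_lt R one_lt_two
  have hball : ∀ N : ℕ, ∫⁻ x in ball 0 (2 ^ (N + N₀)), ‖l2Apply T₂ f x‖ₑ ^ p ∂(weightMeasure w) ≤
      S.card * B * ∫⁻ x, ‖f x‖ₑ ^ p ∂(weightMeasure w) := by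
    intro N
    have hRN : R ≤ 2 ^ (N + N₀) :=
      hN₀.le.trans (pow_le_pow_right₀ one_le_two (Nat.le_add_left _ _))
    calc _ ≤ ∫⁻ x in ⋃ m : S, cell (-((N + N₀ : ℕ) : ℤ), m.1), ‖l2Apply T₂ f x‖ₑ ^ p
          ∂(weightMeasure w) := by
          refine lintegral_mono_set ?_
          refine (ball_subset_iUnion_cell (N + N₀)).trans (iUnion₂_subset fun m hm => ?_)
          exact subset_iUnion (fun m : S => cell (-((N + N₀ : ℕ) : ℤ), m.1)) ⟨m, hS ▸ hm⟩
      _ ≤ ∑ m ∈ S, ∫⁻ x in cell (-((N + N₀ : ℕ) : ℤ), m), ‖l2Apply T₂ f x‖ₑ ^ p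
          ∂(weightMeasure w) := by
          refine (lintegral_iUnion_le _ _).trans (le_of_eq ?_)
          rw [tsum_fintype]
          exact Finset.sum_coe_sort S fun m => ∫⁻ x in cell (-((N + N₀ : ℕ) : ℤ), m),
            ‖l2Apply T₂ f x‖ₑ ^ p ∂(weightMeasure w)
      _ ≤ ∑ _m ∈ S, B * ∫⁻ x, ‖f x‖ₑ ^ p ∂(weightMeasure w) := by
          refine Finset.sum_le_sum fun m hm => ?_
          have := hB f hf hf1 (-((N + N₀ : ℕ) : ℤ), m)
          -- The enlarged ball contains the support of f, so the local piece is T f itself; the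
          -- bound does not depend on the size of the cubes.
          rwa [localPiece, indicator_eq_self.2] at this
          refine Function.support_subset_iff'.2 fun x hx => hfR x fun hxR => hx ?_
          exact ball_subset_dilate (hS ▸ hm) hRN hxR
      _ = _ := by rw [Finset.sum_const, nsmul_eq_mul, mul_assoc]
  have hmono : Monotone fun N : ℕ => ball (0 : RSpace n) (2 ^ (N + N₀)) := fun a b hab =>
    ball_subset_ball (pow_le_pow_right₀ one_le_two (by omega))
  have huniv : ⋃ N : ℕ, ball (0 : RSpace n) (2 ^ (N + N₀)) = univ := by
    refine eq_univ_of_forall fun x => mem_iUnion.2 ?_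
    obtain ⟨N, hN⟩ := pow_unbounded_of_one_lt ‖x‖ one_lt_two
    refine ⟨N, ?_⟩
    simpa using hN.trans_le (pow_le_pow_right₀ one_le_two (Nat.le_add_right _ _))
  have htot : ∫⁻ x, ‖l2Apply T₂ f x‖ₑ ^ p ∂(weightMeasure w) ≤
      S.card * B * ∫⁻ x, ‖f x‖ₑ ^ p ∂(weightMeasure w) := by
    rw [← setLIntegral_univ, ← huniv, setLIntegral_iUnion_of_directed _ hmono.directed_le]
    exact iSup_le hball
  rw [eLpNorm_ofReal_eq hp0, eLpNorm_ofReal_eq hp0, ENNReal.coe_rpow_of_nonneg _ (by positivity),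
    ← ENNReal.mul_rpow_of_nonneg _ _ (by positivity)]
  push_cast
  gcongr

end IsThetaCZO

end

section

/-! ### The extension of the operator to weighted spaces -/

/-- `B` bounds the operator in `L^p(w)` on square integrable functions with bounded support. -/
def IsWeightedBound {n : ℕ}
    (T₂ : Lp ℂ 2 (volume : Measure (RSpace n)) →L[ℂ] Lp ℂ 2 (volume : Measure (RSpace n)))
    (p : ℝ) (w : RSpace n → ℝ) (B : ℝ≥0) : Prop :=
  ∀ f : RSpace n → ℂ, MemLp f 2 volume → ∀ R : ℝ, (∀ x ∉ ball 0 R, f x = 0) →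
    eLpNorm (l2Apply T₂ f) (ENNReal.ofReal p) (weightMeasure w) ≤
      B * eLpNorm f (ENNReal.ofReal p) (weightMeasure w)

theorem HasCompactSupport.exists_ball {n : ℕ} {φ : RSpace n → ℂ} (hφ : HasCompactSupport φ) :
    ∃ R : ℝ, 0 < R ∧ ∀ x ∉ ball (0 : RSpace n) R, φ x = 0 := by
  obtain ⟨R, hR, h⟩ := hφ.isCompact.isBounded.subset_ball_lt 0 0
  exact ⟨R, hR, fun x hx => image_eq_zero_of_notMem_tsupport fun hx' => hx (h hx')⟩

theorem IsWeight.isFiniteMeasureOnCompacts {n : ℕ} {w : RSpace n → ℝ} (hw : IsWeight w) :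
    IsFiniteMeasureOnCompacts (weightMeasure w) :=
  ⟨fun S hS => by
    obtain ⟨R, h⟩ := hS.isBounded.subset_ball 0
    exact (measure_mono h).trans_lt (hw.measure_ball_ne_top 0 R).lt_top⟩

theorem ENNReal.tendsto_nhds_zero_of_le {u v : ℕ → ℝ≥0∞} (hv : Tendsto v atTop (𝓝 0))
    (h : ∀ k, u k ≤ v k) : Tendsto u atTop (𝓝 0) :=
  tendsto_of_tendsto_of_tendsto_of_le_of_le tendsto_const_nhds hv (fun _ => bot_le) h

variable {n : ℕ} {p : ℝ} {w : RSpace n → ℝ} {B : ℝ≥0}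
  {T₂ : Lp ℂ 2 (volume : Measure (RSpace n)) →L[ℂ] Lp ℂ 2 (volume : Measure (RSpace n))}

theorem IsWeightedBound.schwartz_sub (hB : IsWeightedBound T₂ p w B) (φ ψ : 𝓢(RSpace n, ℂ))
    (hφ : HasCompactSupport φ) (hψ : HasCompactSupport ψ) :
    eLpNorm (fun x => l2Apply T₂ φ x - l2Apply T₂ ψ x) (ENNReal.ofReal p) (weightMeasure w) ≤
      B * eLpNorm (fun x => φ x - ψ x) (ENNReal.ofReal p) (weightMeasure w) := by
  obtain ⟨R, -, hR⟩ := hφ.exists_ball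
  obtain ⟨S, -, hS⟩ := hψ.exists_ball
  have hsub := l2Apply_sub (T₂ := T₂) (φ.memLp 2 volume) (ψ.memLp 2 volume)
  have h := hB (fun x => φ x - ψ x) ((φ.memLp 2 volume).sub (ψ.memLp 2 volume)) (max R S)
    fun x hx => by
      rw [hR x fun h => hx (ball_subset_ball (le_max_left _ _) h),
        hS x fun h => hx (ball_subset_ball (le_max_right _ _) h), sub_zero]
  refine le_trans (le_of_eq (eLpNorm_congr_ae ?_)) h
  exact ((IsWeight.measure_absolutelyContinuous w).ae_eq hsub).symm

/-- Images of a convergent sequence of test functions converge in `L^p(w)`. -/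
theorem IsWeightedBound.exists_tendsto (hB : IsWeightedBound T₂ p w B) (hw : IsWeight w)
    (hp : 1 ≤ p) {h : RSpace n → ℂ} (hh : MemLp h (ENNReal.ofReal p) (weightMeasure w))
    {φ : ℕ → 𝓢(RSpace n, ℂ)} (hφ : ∀ k, HasCompactSupport (φ k))
    (hlim : Tendsto (fun k => eLpNorm (fun x => φ k x - h x) (ENNReal.ofReal p) (weightMeasure w))
      atTop (𝓝 0)) :
    ∃ g : RSpace n → ℂ, MemLp g (ENNReal.ofReal p) (weightMeasure w) ∧
      Tendsto (fun k => eLpNorm (fun x => l2Apply T₂ (φ k) x - g x) (ENNReal.ofReal p)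
        (weightMeasure w)) atTop (𝓝 0) := by
  have hfc := hw.isFiniteMeasureOnCompacts
  have hP1 : 1 ≤ ENNReal.ofReal p := by simpa using hp
  have : Fact (1 ≤ ENNReal.ofReal p) := ⟨hP1⟩
  have hφm : ∀ k, MemLp (φ k) (ENNReal.ofReal p) (weightMeasure w) := fun k =>
    (φ k).continuous.memLp_of_hasCompactSupport (hφ k)
  have hum : ∀ k, MemLp (l2Apply T₂ (φ k)) (ENNReal.ofReal p) (weightMeasure w) := fun k => by
    obtain ⟨R, -, hR⟩ := (hφ k).exists_ball
    exact ⟨stronglyMeasurable_l2Apply.aestronglyMeasurable,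
      (hB _ ((φ k).memLp 2 volume) R hR).trans_lt
        (ENNReal.mul_lt_top ENNReal.coe_lt_top (hφm k).2)⟩
  have hcau : CauchySeq fun k => (hum k).toLp (l2Apply T₂ (φ k)) := by
    have h1 : Tendsto (fun k => (hφm k).toLp (φ k)) atTop (𝓝 (hh.toLp h)) := by
      rw [Lp.tendsto_Lp_iff_tendsto_eLpNorm'']
      exact hlim
    refine EMetric.cauchySeq_iff.2 fun ε hε => ?_
    obtain ⟨δ, hδ, hδε⟩ : ∃ δ : ℝ≥0∞, 0 < δ ∧ B * δ ≤ ε := by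
      rcases eq_or_ne (B : ℝ≥0∞) 0 with h0 | h0
      · exact ⟨1, one_pos, by simp [h0]⟩
      · refine ⟨ε / B, ENNReal.div_pos hε.ne' ENNReal.coe_ne_top, ?_⟩
        exact ENNReal.mul_div_le
    rcases eq_or_ne (B : ℝ≥0∞) 0 with h0 | h0
    · refine ⟨0, fun k _ l _ => ?_⟩
      rw [Lp.edist_toLp_toLp]
      refine ((hB.schwartz_sub _ _ (hφ k) (hφ l)).trans (le_of_eq ?_)).trans_lt hε
      rw [h0, zero_mul]
    · obtain ⟨N, hN⟩ := EMetric.cauchySeq_iff.1 h1.cauchySeq δ hδ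
      refine ⟨N, fun k hk l hl => ?_⟩
      have h2 := hN k hk l hl
      rw [Lp.edist_toLp_toLp] at h2 ⊢
      refine (hB.schwartz_sub _ _ (hφ k) (hφ l)).trans_lt (lt_of_lt_of_le ?_ hδε)
      exact ENNReal.mul_lt_mul_right h0 ENNReal.coe_ne_top h2
  obtain ⟨G, hG⟩ := cauchySeq_tendsto_of_complete hcau
  refine ⟨G, Lp.memLp G, ?_⟩
  have h2 := (Lp.tendsto_Lp_iff_tendsto_eLpNorm' _ _).1 hG
  refine h2.congr fun k => eLpNorm_congr_ae ?_
  filter_upwards [(hum k).coeFn_toLp] with x hx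
  simp [hx]

namespace IsWeightedLpValue

variable {h h' g g' : RSpace n → ℂ}

theorem zero : IsWeightedLpValue T₂ p w (fun _ => 0) (fun _ => 0) := by
  refine ⟨MemLp.zero', MemLp.zero', fun _ => 0, fun _ => ?_, ?_, ?_⟩
  · exact HasCompactSupport.zero
  · simp
  · have h0 := (IsWeight.measure_absolutelyContinuous w).ae_eq (l2Apply_zero (T₂ := T₂))
    have h1 : eLpNorm (fun x => T₂ ((0 : 𝓢(RSpace n, ℂ)).toLp 2 volume) x - 0)
        (ENNReal.ofReal p) (weightMeasure w) = 0 := by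
      rw [← l2Apply_schwartz, ← eLpNorm_zero (μ := weightMeasure w) (p := ENNReal.ofReal p)
        (α := RSpace n) (ε := ℂ)]
      refine eLpNorm_congr_ae ?_
      filter_upwards [h0] with x hx
      simpa using hx
    simp_rw [h1]
    exact tendsto_const_nhds

theorem linear (hp : 1 ≤ p) (hw : IsWeight w) (H : IsWeightedLpValue T₂ p w h g)
    (H' : IsWeightedLpValue T₂ p w h' g') (c : ℂ) :
    IsWeightedLpValue T₂ p w (fun x => c * h x + h' x) (fun x => c * g x + g' x) := by
  have hfc := hw.isFiniteMeasureOnCompacts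
  have hP1 : 1 ≤ ENNReal.ofReal p := by simpa using hp
  obtain ⟨φ, hφ, hφ1, hφ2⟩ := H.approx
  obtain ⟨ψ, hψ, hψ1, hψ2⟩ := H'.approx
  have aux : ∀ {a b : ℕ → RSpace n → ℂ} {a' b' : RSpace n → ℂ},
      (∀ k, AEStronglyMeasurable (fun x => a k x - a' x) (weightMeasure w)) →
      (∀ k, AEStronglyMeasurable (fun x => b k x - b' x) (weightMeasure w)) →
      Tendsto (fun k => eLpNorm (fun x => a k x - a' x) (ENNReal.ofReal p) (weightMeasure w))
        atTop (𝓝 0) →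
      Tendsto (fun k => eLpNorm (fun x => b k x - b' x) (ENNReal.ofReal p) (weightMeasure w))
        atTop (𝓝 0) →
      Tendsto (fun k => eLpNorm (fun x => (c * a k x + b k x) - (c * a' x + b' x))
        (ENNReal.ofReal p) (weightMeasure w)) atTop (𝓝 0) := by
    intro a b a' b' ha hb h1 h2
    have h3 : Tendsto (fun k => ‖c‖ₑ * eLpNorm (fun x => a k x - a' x) (ENNReal.ofReal p)
        (weightMeasure w) + eLpNorm (fun x => b k x - b' x) (ENNReal.ofReal p) (weightMeasure w))
        atTop (𝓝 (‖c‖ₑ * 0 + 0)) :=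
      (ENNReal.Tendsto.const_mul h1 (Or.inr enorm_ne_top)).add h2
    rw [mul_zero, zero_add] at h3
    refine ENNReal.tendsto_nhds_zero_of_le h3 fun k => ?_
    have h4 : (fun x => (c * a k x + b k x) - (c * a' x + b' x)) =
        (c • fun x => a k x - a' x) + fun x => b k x - b' x := by
      ext x
      simp only [Pi.add_apply, Pi.smul_apply, smul_eq_mul]
      ring
    rw [h4]
    refine (eLpNorm_add_le ((ha k).const_smul c) (hb k) hP1).trans ?_
    rw [eLpNorm_const_smul]
  refine ⟨(H.memLp_left.const_mul c).add H'.memLp_left,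
    (H.memLp_right.const_mul c).add H'.memLp_right, fun k => c • φ k + ψ k, fun k => ?_, ?_, ?_⟩
  · exact ((hφ k).smul_left (f := fun _ => c)).add (hψ k)
  · exact aux (fun k => (φ k).continuous.aestronglyMeasurable.sub H.memLp_left.1)
      (fun k => (ψ k).continuous.aestronglyMeasurable.sub H'.memLp_left.1) hφ1 hψ1
  · have hm : ∀ F : Lp ℂ 2 (volume : Measure (RSpace n)),
        AEStronglyMeasurable F (weightMeasure w) := fun F =>
      (Lp.stronglyMeasurable F).aestronglyMeasurable
    refine (aux (fun k => (hm _).sub H.memLp_right.1) (fun k => (hm _).sub H'.memLp_right.1)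
      hφ2 hψ2).congr fun k => eLpNorm_congr_ae ?_
    have h1 : T₂ ((c • φ k + ψ k).toLp 2 volume) =
        c • T₂ ((φ k).toLp 2 volume) + T₂ ((ψ k).toLp 2 volume) := by
      rw [← map_smul, ← map_add]
      rfl
    have h2 : (T₂ ((c • φ k + ψ k).toLp 2 volume) : RSpace n → ℂ) =ᵐ[volume]
        fun x => c * T₂ ((φ k).toLp 2 volume) x + T₂ ((ψ k).toLp 2 volume) x := by
      rw [h1]
      filter_upwards [Lp.coeFn_add (c • T₂ ((φ k).toLp 2 volume)) (T₂ ((ψ k).toLp 2 volume)),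
        Lp.coeFn_smul c (T₂ ((φ k).toLp 2 volume))] with x hx hx'
      rw [hx, Pi.add_apply, hx', Pi.smul_apply, smul_eq_mul]
    filter_upwards [(IsWeight.measure_absolutelyContinuous w).ae_le h2] with x hx
    rw [hx]

/-- The two values may come from different approximating sequences; the bound for differences of
test functions survives the limit. Taking h = h' shows that values are unique, taking h' = 0 gives
the norm bound. -/
theorem eLpNorm_sub_le (hB : IsWeightedBound T₂ p w B) (hp : 1 ≤ p) (hw : IsWeight w)
    (H : IsWeightedLpValue T₂ p w h g) (H' : IsWeightedLpValue T₂ p w h' g') :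
    eLpNorm (fun x => g x - g' x) (ENNReal.ofReal p) (weightMeasure w) ≤
      B * eLpNorm (fun x => h x - h' x) (ENNReal.ofReal p) (weightMeasure w) := by
  have hfc := hw.isFiniteMeasureOnCompacts
  have hP1 : 1 ≤ ENNReal.ofReal p := by simpa using hp
  obtain ⟨φ, hφ, hφ1, hφ2⟩ := H.approx
  obtain ⟨ψ, hψ, hψ1, hψ2⟩ := H'.approx
  have hm : ∀ F : Lp ℂ 2 (volume : Measure (RSpace n)),
      AEStronglyMeasurable F (weightMeasure w) := fun F =>
    (Lp.stronglyMeasurable F).aestronglyMeasurable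
  have tri : ∀ {a b a' b' : RSpace n → ℂ}, AEStronglyMeasurable a (weightMeasure w) →
      AEStronglyMeasurable b (weightMeasure w) → AEStronglyMeasurable a' (weightMeasure w) →
      AEStronglyMeasurable b' (weightMeasure w) →
      eLpNorm (fun x => a x - b x) (ENNReal.ofReal p) (weightMeasure w) ≤
        eLpNorm (fun x => a' x - a x) (ENNReal.ofReal p) (weightMeasure w) +
        eLpNorm (fun x => b' x - b x) (ENNReal.ofReal p) (weightMeasure w) +
        eLpNorm (fun x => a' x - b' x) (ENNReal.ofReal p) (weightMeasure w) := by
    intro a b a' b' ha hb ha' hb'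
    have e : (fun x => a x - b x) =
        (((fun x => b' x - b x) - fun x => a' x - a x) + fun x => a' x - b' x) := by
      ext x
      simp only [Pi.add_apply, Pi.sub_apply]
      ring
    rw [e]
    refine (eLpNorm_add_le ((hb'.sub hb).sub (ha'.sub ha)) (ha'.sub hb') hP1).trans ?_
    refine add_le_add_left ?_ _
    refine (MeasureTheory.eLpNorm_sub_le (hb'.sub hb) (ha'.sub ha) hP1).trans (le_of_eq (add_comm _ _))
  have hlim : Tendsto (fun k => eLpNorm (fun x => T₂ ((φ k).toLp 2 volume) x - g x)
        (ENNReal.ofReal p) (weightMeasure w) +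
      eLpNorm (fun x => T₂ ((ψ k).toLp 2 volume) x - g' x) (ENNReal.ofReal p) (weightMeasure w) +
      B * (eLpNorm (fun x => φ k x - h x) (ENNReal.ofReal p) (weightMeasure w) +
        eLpNorm (fun x => ψ k x - h' x) (ENNReal.ofReal p) (weightMeasure w) +
        eLpNorm (fun x => h x - h' x) (ENNReal.ofReal p) (weightMeasure w))) atTop
      (𝓝 (0 + 0 + B * (0 + 0 +
        eLpNorm (fun x => h x - h' x) (ENNReal.ofReal p) (weightMeasure w)))) :=
    (hφ2.add hψ2).add (ENNReal.Tendsto.const_mul ((hφ1.add hψ1).add tendsto_const_nhds)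
      (Or.inr ENNReal.coe_ne_top))
  rw [add_zero, zero_add, zero_add] at hlim
  refine ge_of_tendsto hlim (Eventually.of_forall fun k => ?_)
  refine (tri H.memLp_right.1 H'.memLp_right.1 (hm (T₂ ((φ k).toLp 2 volume)))
    (hm (T₂ ((ψ k).toLp 2 volume)))).trans ?_
  gcongr ?_ + ?_ + ?_
  · exact le_rfl
  · exact le_rfl
  rw [← l2Apply_schwartz, ← l2Apply_schwartz]
  refine (hB.schwartz_sub _ _ (hφ k) (hψ k)).trans ?_
  gcongr
  have e := tri (a := φ k) (b := ψ k) (a' := h) (b' := h') (φ k).continuous.aestronglyMeasurable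
    (ψ k).continuous.aestronglyMeasurable H.memLp_left.1 H'.memLp_left.1
  have comm : ∀ a b : RSpace n → ℂ,
      eLpNorm (fun x => a x - b x) (ENNReal.ofReal p) (weightMeasure w) =
      eLpNorm (fun x => b x - a x) (ENNReal.ofReal p) (weightMeasure w) := fun a b =>
    eLpNorm_sub_comm a b _ _
  rwa [comm h, comm h'] at e

theorem eLpNorm_le (hB : IsWeightedBound T₂ p w B) (hp : 1 ≤ p) (hw : IsWeight w)
    (H : IsWeightedLpValue T₂ p w h g) :
    eLpNorm g (ENNReal.ofReal p) (weightMeasure w) ≤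
      B * eLpNorm h (ENNReal.ofReal p) (weightMeasure w) := by
  simpa using H.eLpNorm_sub_le hB hp hw zero

theorem unique (hB : IsWeightedBound T₂ p w B) (hp : 1 ≤ p) (hw : IsWeight w)
    (H : IsWeightedLpValue T₂ p w h g) (H' : IsWeightedLpValue T₂ p w h g') :
    g =ᵐ[volume] g' := by
  have h0 : eLpNorm (fun x => g x - g' x) (ENNReal.ofReal p) (weightMeasure w) = 0 := by
    have := H.eLpNorm_sub_le hB hp hw H'
    simpa using this
  have h1 := (eLpNorm_eq_zero_iff (H.memLp_right.1.sub H'.memLp_right.1)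
    (by simpa using zero_lt_one.trans_le hp)).1 h0
  filter_upwards [hw.absolutelyContinuous_measure.ae_eq h1] with x hx
  exact sub_eq_zero.1 hx

end IsWeightedLpValue

namespace IsWeightedBound

variable {h : RSpace n → ℂ}

theorem exists_value (hB : IsWeightedBound T₂ p w B) (hw : IsWeight w) (hp : 1 ≤ p)
    (hh : MemLp h (ENNReal.ofReal p) (weightMeasure w)) :
    ∃ g, IsWeightedLpValue T₂ p w h g := by
  have hfc := hw.isFiniteMeasureOnCompacts
  obtain ⟨φ, hφ, -, hlim⟩ := exists_testFunction_tendsto (η := fun _ => 1) ENNReal.ofReal_ne_top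
    (by simpa using hp) hh contDiff_const (by simp) (by simp)
  obtain ⟨g, hg, hglim⟩ := hB.exists_tendsto hw hp hh hφ hlim
  exact ⟨g, hh, hg, φ, hφ, hlim, by simpa only [l2Apply_schwartz] using hglim⟩

end IsWeightedBound

end

section

/-! ### Weighted values of functions with bounded support -/

variable {n : ℕ} {p : ℝ} {w : RSpace n → ℝ} {B : ℝ≥0}
  {T₂ : Lp ℂ 2 (volume : Measure (RSpace n)) →L[ℂ] Lp ℂ 2 (volume : Measure (RSpace n))}
  {h g : RSpace n → ℂ}

/-- The approximants are supported in a fixed ball, so φ_k - h is itself square integrable with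
bounded support and the weighted bound applies to it directly. No simultaneous approximation in L²
is needed. -/
theorem IsWeightedBound.value_of_memLp_two (hB : IsWeightedBound T₂ p w B) (hw : IsWeight w)
    (hp : 1 ≤ p) (hh : MemLp h (ENNReal.ofReal p) (weightMeasure w)) (hh2 : MemLp h 2 volume)
    {R : ℝ} (hR : ∀ x ∉ ball 0 R, h x = 0) :
    IsWeightedLpValue T₂ p w h (l2Apply T₂ h) := by
  have hfc := hw.isFiniteMeasureOnCompacts
  obtain ⟨η, hη, hη1, hη2, hη3⟩ := exists_cutoff (0 : RSpace n) (lt_max_of_lt_right one_pos : 0 < max R 1)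
  obtain ⟨φ, hφ, hφ0, hlim⟩ := exists_testFunction_tendsto ENNReal.ofReal_ne_top
    (by simpa using hp) hh hη hη1 (fun x => by
      by_cases hx : x ∈ ball 0 (max R 1)
      · simp [hη2 x hx]
      · simp [hR x fun hx' => hx (ball_subset_ball (le_max_left _ _) hx')])
  refine ⟨hh, ⟨stronglyMeasurable_l2Apply.aestronglyMeasurable,
    (hB h hh2 R hR).trans_lt (ENNReal.mul_lt_top ENNReal.coe_lt_top hh.2)⟩, φ, hφ, hlim, ?_⟩
  have h1 := ENNReal.Tendsto.const_mul (a := (B : ℝ≥0∞)) hlim (Or.inr ENNReal.coe_ne_top)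
  rw [mul_zero] at h1
  refine ENNReal.tendsto_nhds_zero_of_le h1 fun k => ?_
  have h2 := hB (fun x => φ k x - h x) (((φ k).memLp 2 volume).sub hh2) (2 * max R 1) fun x hx => by
    rw [hφ0 k x (hη3 x hx), hR x fun hx' => hx (ball_subset_ball ?_ hx'), sub_zero]
    linarith [le_max_left R 1, le_max_right R 1]
  refine le_trans (le_of_eq (eLpNorm_congr_ae ?_)) h2
  rw [← l2Apply_schwartz]
  exact ((IsWeight.measure_absolutelyContinuous w).ae_eq
    (l2Apply_sub ((φ k).memLp 2 volume) hh2)).symm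

namespace IsMuckenhouptAp

variable (hw : IsMuckenhouptAp p w)
include hw

theorem dualMeasure_ball_ne_top (hp : 1 < p) (c : RSpace n) (r : ℝ) :
    dualMeasure p w (ball c r) ≠ ∞ := by
  obtain ⟨C, hC⟩ := hw.isApPair hp
  exact hC.finite_right c r

theorem setLIntegral_enorm_le (hp : 1 < p) (hh : AEStronglyMeasurable h volume)
    {E : Set (RSpace n)} (hE : MeasurableSet E) :
    ∫⁻ x in E, ‖h x‖ₑ ≤ eLpNorm (E.indicator h) (ENNReal.ofReal p) (weightMeasure w) *
      dualMeasure p w E ^ (1 - 1 / p) := by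
  rw [eLpNorm_indicator_eq_eLpNorm_restrict hE, eLpNorm_ofReal_eq (by linarith)]
  exact setLIntegral_le hw.isWeight hp hh.enorm hE

theorem locallyIntegrable_of_memLp (hp : 1 < p)
    (hh : ∀ r, MemLp ((ball 0 r).indicator h) (ENNReal.ofReal p) (weightMeasure w)) :
    LocallyIntegrable h volume := by
  intro x
  have hx : ball 0 (‖x‖ + 1) ∈ 𝓝 x := isOpen_ball.mem_nhds (by simp)
  have hm : AEStronglyMeasurable h (volume.restrict (ball 0 (‖x‖ + 1))) := by
    have := ((hh (‖x‖ + 1)).1.mono_ac hw.isWeight.absolutelyContinuous_measure)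
    exact (aestronglyMeasurable_indicator_iff measurableSet_ball).1 this
  refine ⟨_, hx, hm, ?_⟩
  have hm' := ((hh (‖x‖ + 1)).1.mono_ac hw.isWeight.absolutelyContinuous_measure)
  have h1 := hw.setLIntegral_enorm_le hp hm' (measurableSet_ball (x := (0 : RSpace n)) (ε := ‖x‖ + 1))
  rw [indicator_indicator, inter_self] at h1
  have h2 : ∫⁻ y in ball 0 (‖x‖ + 1), ‖(ball 0 (‖x‖ + 1)).indicator h y‖ₑ =
      ∫⁻ y in ball 0 (‖x‖ + 1), ‖h y‖ₑ := by
    refine setLIntegral_congr_fun measurableSet_ball fun y hy => ?_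
    simp only [indicator_of_mem hy]
  rw [hasFiniteIntegral_iff_enorm, ← h2]
  refine h1.trans_lt (ENNReal.mul_lt_top (hh _).2 ?_)
  have hp0 : 0 ≤ 1 - 1 / p := by
    rw [sub_nonneg, div_le_one (by linarith)]
    exact hp.le
  exact ENNReal.rpow_lt_top_of_nonneg hp0 (hw.dualMeasure_ball_ne_top hp _ _)

end IsMuckenhouptAp

namespace IsThetaCZO

variable {θ : ℝ → ℝ} {T : 𝓢(RSpace n, ℂ) →ₗ[ℂ] 𝓢'(RSpace n, ℂ)} {K : RSpace n → RSpace n → ℂ}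

/-- Away from its bounded support, the weighted value of a function is given by the kernel. -/
theorem weightedValue_eq_integral (hT : IsThetaCZO θ T T₂ K) (hθ : IsDiniModulus θ) (hn : 1 ≤ n)
    (hB : IsWeightedBound T₂ p w B) (hp : 1 < p) (hw : IsMuckenhouptAp p w)
    {c : RSpace n} {ρ : ℝ} (hρ : 0 < ρ) (H : IsWeightedLpValue T₂ p w h g)
    (hh0 : ∀ x ∈ ball c (2 * ρ), h x = 0) {R : ℝ} (hR : ∀ x ∉ ball 0 R, h x = 0) :
    ∀ᵐ x, x ∈ ball c ρ → Integrable (fun z => K x z * h z) volume ∧ g x = ∫ z, K x z * h z := by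
  have hfc := hw.isWeight.isFiniteMeasureOnCompacts
  have hh := H.memLp_left
  have hhm : AEStronglyMeasurable h volume :=
    hh.1.mono_ac hw.isWeight.absolutelyContinuous_measure
  obtain ⟨S, hS⟩ : ∃ S, S = max R 1 := ⟨_, rfl⟩
  have hS1 : 1 ≤ S := hS ▸ le_max_right _ _
  have hSR : R ≤ S := hS ▸ le_max_left _ _
  obtain ⟨η, hη, hη1, hη2, hη3⟩ := exists_cutoff (0 : RSpace n) (zero_lt_one.trans_le hS1)
  obtain ⟨ζ, hζ, hζ1, hζ2, hζ3⟩ := exists_cutoff_compl c hρ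
  -- The product cutoff keeps the approximants in a fixed ball and away from c; by uniqueness of
  -- values it does not matter that `H` came with another sequence.
  obtain ⟨φ, hφ, hφ0, hlim⟩ := exists_testFunction_tendsto (η := fun x => η x * ζ x)
    ENNReal.ofReal_ne_top (by simpa using hp.le) hh (hη.mul hζ)
    (fun x => by
      rw [abs_mul]
      exact mul_le_one₀ (hη1 x) (abs_nonneg _) (hζ1 x))
    (fun x => by
      by_cases hx : x ∈ ball 0 S
      · by_cases hx' : x ∈ ball c (2 * ρ)
        · simp [hh0 x hx']
        · simp [hη2 x hx, hζ3 x hx']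
      · simp [hR x fun hx' => hx (ball_subset_ball hSR hx')])
  obtain ⟨g', hg', hglim⟩ := hB.exists_tendsto hw.isWeight hp.le hh hφ hlim
  have H' : IsWeightedLpValue T₂ p w h g' :=
    ⟨hh, hg', φ, hφ, hlim, by simpa only [l2Apply_schwartz] using hglim⟩
  have hgg' := H.unique hB hp.le hw.isWeight H'
  have hP0 : ENNReal.ofReal p ≠ 0 := by simpa using (zero_lt_one.trans hp)
  obtain ⟨ns, hns, hae⟩ := (tendstoInMeasure_of_tendsto_eLpNorm hP0
    (fun k => (stronglyMeasurable_l2Apply (T₂ := T₂) (f := φ k)).aestronglyMeasurable)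
    hg'.1 hglim).exists_seq_tendsto_ae
  have hae' := hw.isWeight.absolutelyContinuous_measure.ae_le hae
  -- Here |z - c|^(-n) is bounded, and Hölder on a fixed ball of finite σ-measure reduces L¹ to
  -- L^p(w) convergence.
  have hint : Tendsto (fun k => ∫⁻ z in (ball c (3 / 2 * ρ))ᶜ,
      ENNReal.ofReal (1 / ‖z - c‖ ^ n) * ‖φ k z - h z‖ₑ) atTop (𝓝 0) := by
    obtain ⟨M, hM⟩ : ∃ M, M = ENNReal.ofReal (1 / (3 / 2 * ρ) ^ n) := ⟨_, rfl⟩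
    obtain ⟨V, hV⟩ : ∃ V, V = dualMeasure p w (ball 0 (2 * S)) ^ (1 - 1 / p) := ⟨_, rfl⟩
    have hVt : V ≠ ∞ := by
      have hp0 : 0 ≤ 1 - 1 / p := by
        rw [sub_nonneg, div_le_one (by linarith)]
        exact hp.le
      rw [hV]
      exact ENNReal.rpow_ne_top_of_nonneg hp0 (hw.dualMeasure_ball_ne_top hp _ _)
    have h1 : Tendsto (fun k => M * (eLpNorm (fun x => φ k x - h x) (ENNReal.ofReal p)
        (weightMeasure w) * V)) atTop (𝓝 (M * (0 * V))) :=
      ENNReal.Tendsto.const_mul (ENNReal.Tendsto.mul_const hlim (Or.inr hVt))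
        (Or.inr (hM ▸ ENNReal.ofReal_ne_top))
    rw [zero_mul, mul_zero] at h1
    refine ENNReal.tendsto_nhds_zero_of_le h1 fun k => ?_
    have hvan : ∀ z ∉ ball (0 : RSpace n) (2 * S), φ k z - h z = 0 := fun z hz => by
      rw [hφ0 k z (by rw [hη3 z hz, zero_mul]),
        hR z fun hz' => hz (ball_subset_ball (by linarith) hz'), sub_zero]
    have hind : (ball 0 (2 * S)).indicator (fun z => φ k z - h z) = fun z => φ k z - h z :=
      indicator_eq_self.2 fun z hz => by_contra fun hz' => hz (hvan z hz')
    have h2 := hw.setLIntegral_enorm_le hp ((φ k).continuous.aestronglyMeasurable.sub hhm)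
      (measurableSet_ball (x := (0 : RSpace n)) (ε := 2 * S))
    calc _ ≤ ∫⁻ z in (ball c (3 / 2 * ρ))ᶜ, M * ‖φ k z - h z‖ₑ := by
          refine setLIntegral_mono' measurableSet_ball.compl fun z hz => ?_
          rw [hM]
          gcongr
          simpa [dist_eq_norm] using hz
      _ ≤ ∫⁻ z, M * ‖φ k z - h z‖ₑ := setLIntegral_le_lintegral _ _
      _ = M * ∫⁻ z, ‖φ k z - h z‖ₑ := lintegral_const_mul' _ _ (hM ▸ ENNReal.ofReal_ne_top)
      _ = M * ∫⁻ z in ball 0 (2 * S), ‖φ k z - h z‖ₑ := by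
          congr 1
          rw [← lintegral_indicator measurableSet_ball]
          refine lintegral_congr fun z => ?_
          by_cases hz : z ∈ ball 0 (2 * S)
          · rw [indicator_of_mem hz]
          · rw [indicator_of_notMem hz, hvan z hz, enorm_zero]
      _ ≤ _ := by
          rw [hV]
          gcongr
          rw [show (fun z => φ k z - h z) = (ball 0 (2 * S)).indicator (⇑(φ k) - h) from hind.symm]
          exact h2
  have := hT.ae_eq_integral_of_tendsto hθ hn hρ (φ := fun k => φ (ns k)) (fun k => hφ (ns k))
    (fun k x hx => hφ0 (ns k) x (by rw [hζ2 x hx, mul_zero])) hhm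
    (fun x hx => hh0 x (ball_subset_ball (by linarith) hx)) (hint.comp hns.tendsto_atTop)
    (g := g') (by filter_upwards [hae'] with x hx _ using hx)
  filter_upwards [this, hgg'] with x hx hx' hxB
  rw [hx']
  exact hx hxB

end IsThetaCZO

end

section

/-! ### Local estimates in weighted amalgam spaces -/

variable {n : ℕ} {p s α : ℝ} {q : ℝ≥0∞} {w μ : RSpace n → ℝ} {f : RSpace n → ℂ}

/-- The function of the centre whose `L^q(μ)`-norm enters the amalgam norm. -/
noncomputable def amalgamSection (p s : ℝ) (w : RSpace n → ℝ) (f : RSpace n → ℂ) (r : ℝ)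
    (y : RSpace n) : ℝ≥0∞ :=
  weightMeasure w (ball y r) ^ s *
    eLpNorm ((ball y r).indicator f) (ENNReal.ofReal p) (weightMeasure w)

theorem eLpNorm_amalgamSection_le {r : ℝ} (hr : 0 < r) :
    eLpNorm (amalgamSection p (1 / α - 1 / p - (q⁻¹).toReal) w f r) q (weightMeasure μ) ≤
      amalgamNorm p α q w μ f :=
  le_iSup₂ (f := fun (r : ℝ) (_ : 0 < r) =>
    eLpNorm (amalgamSection p (1 / α - 1 / p - (q⁻¹).toReal) w f r) q (weightMeasure μ)) r hr

theorem eLpNorm_indicator_le_of_subset {ν : Measure (RSpace n)} {P : ℝ≥0∞} {S S' : Set (RSpace n)}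
    (h : S ⊆ S') : eLpNorm (S.indicator f) P ν ≤ eLpNorm (S'.indicator f) P ν :=
  eLpNorm_mono_enorm fun x => by
    rw [enorm_indicator_eq_indicator_enorm, enorm_indicator_eq_indicator_enorm]
    exact indicator_le_indicator_of_subset h (fun _ => bot_le) x

theorem ENNReal.rpow_le_rpow_of_nonpos {x : ℝ} (hx : x ≤ 0) {a b : ℝ≥0∞} (h : a ≤ b) :
    b ^ x ≤ a ^ x := by
  have h1 := ENNReal.rpow_le_rpow h (neg_nonneg.2 hx)
  rw [ENNReal.rpow_neg, ENNReal.rpow_neg] at h1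
  exact ENNReal.inv_le_inv.1 h1

theorem ENNReal.rpow_ne_zero_of_ne {a : ℝ≥0∞} (h0 : a ≠ 0) (ht : a ≠ ∞) (x : ℝ) : a ^ x ≠ 0 :=
  (ENNReal.rpow_pos (pos_iff_ne_zero.2 h0) ht).ne'

theorem ENNReal.rpow_le_mul_rpow_of_nonpos {x : ℝ} (hx : x ≤ 0) {a b d : ℝ≥0∞} (ha : a ≠ 0)
    (ha' : a ≠ ∞) (hb : b ≠ 0) (hb' : b ≠ ∞) (h : b ≤ d * a) : a ^ x ≤ d ^ (-x) * b ^ x := by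
  have hx' : 0 ≤ -x := neg_nonneg.2 hx
  have h2 := ENNReal.rpow_le_rpow h hx'
  rw [ENNReal.mul_rpow_of_nonneg _ _ hx'] at h2
  have h3 : b ^ (-x) * b ^ x = 1 := by
    rw [← ENNReal.rpow_add _ _ hb hb', neg_add_cancel, ENNReal.rpow_zero]
  have h4 : a ^ (-x) * a ^ x = 1 := by
    rw [← ENNReal.rpow_add _ _ ha ha', neg_add_cancel, ENNReal.rpow_zero]
  calc a ^ x = (b ^ (-x) * b ^ x) * a ^ x := by rw [h3, one_mul]
    _ ≤ (d ^ (-x) * a ^ (-x) * b ^ x) * a ^ x := by gcongr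
    _ = d ^ (-x) * b ^ x * (a ^ (-x) * a ^ x) := by ring
    _ = _ := by rw [h4, mul_one]

/-- For z in B(y, r) one has B(y, r) ⊆ B(z, 2r) ⊆ B(y, 3r), and s ≤ 0 reverses the second inclusion;
so the section of radius 2r is bounded below on B(y, r). For q = ∞ the exponent `1 / q.toReal` is
1/0 = 0 and the measure factor is 1, as it should be. -/
theorem eLpNorm_indicator_mul_le_eLpNorm_section (hs : s ≤ 0) (hq : q ≠ 0) (hμ : IsWeight μ)
    (y : RSpace n) {r : ℝ} (hr : 0 < r) :
    weightMeasure w (ball y (3 * r)) ^ s *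
        eLpNorm ((ball y r).indicator f) (ENNReal.ofReal p) (weightMeasure w) *
        weightMeasure μ (ball y r) ^ (1 / q.toReal) ≤
      eLpNorm (amalgamSection p s w f (2 * r)) q (weightMeasure μ) := by
  obtain ⟨a, ha⟩ : ∃ a, a = weightMeasure w (ball y (3 * r)) ^ s *
        eLpNorm ((ball y r).indicator f) (ENNReal.ofReal p) (weightMeasure w) := ⟨_, rfl⟩
  have h := eLpNorm_indicator_const' (μ := weightMeasure μ) (p := q) (c := a)
    (measurableSet_ball (x := y) (ε := r)) (hμ.measure_ball_ne_zero y hr) hq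
  rw [enorm_eq_self] at h
  rw [← ha, ← h]
  refine eLpNorm_mono_enorm fun z => ?_
  rw [enorm_eq_self, enorm_eq_self]
  by_cases hz : z ∈ ball y r
  · rw [indicator_of_mem hz, ha, amalgamSection]
    have hz' := mem_ball.1 hz
    refine mul_le_mul' (ENNReal.rpow_le_rpow_of_nonpos hs (measure_mono ?_))
      (eLpNorm_indicator_le_of_subset ?_)
    · exact ball_subset_ball' (by linarith)
    · exact ball_subset_ball' (by linarith [dist_comm y z])
  · rw [indicator_of_notMem hz]
    exact bot_le

theorem MemAmalgam.memLp_indicator (hf : MemAmalgam p α q w μ f)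
    (hs : 1 / α - 1 / p - (q⁻¹).toReal ≤ 0) (hq : q ≠ 0) (hw : IsWeight w) (hμ : IsWeight μ)
    (y : RSpace n) (r : ℝ) :
    MemLp ((ball y r).indicator f) (ENNReal.ofReal p) (weightMeasure w) := by
  have hm := hf.locallyIntegrable.aestronglyMeasurable.mono_ac
    (IsWeight.measure_absolutelyContinuous w)
  refine ⟨hm.indicator measurableSet_ball, ?_⟩
  obtain ⟨R, hR0, hrR⟩ : ∃ R, 0 < R ∧ r ≤ R := ⟨max r 1, by simp, le_max_left _ _⟩
  refine (eLpNorm_indicator_le_of_subset (ball_subset_ball hrR)).trans_lt ?_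
  have h := (eLpNorm_indicator_mul_le_eLpNorm_section (p := p) (w := w) (f := f) hs hq hμ y hR0).trans
    (eLpNorm_amalgamSection_le (by linarith : 0 < 2 * R))
  have h1 := h.trans_lt hf.norm_lt_top
  by_contra htop
  rw [not_lt, top_le_iff] at htop
  have hW := ENNReal.rpow_ne_zero_of_ne (hw.measure_ball_ne_zero y (by linarith : 0 < 3 * R))
    (hw.measure_ball_ne_top y (3 * R)) (1 / α - 1 / p - (q⁻¹).toReal)
  have hM := ENNReal.rpow_ne_zero_of_ne (hμ.measure_ball_ne_zero y hR0)
    (hμ.measure_ball_ne_top y R) (1 / q.toReal)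
  rw [htop, ENNReal.mul_top hW, ENNReal.top_mul hM] at h1
  exact lt_irrefl _ h1

namespace IsMuckenhouptAp

variable (hw : IsMuckenhouptAp p w)
include hw

/-- On each annulus Hölder produces σ(ball)^(1 - 1/p), which `A_p` replaces by C |ball|
w(ball)^(-1/p); the volume cancels against |z - y|^(-n). -/
theorem exists_tail_le (hp : 1 < p) :
    ∃ C : ℝ≥0, ∀ f : RSpace n → ℂ, AEStronglyMeasurable f volume → ∀ (y : RSpace n) (r : ℝ), 0 < r →
      ∫⁻ z in (ball y (2 * r))ᶜ, ENNReal.ofReal (1 / ‖z - y‖ ^ n) * ‖f z‖ₑ ≤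
        C * ∑' k : ℕ, weightMeasure w (ball y (2 ^ (k + 2) * r)) ^ (-(1 / p)) *
          eLpNorm ((ball y (2 ^ (k + 2) * r)).indicator f) (ENNReal.ofReal p)
            (weightMeasure w) := by
  obtain ⟨C, hC⟩ := hw.isApPair hp
  refine ⟨C * (2 ^ n * (volume (ball (0 : RSpace n) 1)).toNNReal), fun f hf y r hr => ?_⟩
  refine (lintegral_compl_ball_le_tsum y (by linarith) _).trans ?_
  rw [← ENNReal.tsum_mul_left]
  refine ENNReal.tsum_le_tsum fun k => ?_
  obtain ⟨ρ, hρ⟩ : ∃ ρ, ρ = 2 ^ (k + 2) * r := ⟨_, rfl⟩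
  have hρ0 : 0 < ρ := by rw [hρ]; positivity
  have e1 : (2 : ℝ) ^ (k + 1) * (2 * r) = ρ := by rw [hρ]; ring
  have e2 : (2 : ℝ) ^ k * (2 * r) = ρ / 2 := by rw [hρ]; ring
  rw [e1, e2, ← hρ]
  have hW0 := hC.pos_left y ρ hρ0
  have hWt := hC.finite_left y ρ
  have hσ : dualMeasure p w (ball y ρ) ^ (1 - 1 / p) ≤
      weightMeasure w (ball y ρ) ^ (-(1 / p)) * (C * volume (ball y ρ)) := by
    rw [ENNReal.rpow_neg, mul_comm, ← div_eq_mul_inv,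
      ENNReal.le_div_iff_mul_le (Or.inl (ENNReal.rpow_ne_zero_of_ne hW0 hWt _))
        (Or.inl (ENNReal.rpow_ne_top_of_nonneg (by positivity) hWt)), mul_comm]
    exact hC.bound y ρ hρ0
  have hvol : volume (ball y ρ) = ENNReal.ofReal (ρ ^ n) * volume (ball (0 : RSpace n) 1) := by
    rw [← volume_ball_mul y 0 hρ0, mul_one]
  have hρn : ENNReal.ofReal (1 / (ρ / 2) ^ n) * ENNReal.ofReal (ρ ^ n) = 2 ^ n := by
    rw [← ENNReal.ofReal_mul (by positivity)]
    rw [show 1 / (ρ / 2) ^ n * ρ ^ n = 2 ^ n by rw [div_pow]; field_simp]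
    rw [ENNReal.ofReal_pow (by norm_num)]
    simp
  calc ∫⁻ z in ball y ρ \ ball y (ρ / 2), ENNReal.ofReal (1 / ‖z - y‖ ^ n) * ‖f z‖ₑ
      ≤ ∫⁻ z in ball y ρ \ ball y (ρ / 2), ENNReal.ofReal (1 / (ρ / 2) ^ n) * ‖f z‖ₑ := by
        refine setLIntegral_mono' (measurableSet_ball.diff measurableSet_ball) fun z hz => ?_
        have : ρ / 2 ≤ ‖z - y‖ := by simpa [dist_eq_norm] using hz.2
        gcongr
    _ ≤ ∫⁻ z in ball y ρ, ENNReal.ofReal (1 / (ρ / 2) ^ n) * ‖f z‖ₑ :=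
        lintegral_mono_set sdiff_subset
    _ = ENNReal.ofReal (1 / (ρ / 2) ^ n) * ∫⁻ z in ball y ρ, ‖f z‖ₑ :=
        lintegral_const_mul' _ _ ENNReal.ofReal_ne_top
    _ ≤ ENNReal.ofReal (1 / (ρ / 2) ^ n) *
        (eLpNorm ((ball y ρ).indicator f) (ENNReal.ofReal p) (weightMeasure w) *
          (weightMeasure w (ball y ρ) ^ (-(1 / p)) * (C * volume (ball y ρ)))) := by
        refine mul_le_mul_right ((hw.setLIntegral_enorm_le hp hf measurableSet_ball).trans ?_) _
        exact mul_le_mul_right hσ _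
    _ = (ENNReal.ofReal (1 / (ρ / 2) ^ n) * ENNReal.ofReal (ρ ^ n)) *
        (C * volume (ball (0 : RSpace n) 1) * (weightMeasure w (ball y ρ) ^ (-(1 / p)) *
          eLpNorm ((ball y ρ).indicator f) (ENNReal.ofReal p) (weightMeasure w))) := by
        rw [hvol]
        ring
    _ = _ := by
        rw [hρn]
        push_cast
        rw [ENNReal.coe_toNNReal (volume_ball_ne_top _ _)]
        ring

/-- The tail of the kernel integral in terms of the amalgam sections, with geometric decay. -/
theorem exists_tail_le_section (hp : 1 < p) (hn : 1 ≤ n) (hs : 0 < s + 1 / p) :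
    ∃ C c : ℝ≥0, c < 1 ∧ ∀ f : RSpace n → ℂ, AEStronglyMeasurable f volume →
      ∀ (y : RSpace n) (r : ℝ), 0 < r →
      weightMeasure w (ball y r) ^ (s + 1 / p) *
        ∫⁻ z in (ball y (2 * r))ᶜ, ENNReal.ofReal (1 / ‖z - y‖ ^ n) * ‖f z‖ₑ ≤
        C * ∑' k : ℕ, (c : ℝ≥0∞) ^ (k + 2) * amalgamSection p s w f (2 ^ (k + 2) * r) y := by
  obtain ⟨C₀, hC₀⟩ := hw.isApPair hp
  obtain ⟨C, hC⟩ := hw.exists_tail_le hp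
  obtain ⟨δ, hδ, hδW⟩ := hC₀.measure_ball_le_pow hp hn
  refine ⟨C, δ ^ (s + 1 / p), NNReal.rpow_lt_one hδ hs, fun f hf y r hr => ?_⟩
  refine (mul_le_mul_right (hC f hf y r hr) _).trans ?_
  rw [mul_left_comm, ← ENNReal.tsum_mul_left]
  refine mul_le_mul_right (ENNReal.tsum_le_tsum fun k => ?_) _
  obtain ⟨V, hV⟩ : ∃ V, V = weightMeasure w (ball y (2 ^ (k + 2) * r)) := ⟨_, rfl⟩
  have hV0 : V ≠ 0 := hV ▸ hC₀.pos_left y _ (by positivity)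
  have hVt : V ≠ ∞ := hV ▸ hC₀.finite_left y _
  rw [amalgamSection, ← hV, ← mul_assoc, ← mul_assoc]
  refine mul_le_mul_left ?_ _
  -- Iterated reverse doubling, raised to the positive power s + 1/p, gives the decay; the powers of
  -- w(2^(k+2) B) then combine to w(2^(k+2) B)^s.
  have h1 : weightMeasure w (ball y r) ≤ (δ : ℝ≥0∞) ^ (k + 2) * V := hV ▸ hδW y r hr (k + 2)
  calc weightMeasure w (ball y r) ^ (s + 1 / p) * V ^ (-(1 / p))
      ≤ ((δ : ℝ≥0∞) ^ (k + 2) * V) ^ (s + 1 / p) * V ^ (-(1 / p)) := by gcongr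
    _ = _ := by
        rw [ENNReal.mul_rpow_of_nonneg _ _ hs.le, mul_assoc, ← ENNReal.rpow_add _ _ hV0 hVt,
          add_neg_cancel_right, ENNReal.coe_rpow_of_nonneg _ hs.le, ← ENNReal.rpow_natCast,
          ← ENNReal.rpow_natCast, ← ENNReal.rpow_mul, ← ENNReal.rpow_mul, mul_comm ((k + 2 : ℕ) : ℝ)]

/-- A pointwise bound for the section at every radius ρ ≥ r. The factor μ(B(y, r)) does not depend
on ρ, so the bound is uniform along 2^k r. -/
theorem exists_section_le (hp : 1 < p) (hs : s ≤ 0) (hq : q ≠ 0) (hμ : IsWeight μ) :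
    ∃ D : ℝ≥0, ∀ (f : RSpace n → ℂ) (y : RSpace n) (r ρ : ℝ), 0 < r → r ≤ ρ →
      amalgamSection p s w f ρ y * weightMeasure μ (ball y r) ^ (1 / q.toReal) ≤
        D * eLpNorm (amalgamSection p s w f (2 * ρ)) q (weightMeasure μ) := by
  obtain ⟨C₀, hC₀⟩ := hw.isApPair hp
  obtain ⟨D, hD⟩ := hC₀.measure_ball_mul_le hp (t := 3) (by norm_num)
  refine ⟨D ^ (-s), fun f y r ρ hr hρ => ?_⟩
  have hρ0 : 0 < ρ := hr.trans_le hρ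
  have hs' : 0 ≤ -s := by linarith
  refine le_trans ?_ (mul_le_mul_right
    (eLpNorm_indicator_mul_le_eLpNorm_section (p := p) (w := w) (f := f) hs hq hμ y hρ0) _)
  rw [amalgamSection, ← mul_assoc, ← mul_assoc]
  have h1 : weightMeasure w (ball y ρ) ^ s ≤
      ((D ^ (-s) : ℝ≥0) : ℝ≥0∞) * weightMeasure w (ball y (3 * ρ)) ^ s := by
    rw [ENNReal.coe_rpow_of_nonneg _ hs']
    exact ENNReal.rpow_le_mul_rpow_of_nonpos hs (hC₀.pos_left y ρ hρ0) (hC₀.finite_left y ρ)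
      (hC₀.pos_left y _ (by positivity)) (hC₀.finite_left y _) (hD y ρ hρ0)
  gcongr

end IsMuckenhouptAp

/-- The tail of the kernel integral is finite for functions in the amalgam space. -/
theorem MemAmalgam.lintegral_tail_ne_top (hf : MemAmalgam p α q w μ f)
    (hs : 1 / α - 1 / p - (q⁻¹).toReal ≤ 0) (hs' : 0 < 1 / α - 1 / p - (q⁻¹).toReal + 1 / p)
    (hq : q ≠ 0) (hp : 1 < p) (hn : 1 ≤ n) (hw : IsMuckenhouptAp p w) (hμ : IsWeight μ)
    (y : RSpace n) {r : ℝ} (hr : 0 < r) :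
    ∫⁻ z in (ball y (2 * r))ᶜ, ENNReal.ofReal (1 / ‖z - y‖ ^ n) * ‖f z‖ₑ ≠ ∞ := by
  obtain ⟨C, c, hc, hC⟩ := hw.exists_tail_le_section hp hn hs'
  obtain ⟨D, hD⟩ := hw.exists_section_le hp hs hq hμ
  have h := hC f hf.locallyIntegrable.aestronglyMeasurable y r hr
  obtain ⟨m, hm⟩ : ∃ m, m = weightMeasure μ (ball y r) ^ (1 / q.toReal) := ⟨_, rfl⟩
  have hm0 : m ≠ 0 := hm ▸ ENNReal.rpow_ne_zero_of_ne (hμ.measure_ball_ne_zero y hr)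
    (hμ.measure_ball_ne_top y r) _
  have hmt : m ≠ ∞ := hm ▸ ENNReal.rpow_ne_top_of_nonneg (by positivity) (hμ.measure_ball_ne_top y r)
  have hsec : ∀ k : ℕ, amalgamSection p (1 / α - 1 / p - (q⁻¹).toReal) w f (2 ^ (k + 2) * r) y ≤
      D * amalgamNorm p α q w μ f / m := by
    intro k
    have hk : r ≤ 2 ^ (k + 2) * r := le_mul_of_one_le_left hr.le (one_le_pow₀ one_le_two)
    rw [ENNReal.le_div_iff_mul_le (Or.inl hm0) (Or.inl hmt), hm]
    refine (hD f y r _ hr hk).trans (mul_le_mul_right (eLpNorm_amalgamSection_le ?_) _)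
    positivity
  have hfin : C * ∑' k : ℕ, (c : ℝ≥0∞) ^ (k + 2) *
      amalgamSection p (1 / α - 1 / p - (q⁻¹).toReal) w f (2 ^ (k + 2) * r) y ≠ ∞ := by
    refine ENNReal.mul_ne_top ENNReal.coe_ne_top ?_
    have h1 : ∑' k : ℕ, (c : ℝ≥0∞) ^ (k + 2) *
        amalgamSection p (1 / α - 1 / p - (q⁻¹).toReal) w f (2 ^ (k + 2) * r) y ≤
        (∑' k : ℕ, (c : ℝ≥0∞) ^ k) * (D * amalgamNorm p α q w μ f / m) := by
      rw [← ENNReal.tsum_mul_right]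
      refine ENNReal.tsum_le_tsum fun k => mul_le_mul' ?_ (hsec k)
      exact pow_le_pow_right_of_le_one' (by exact_mod_cast hc.le) (by omega)
    refine ne_top_of_le_ne_top (ENNReal.mul_ne_top ?_ ?_) h1
    · rw [ENNReal.tsum_geometric]
      have : (c : ℝ≥0∞) < 1 := by exact_mod_cast hc
      exact ENNReal.inv_ne_top.2 (tsub_pos_of_lt this).ne'
    · exact ENNReal.div_ne_top (ENNReal.mul_ne_top ENNReal.coe_ne_top hf.norm_lt_top.ne) hm0
  intro htop
  rw [htop, ENNReal.mul_top (ENNReal.rpow_ne_zero_of_ne (hw.isWeight.measure_ball_ne_zero y hr)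
    (hw.isWeight.measure_ball_ne_top y r) _)] at h
  exact hfin (top_le_iff.1 h)

end

section

/-! ### The norm estimate -/

/-- Minkowski's inequality for a countable weighted sum. For finite q it follows from Hölder with
weights e_k: (∑ e_k F_k)^q ≤ (∑ e_k)^(q-1) ∑ e_k F_k^q. -/
theorem eLpNorm_tsum_mul_le {X : Type*} [MeasurableSpace X] {ν : Measure X} {q : ℝ≥0∞} (hq : 1 < q)
    {F : ℕ → X → ℝ≥0∞} (hF : ∀ k, Measurable (F k)) (e : ℕ → ℝ≥0∞) {N : ℝ≥0∞}
    (h : ∀ k, eLpNorm (F k) q ν ≤ N) :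
    eLpNorm (fun x => ∑' k, e k * F k x) q ν ≤ (∑' k, e k) * N := by
  by_cases hqt : q = ∞
  · subst hqt
    simp only [eLpNorm_exponent_top, eLpNormEssSup_eq_essSup_enorm, enorm_eq_self] at h ⊢
    refine essSup_le_of_ae_le _ ?_
    have h1 : ∀ᵐ x ∂ν, ∀ k, F k x ≤ N := by
      rw [ae_all_iff]
      intro k
      filter_upwards [ae_le_essSup (μ := ν) (f := F k)] with x hx using hx.trans (h k)
    filter_upwards [h1] with x hx
    rw [← ENNReal.tsum_mul_right]
    exact ENNReal.tsum_le_tsum fun k => mul_le_mul_right (hx k) _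
  · have hq0 : q ≠ 0 := (zero_lt_one.trans hq).ne'
    obtain ⟨t, ht⟩ : ∃ t, t = q.toReal := ⟨_, rfl⟩
    have ht1 : 1 < t := by
      rw [ht, ← ENNReal.toReal_one]
      exact (ENNReal.toReal_lt_toReal ENNReal.one_ne_top hqt).2 hq
    have ht0 : 0 < t := zero_lt_one.trans ht1
    have ht' : 0 ≤ 1 - 1 / t := by
      rw [sub_nonneg, div_le_one ht0]
      exact ht1.le
    simp only [eLpNorm_eq_lintegral_rpow_enorm_toReal hq0 hqt, enorm_eq_self, ← ht] at h ⊢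
    have hFN : ∀ k, ∫⁻ x, F k x ^ t ∂ν ≤ N ^ t := fun k => by
      have := ENNReal.rpow_le_rpow (h k) ht0.le
      rwa [← ENNReal.rpow_mul, one_div_mul_cancel ht0.ne', ENNReal.rpow_one] at this
    obtain ⟨S, hS⟩ : ∃ S, S = ∑' k, e k := ⟨_, rfl⟩
    rw [← hS]
    have hpt : ∀ x, (∑' k, e k * F k x) ^ t ≤ S ^ (t - 1) * ∑' k, e k * F k x ^ t := by
      intro x
      have h1 := ENNReal.tsum_rpow_mul_rpow_le ht1 (fun k => e k * F k x ^ t) e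
      have h2 : ∀ k, (e k * F k x ^ t) ^ (1 / t) * e k ^ (1 - 1 / t) = e k * F k x := fun k => by
        rw [ENNReal.mul_rpow_of_nonneg _ _ (by positivity), ← ENNReal.rpow_mul,
          mul_one_div_cancel ht0.ne', ENNReal.rpow_one, mul_right_comm,
          ← ENNReal.rpow_add_of_nonneg _ _ (by positivity) ht', add_sub_cancel, ENNReal.rpow_one]
      simp_rw [h2] at h1
      have h3 := ENNReal.rpow_le_rpow h1 ht0.le
      rwa [ENNReal.mul_rpow_of_nonneg _ _ ht0.le, ← ENNReal.rpow_mul, ← ENNReal.rpow_mul,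
        one_div_mul_cancel ht0.ne', ENNReal.rpow_one, sub_mul, one_mul,
        one_div_mul_cancel ht0.ne', mul_comm, ← hS] at h3
    have hint : ∫⁻ x, (∑' k, e k * F k x) ^ t ∂ν ≤ (S * N) ^ t := by
      calc _ ≤ ∫⁻ x, S ^ (t - 1) * ∑' k, e k * F k x ^ t ∂ν := lintegral_mono hpt
        _ = S ^ (t - 1) * ∑' k, e k * ∫⁻ x, F k x ^ t ∂ν := by
            rw [lintegral_const_mul _ (Measurable.tsum fun k =>
              ((hF k).pow_const t).const_mul _),
              lintegral_tsum fun k => (((hF k).pow_const t).const_mul _).aemeasurable]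
            congr 1
            exact tsum_congr fun k => lintegral_const_mul _ ((hF k).pow_const t)
        _ ≤ S ^ (t - 1) * ∑' k, e k * N ^ t := by
            refine mul_le_mul_right (ENNReal.tsum_le_tsum fun k => mul_le_mul_right (hFN k) _) _
        _ = _ := by
            rw [ENNReal.tsum_mul_right, ← hS, ← mul_assoc, ENNReal.mul_rpow_of_nonneg _ _ ht0.le]
            congr 1
            nth_rewrite 2 [← ENNReal.rpow_one S]
            rw [← ENNReal.rpow_add_of_nonneg _ _ (by linarith) zero_le_one, sub_add_cancel]
    have := ENNReal.rpow_le_rpow hint (by positivity : 0 ≤ 1 / t)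
    rwa [← ENNReal.rpow_mul (S * N), mul_one_div_cancel ht0.ne', ENNReal.rpow_one] at this

variable {n : ℕ} {p s α : ℝ} {q : ℝ≥0∞} {w μ : RSpace n → ℝ} {f g : RSpace n → ℂ} {B : ℝ≥0}

theorem measurable_amalgamSection (hp : 0 < p) (hf : AEStronglyMeasurable f volume) (r : ℝ) :
    Measurable (amalgamSection p s w f r) := by
  have hf' := hf.mono_ac (IsWeight.measure_absolutelyContinuous w)
  have hS : MeasurableSet {z : RSpace n × RSpace n | z.2 ∈ ball z.1 r} := by
    simp only [mem_ball]
    exact measurableSet_lt (measurable_snd.dist measurable_fst) measurable_const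
  have h1 : Measurable fun y : RSpace n => weightMeasure w (ball y r) :=
    measurable_measure_prodMk_left hS
  have h2 : ∀ y, eLpNorm ((ball y r).indicator f) (ENNReal.ofReal p) (weightMeasure w) =
      (∫⁻ z, {z : RSpace n × RSpace n | z.2 ∈ ball z.1 r}.indicator
        (fun z => ‖hf'.mk f z.2‖ₑ ^ p) (y, z) ∂(weightMeasure w)) ^ (1 / p) := by
    intro y
    rw [eLpNorm_ofReal_eq hp]
    congr 1
    refine lintegral_congr_ae ?_
    filter_upwards [hf'.ae_eq_mk] with z hz
    by_cases hzy : z ∈ ball y r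
    · rw [indicator_of_mem hzy, indicator_of_mem (by exact hzy), hz]
    · rw [indicator_of_notMem hzy, indicator_of_notMem (by exact hzy), enorm_zero,
        ENNReal.zero_rpow_of_pos hp]
  unfold amalgamSection
  refine (h1.pow_const s).mul ?_
  simp_rw [h2]
  refine Measurable.pow_const (Measurable.lintegral_prod_right' ?_) _
  exact ((hf'.stronglyMeasurable_mk.measurable.comp measurable_snd).enorm.pow_const p).indicator hS

variable {T₂ : Lp ℂ 2 (volume : Measure (RSpace n)) →L[ℂ] Lp ℂ 2 (volume : Measure (RSpace n))}
  {θ : ℝ → ℝ} {T : 𝓢(RSpace n, ℂ) →ₗ[ℂ] 𝓢'(RSpace n, ℂ)} {K : RSpace n → RSpace n → ℂ}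

theorem enorm_setIntegral_kernel_le {C : ℝ≥0}
    (hC : ∀ c x z : RSpace n, ∀ ρ : ℝ, x ∈ ball c ρ → z ∉ ball c (3 / 2 * ρ) →
      ‖K x z‖ₑ ≤ C * ENNReal.ofReal (1 / ‖z - c‖ ^ n)) {x y : RSpace n} {r : ℝ}
    (hx : x ∈ ball y r) :
    ∫⁻ z in (ball y (2 * r))ᶜ, ‖K x z * f z‖ₑ ≤
      C * ∫⁻ z in (ball y (2 * r))ᶜ, ENNReal.ofReal (1 / ‖z - y‖ ^ n) * ‖f z‖ₑ := by
  have hr : 0 < r := pos_of_mem_ball hx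
  rw [← lintegral_const_mul' _ _ ENNReal.coe_ne_top]
  refine setLIntegral_mono' measurableSet_ball.compl fun z hz => ?_
  rw [enorm_mul, ← mul_assoc]
  gcongr
  exact hC y x z r hx fun h => hz (ball_subset_ball (by linarith) h)

namespace IsThetaCZO

/-- On the ball the kernel integral is bounded by a constant τ, whose L^p(w) norm over the ball is τ
w(B)^(1/p). -/
theorem eLpNorm_indicator_localValue_le {C : ℝ≥0}
    (hC : ∀ c x z : RSpace n, ∀ ρ : ℝ, x ∈ ball c ρ → z ∉ ball c (3 / 2 * ρ) →
      ‖K x z‖ₑ ≤ C * ENNReal.ofReal (1 / ‖z - c‖ ^ n))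
    (hB : IsWeightedBound T₂ p w B) (hp : 1 < p) (hw : IsWeight w)
    (hg : IsLocalValue T₂ K p w f g) (y : RSpace n) {r : ℝ} (hr : 0 < r) :
    eLpNorm ((ball y r).indicator g) (ENNReal.ofReal p) (weightMeasure w) ≤
      B * eLpNorm ((ball y (2 * r)).indicator f) (ENNReal.ofReal p) (weightMeasure w) +
      C * (∫⁻ z in (ball y (2 * r))ᶜ, ENNReal.ofReal (1 / ‖z - y‖ ^ n) * ‖f z‖ₑ) *
        weightMeasure w (ball y r) ^ (1 / p) := by
  obtain ⟨g₁, H, hae⟩ := hg y r hr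
  obtain ⟨τ, hτ⟩ : ∃ τ, τ = C * ∫⁻ z in (ball y (2 * r))ᶜ,
    ENNReal.ofReal (1 / ‖z - y‖ ^ n) * ‖f z‖ₑ := ⟨_, rfl⟩
  have hae' := (IsWeight.measure_absolutelyContinuous w).ae_le
    ((ae_restrict_iff' measurableSet_ball).1 hae)
  have hP1 : 1 ≤ ENNReal.ofReal p := by simpa using hp.le
  have hP0 : ENNReal.ofReal p ≠ 0 := (zero_lt_one.trans_le hP1).ne'
  rw [← hτ]
  calc eLpNorm ((ball y r).indicator g) (ENNReal.ofReal p) (weightMeasure w)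
      ≤ eLpNorm ((fun x => ‖g₁ x‖ₑ) + (ball y r).indicator fun _ => τ) (ENNReal.ofReal p)
          (weightMeasure w) := by
        refine eLpNorm_mono_enorm_ae ?_
        filter_upwards [hae'] with x hx
        rw [enorm_eq_self, Pi.add_apply]
        by_cases hxB : x ∈ ball y r
        · rw [indicator_of_mem hxB, indicator_of_mem hxB, (hx hxB).2]
          refine (enorm_add_le _ _).trans (add_le_add_right ?_ _)
          refine (enorm_integral_le_lintegral_enorm _).trans ?_
          rw [hτ]
          exact enorm_setIntegral_kernel_le hC hxB
        · simp [indicator_of_notMem hxB]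
    _ ≤ eLpNorm (fun x => ‖g₁ x‖ₑ) (ENNReal.ofReal p) (weightMeasure w) +
        eLpNorm ((ball y r).indicator fun _ => τ) (ENNReal.ofReal p) (weightMeasure w) :=
        eLpNorm_add_le H.memLp_right.1.enorm.aestronglyMeasurable
          (aestronglyMeasurable_const.indicator measurableSet_ball) hP1
    _ ≤ _ := by
        rw [eLpNorm_indicator_const' measurableSet_ball (hw.measure_ball_ne_zero y hr) hP0,
          enorm_eq_self, ENNReal.toReal_ofReal (by linarith)]
        refine add_le_add_left (le_trans (le_of_eq ?_) (H.eLpNorm_le hB hp.le hw)) _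
        exact eLpNorm_congr_enorm_ae (Eventually.of_forall fun x => enorm_eq_self _)

/-- The norm estimate for the values of the operator on the amalgam space. -/
theorem exists_amalgamNorm_le (hT : IsThetaCZO θ T T₂ K) (hθ : IsDiniModulus θ) (hn : 1 ≤ n)
    (hB : IsWeightedBound T₂ p w B) (hp : 1 < p) (hw : IsMuckenhouptAp p w)
    (hs : 1 / α - 1 / p - (q⁻¹).toReal ≤ 0) (hs' : 0 < 1 / α - 1 / p - (q⁻¹).toReal + 1 / p)
    (hq : 1 < q) :
    ∃ C : ℝ≥0, ∀ f g : RSpace n → ℂ, AEStronglyMeasurable f volume →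
      IsLocalValue T₂ K p w f g → amalgamNorm p α q w μ g ≤ C * amalgamNorm p α q w μ f := by
  obtain ⟨CK, hCK0, hCK, -⟩ := hT.isThetaKernel.exists_bounds hθ
  obtain ⟨C₁, hC₁⟩ := IsThetaKernel.enorm_le_of_notMem ⟨CK, hCK0, hCK⟩
  obtain ⟨C₀, hC₀⟩ := hw.isApPair hp
  obtain ⟨D, hD⟩ := hC₀.measure_ball_mul_le hp (t := 2) (by norm_num)
  obtain ⟨C₂, c, hc, hC₂⟩ := hw.exists_tail_le_section hp hn hs'
  obtain ⟨s, hs₀⟩ : ∃ s, s = 1 / α - 1 / p - (q⁻¹).toReal := ⟨_, rfl⟩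
  rw [← hs₀] at hs hs' hC₂
  -- One constant for both parts, so that they form a single series: the local part, with w(B)^s
  -- replaced by w(2B)^s through doubling, is the term k = 0, and the tail gives the terms k + 1.
  obtain ⟨b, hb⟩ : ∃ b : ℝ≥0, b = B * D ^ (-s) + C₁ * C₂ := ⟨_, rfl⟩
  have hc' : (c : ℝ≥0∞) < 1 := by exact_mod_cast hc
  have hsum : ∑' k : ℕ, (b : ℝ≥0∞) * (c : ℝ≥0∞) ^ k ≠ ∞ := by
    rw [ENNReal.tsum_mul_left, ENNReal.tsum_geometric]
    exact ENNReal.mul_ne_top ENNReal.coe_ne_top (ENNReal.inv_ne_top.2 (tsub_pos_of_lt hc').ne')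
  refine ⟨(∑' k : ℕ, (b : ℝ≥0∞) * (c : ℝ≥0∞) ^ k).toNNReal, fun f g hf hg => ?_⟩
  rw [ENNReal.coe_toNNReal hsum]
  refine iSup₂_le fun r hr => ?_
  change eLpNorm (amalgamSection p (1 / α - 1 / p - (q⁻¹).toReal) w g r) q (weightMeasure μ) ≤ _
  have hpt : ∀ y, amalgamSection p s w g r y ≤
      ∑' k : ℕ, (b * (c : ℝ≥0∞) ^ k) * amalgamSection p s w f (2 ^ (k + 1) * r) y := by
    intro y
    obtain ⟨V, hV⟩ : ∃ V, V = weightMeasure w (ball y r) := ⟨_, rfl⟩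
    obtain ⟨A, hA⟩ : ∃ A, A = ∫⁻ z in (ball y (2 * r))ᶜ,
      ENNReal.ofReal (1 / ‖z - y‖ ^ n) * ‖f z‖ₑ := ⟨_, rfl⟩
    have hV0 : V ≠ 0 := hV ▸ hC₀.pos_left y r hr
    have hVt : V ≠ ∞ := hV ▸ hC₀.finite_left y r
    have hloc := eLpNorm_indicator_localValue_le hC₁ hB hp hw.isWeight hg y hr
    rw [← hA, ← hV] at hloc
    have htail := hC₂ f hf y r hr
    rw [← hA, ← hV] at htail
    have hVs : V ^ s ≤ (D : ℝ≥0∞) ^ (-s) * weightMeasure w (ball y (2 * r)) ^ s :=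
      ENNReal.rpow_le_mul_rpow_of_nonpos hs hV0 hVt (hC₀.pos_left y _ (by positivity))
        (hC₀.finite_left y _) (hV ▸ hD y r hr)
    have hfirst : V ^ s * (B * eLpNorm ((ball y (2 * r)).indicator f) (ENNReal.ofReal p)
        (weightMeasure w)) ≤ B * (D : ℝ≥0∞) ^ (-s) * amalgamSection p s w f (2 * r) y := by
      rw [amalgamSection]
      calc _ ≤ ((D : ℝ≥0∞) ^ (-s) * weightMeasure w (ball y (2 * r)) ^ s) *
            (B * eLpNorm ((ball y (2 * r)).indicator f) (ENNReal.ofReal p) (weightMeasure w)) := by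
            gcongr
        _ = _ := by ring
    have hsecond : V ^ s * (C₁ * A * V ^ (1 / p)) = C₁ * (V ^ (s + 1 / p) * A) := by
      rw [ENNReal.rpow_add _ _ hV0 hVt]
      ring
    have hDs : ((D ^ (-s) : ℝ≥0) : ℝ≥0∞) = (D : ℝ≥0∞) ^ (-s) :=
      ENNReal.coe_rpow_of_nonneg _ (by linarith)
    rw [tsum_eq_zero_add' ENNReal.summable]
    calc amalgamSection p s w g r y
        ≤ V ^ s * (B * eLpNorm ((ball y (2 * r)).indicator f) (ENNReal.ofReal p)
          (weightMeasure w) + C₁ * A * V ^ (1 / p)) := by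
          rw [amalgamSection, ← hV]
          gcongr
      _ ≤ B * (D : ℝ≥0∞) ^ (-s) * amalgamSection p s w f (2 * r) y + C₁ * (C₂ *
          ∑' k : ℕ, (c : ℝ≥0∞) ^ (k + 2) * amalgamSection p s w f (2 ^ (k + 2) * r) y) := by
          rw [mul_add, hsecond]
          gcongr
      _ ≤ _ := by
          rw [← mul_assoc, ← ENNReal.tsum_mul_left]
          refine add_le_add ?_ (ENNReal.tsum_le_tsum fun k => ?_)
          · rw [pow_zero, mul_one, zero_add, pow_one, hb, ← hDs]
            push_cast
            gcongr
            exact le_self_add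
          · rw [← mul_assoc]
            refine mul_le_mul_left (mul_le_mul' ?_ ?_) _
            · rw [hb]
              push_cast
              exact le_add_self
            · exact pow_le_pow_right_of_le_one' hc'.le (by omega)
  rw [← hs₀]
  refine (eLpNorm_mono_enorm (g := fun y => ∑' k : ℕ, (b * (c : ℝ≥0∞) ^ k) *
    amalgamSection p s w f (2 ^ (k + 1) * r) y) fun y => ?_).trans ?_
  · rw [enorm_eq_self, enorm_eq_self]
    exact hpt y
  · refine eLpNorm_tsum_mul_le hq (fun k => measurable_amalgamSection (by linarith) hf _) _
      fun k => ?_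
    rw [hs₀]
    exact eLpNorm_amalgamSection_le (by positivity)

end IsThetaCZO

end

section

/-! ### Existence of the values on the amalgam space -/

variable {n : ℕ} {p s α : ℝ} {q : ℝ≥0∞} {w μ : RSpace n → ℝ} {f g : RSpace n → ℂ} {B : ℝ≥0}
  {T₂ : Lp ℂ 2 (volume : Measure (RSpace n)) →L[ℂ] Lp ℂ 2 (volume : Measure (RSpace n))}
  {θ : ℝ → ℝ} {T : 𝓢(RSpace n, ℂ) →ₗ[ℂ] 𝓢'(RSpace n, ℂ)} {K : RSpace n → RSpace n → ℂ}

theorem IsThetaKernel.aestronglyMeasurable_tail (hK : IsThetaKernel θ K)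
    (hf : AEStronglyMeasurable f volume) (y : RSpace n) (r : ℝ) :
    AEStronglyMeasurable (fun x => ∫ z in (ball y (2 * r))ᶜ, K x z * f z)
      (volume.restrict (ball y r)) := by
  obtain ⟨K', hK', hKK'⟩ := hK.exists_measurable
  have hm : StronglyMeasurable fun x : RSpace n =>
      ∫ z, K' (x, z) * hf.mk f z ∂(volume.restrict (ball y (2 * r))ᶜ) :=
    StronglyMeasurable.integral_prod_right'
      (f := fun z : RSpace n × RSpace n => K' z * hf.mk f z.2)
      (hK'.stronglyMeasurable.mul (hf.stronglyMeasurable_mk.comp_measurable measurable_snd))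
  refine ⟨_, hm, (ae_restrict_iff' measurableSet_ball).2 (Eventually.of_forall fun x hx => ?_)⟩
  refine integral_congr_ae ?_
  filter_upwards [ae_restrict_mem measurableSet_ball.compl, ae_restrict_of_ae hf.ae_eq_mk]
    with z hz hfz
  have hxz : x ≠ z := by
    rintro rfl
    exact hz (ball_subset_ball (by linarith [pos_of_mem_ball hx]) hx)
  rw [hKK' x z hxz, hfz]

theorem IsThetaKernel.integrableOn_tail (hK : IsThetaKernel θ K) (hθ : IsDiniModulus θ)
    (hn : 1 ≤ n) (hf : AEStronglyMeasurable f volume) {y : RSpace n} {r : ℝ}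
    (htail : ∫⁻ z in (ball y (2 * r))ᶜ, ENNReal.ofReal (1 / ‖z - y‖ ^ n) * ‖f z‖ₑ ≠ ∞)
    {x : RSpace n} (hx : x ∈ ball y r) :
    IntegrableOn (fun z => K x z * f z) (ball y (2 * r))ᶜ volume := by
  obtain ⟨CK, hCK0, hCK, -⟩ := hK.exists_bounds hθ
  obtain ⟨C, hC⟩ := IsThetaKernel.enorm_le_of_notMem ⟨CK, hCK0, hCK⟩
  refine ⟨((hK.aestronglyMeasurable hn x).mul hf).restrict, ?_⟩
  exact (enorm_setIntegral_kernel_le hC hx).trans_lt (ENNReal.mul_lt_top ENNReal.coe_lt_top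
    htail.lt_top)

/-- Values computed from two concentric or nested balls agree. -/
theorem IsThetaCZO.localValue_eq (hT : IsThetaCZO θ T T₂ K) (hθ : IsDiniModulus θ) (hn : 1 ≤ n)
    (hB : IsWeightedBound T₂ p w B) (hp : 1 < p) (hw : IsMuckenhouptAp p w)
    (hf : AEStronglyMeasurable f volume) {y y' : RSpace n} {r R : ℝ} (hr : 0 < r)
    (htail : ∫⁻ z in (ball y (2 * r))ᶜ, ENNReal.ofReal (1 / ‖z - y‖ ^ n) * ‖f z‖ₑ ≠ ∞)
    (hsub : ball y (2 * r) ⊆ ball y' R) {g₁ g₂ : RSpace n → ℂ}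
    (H₁ : IsWeightedLpValue T₂ p w ((ball y (2 * r)).indicator f) g₁)
    (H₂ : IsWeightedLpValue T₂ p w ((ball y' R).indicator f) g₂) :
    ∀ᵐ x, x ∈ ball y r → g₁ x + ∫ z in (ball y (2 * r))ᶜ, K x z * f z =
      g₂ x + ∫ z in (ball y' R)ᶜ, K x z * f z := by
  have hdiff : (fun x => (-1) * (ball y (2 * r)).indicator f x + (ball y' R).indicator f x) =
      (ball y' R \ ball y (2 * r)).indicator f := by
    ext x
    by_cases h1 : x ∈ ball y (2 * r)
    · rw [indicator_of_mem h1, indicator_of_mem (hsub h1), indicator_of_notMem fun h => h.2 h1]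
      ring
    · by_cases h2 : x ∈ ball y' R
      · rw [indicator_of_notMem h1, indicator_of_mem h2, indicator_of_mem
          (show x ∈ ball y' R \ ball y (2 * r) from ⟨h2, h1⟩)]
        ring
      · rw [indicator_of_notMem h1, indicator_of_notMem h2, indicator_of_notMem fun h => h2 h.1]
        ring
  -- The two truncations of f differ by a function supported in the larger ball and vanishing on the
  -- smaller 2B; on B its value is a kernel integral, exactly the piece by which the two tails
  -- differ.
  have H := H₁.linear hp.le hw.isWeight H₂ (-1)
  rw [hdiff] at H
  obtain ⟨S, hS⟩ : ∃ S, ball y' R ⊆ ball 0 S := isBounded_ball.subset_ball 0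
  have key := hT.weightedValue_eq_integral hθ hn hB hp hw hr H
    (fun x hx => indicator_of_notMem (fun h => h.2 hx) f) (R := S)
    (fun x hx => indicator_of_notMem (fun h => hx (hS h.1)) f)
  filter_upwards [key] with x hx hxB
  have hint := hT.isThetaKernel.integrableOn_tail hθ hn hf htail hxB
  have hset : (ball y (2 * r))ᶜ = (ball y' R \ ball y (2 * r)) ∪ (ball y' R)ᶜ := by
    ext z
    refine ⟨fun hz => ?_, fun hz => hz.elim (fun h => h.2) fun h h' => h (hsub h')⟩
    by_cases h : z ∈ ball y' R
    · exact Or.inl ⟨h, hz⟩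
    · exact Or.inr h
  have hm : MeasurableSet (ball y' R \ ball y (2 * r)) := measurableSet_ball.diff measurableSet_ball
  have h1 : ∫ z, K x z * (ball y' R \ ball y (2 * r)).indicator f z =
      ∫ z in ball y' R \ ball y (2 * r), K x z * f z := by
    rw [← integral_indicator hm]
    congr 1
    ext z
    by_cases hz : z ∈ ball y' R \ ball y (2 * r)
    · rw [indicator_of_mem hz, indicator_of_mem hz]
    · rw [indicator_of_notMem hz, indicator_of_notMem hz, mul_zero]
  have h2 := (hx hxB).2
  rw [h1] at h2
  rw [hset] at hint ⊢
  have hdisj : Disjoint (ball y' R \ ball y (2 * r)) (ball y' R)ᶜ :=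
    Set.disjoint_left.2 fun z hz hz' => hz' hz.1
  rw [setIntegral_union hdisj measurableSet_ball.compl
    (hint.mono_set subset_union_left) (hint.mono_set subset_union_right), ← h2]
  ring

/-- Existence of the value of the operator. -/
theorem IsThetaCZO.exists_localValue (hT : IsThetaCZO θ T T₂ K) (hθ : IsDiniModulus θ)
    (hn : 1 ≤ n) (hB : IsWeightedBound T₂ p w B) (hp : 1 < p) (hw : IsMuckenhouptAp p w)
    (hf : AEStronglyMeasurable f volume)
    (hloc : ∀ y r, MemLp ((ball y r).indicator f) (ENNReal.ofReal p) (weightMeasure w))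
    (htail : ∀ (y : RSpace n) (r : ℝ), 0 < r →
      ∫⁻ z in (ball y (2 * r))ᶜ, ENNReal.ofReal (1 / ‖z - y‖ ^ n) * ‖f z‖ₑ ≠ ∞) :
    ∃ g : RSpace n → ℂ, AEStronglyMeasurable g volume ∧ IsLocalValue T₂ K p w f g := by
  have hex : ∀ (y : RSpace n) (r : ℝ), ∃ g₁,
      IsWeightedLpValue T₂ p w ((ball y r).indicator f) g₁ := fun y r =>
    hB.exists_value hw.isWeight hp.le (hloc y r)
  choose v hv using hex
  obtain ⟨ρ, hρ⟩ : ∃ ρ : ℕ → ℝ, ∀ N, ρ N = (N : ℝ) + 1 := ⟨fun N => N + 1, fun _ => rfl⟩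
  have hρ0 : ∀ N, 0 < ρ N := fun N => by rw [hρ]; positivity
  obtain ⟨G, hG⟩ : ∃ G : ℕ → RSpace n → ℂ, G = fun N x => v 0 (2 * ρ N) x +
    ∫ z in (ball 0 (2 * ρ N))ᶜ, K x z * f z := ⟨_, rfl⟩
  -- The candidates on the balls of radius N + 1 around 0 agree a.e. where both apply; at x the
  -- smallest such ball containing x is used.
  obtain ⟨g, hg⟩ : ∃ g : RSpace n → ℂ, g = fun x => G ⌊‖x‖⌋₊ x := ⟨_, rfl⟩
  have hGG : ∀ᵐ x, ∀ M N : ℕ, M ≤ N → x ∈ ball (0 : RSpace n) (ρ M) → G M x = G N x := by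
    rw [ae_all_iff]; intro M
    rw [ae_all_iff]; intro N
    by_cases hMN : M ≤ N
    · have hρMN : ρ M ≤ ρ N := by
        simp only [hρ]
        gcongr
      filter_upwards [hT.localValue_eq hθ hn hB hp hw hf (hρ0 M) (htail 0 _ (hρ0 M))
        (ball_subset_ball (by linarith)) (hv 0 (2 * ρ M)) (hv 0 (2 * ρ N))] with x hx _ hxM
      rw [hG]
      exact hx hxM
    · exact Eventually.of_forall fun x h => absurd h hMN
  have hgG : ∀ᵐ x, ∀ N : ℕ, x ∈ ball (0 : RSpace n) (ρ N) → g x = G N x := by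
    filter_upwards [hGG] with x hx N hxN
    rw [hg]
    have hxN' : ‖x‖ < N + 1 := by simpa [hρ] using hxN
    refine hx _ _ ?_ ?_
    · exact Nat.lt_succ_iff.1 ((Nat.floor_lt (norm_nonneg x)).2 (by exact_mod_cast hxN'))
    · simpa [hρ] using Nat.lt_floor_add_one ‖x‖
  have huniv : ⋃ N : ℕ, ball (0 : RSpace n) (ρ N) = univ := by
    refine eq_univ_of_forall fun x => mem_iUnion.2 ⟨⌊‖x‖⌋₊, ?_⟩
    simpa [hρ] using Nat.lt_floor_add_one ‖x‖
  refine ⟨g, ?_, ?_⟩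
  · rw [← Measure.restrict_univ (μ := volume), ← huniv, aestronglyMeasurable_iUnion_iff]
    intro N
    have hGm : AEStronglyMeasurable (G N) (volume.restrict (ball 0 (ρ N))) := by
      rw [hG]
      exact ((hv 0 (2 * ρ N)).memLp_right.1.mono_ac
        hw.isWeight.absolutelyContinuous_measure).restrict.add
        (hT.isThetaKernel.aestronglyMeasurable_tail hf 0 (ρ N))
    refine hGm.congr ((ae_restrict_iff' measurableSet_ball).2 ?_)
    filter_upwards [hgG] with x hx hxN using (hx N hxN).symm
  · intro y r hr
    refine ⟨v y (2 * r), hv y (2 * r), (ae_restrict_iff' measurableSet_ball).2 ?_⟩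
    obtain ⟨N, hN⟩ := exists_nat_ge (‖y‖ + 2 * r)
    have hNρ : ‖y‖ + 2 * r ≤ ρ N := by
      rw [hρ]
      exact hN.trans (by simp)
    have hsub : ball y (2 * r) ⊆ ball 0 (ρ N) := ball_subset_ball' (by
      rw [dist_zero_right]
      linarith)
    filter_upwards [hgG, hT.localValue_eq hθ hn hB hp hw hf hr (htail y r hr)
      (hsub.trans (ball_subset_ball (by linarith [hρ0 N]))) (hv y (2 * r)) (hv 0 (2 * ρ N))]
      with x hx hx' hxB
    refine ⟨hT.isThetaKernel.integrableOn_tail hθ hn hf (htail y r hr) hxB, ?_⟩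
    rw [hx N (hsub (ball_subset_ball (by linarith) hxB)), hG]
    exact (hx' hxB).symm

namespace IsLocalValue

theorem memLp_indicator (hT : IsThetaCZO θ T T₂ K) (hθ : IsDiniModulus θ)
    (hB : IsWeightedBound T₂ p w B) (hp : 1 < p) (hw : IsWeight w)
    (hgm : AEStronglyMeasurable g volume) (hg : IsLocalValue T₂ K p w f g) (y : RSpace n) {r : ℝ}
    (hr : 0 < r)
    (hloc : MemLp ((ball y (2 * r)).indicator f) (ENNReal.ofReal p) (weightMeasure w))
    (htail : ∫⁻ z in (ball y (2 * r))ᶜ, ENNReal.ofReal (1 / ‖z - y‖ ^ n) * ‖f z‖ₑ ≠ ∞) :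
    MemLp ((ball y r).indicator g) (ENNReal.ofReal p) (weightMeasure w) := by
  obtain ⟨CK, hCK0, hCK, -⟩ := hT.isThetaKernel.exists_bounds hθ
  obtain ⟨C, hC⟩ := IsThetaKernel.enorm_le_of_notMem ⟨CK, hCK0, hCK⟩
  refine ⟨(hgm.mono_ac (IsWeight.measure_absolutelyContinuous w)).indicator measurableSet_ball, ?_⟩
  refine (IsThetaCZO.eLpNorm_indicator_localValue_le hC hB hp hw hg y hr).trans_lt ?_
  refine ENNReal.add_lt_top.2 ⟨ENNReal.mul_lt_top ENNReal.coe_lt_top hloc.2,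
    ENNReal.mul_lt_top (ENNReal.mul_lt_top ENNReal.coe_lt_top htail.lt_top) ?_⟩
  exact ENNReal.rpow_lt_top_of_nonneg (by positivity) (hw.measure_ball_ne_top y r)

theorem unique (hB : IsWeightedBound T₂ p w B) (hp : 1 ≤ p) (hw : IsWeight w) {g' : RSpace n → ℂ}
    (hg : IsLocalValue T₂ K p w f g) (hg' : IsLocalValue T₂ K p w f g') : g =ᵐ[volume] g' := by
  have hN : ∀ N : ℕ, ∀ᵐ x, x ∈ ball (0 : RSpace n) (N + 1) → g x = g' x := by
    intro N
    obtain ⟨g₁, H₁, h₁⟩ := hg 0 (N + 1) (by positivity)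
    obtain ⟨g₂, H₂, h₂⟩ := hg' 0 (N + 1) (by positivity)
    filter_upwards [(ae_restrict_iff' measurableSet_ball).1 h₁,
      (ae_restrict_iff' measurableSet_ball).1 h₂, H₁.unique hB hp hw H₂] with x hx hx' he hxB
    rw [(hx hxB).2, (hx' hxB).2, he]
  filter_upwards [ae_all_iff.2 hN] with x hx
  refine hx ⌊‖x‖⌋₊ ?_
  simpa using Nat.lt_floor_add_one ‖x‖

theorem linear (hp : 1 ≤ p) (hw : IsWeight w) {f' g' : RSpace n → ℂ} (c : ℂ)
    (hg : IsLocalValue T₂ K p w f g) (hg' : IsLocalValue T₂ K p w f' g') :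
    IsLocalValue T₂ K p w (fun x => c * f x + f' x) (fun x => c * g x + g' x) := by
  intro y r hr
  obtain ⟨g₁, H₁, h₁⟩ := hg y r hr
  obtain ⟨g₂, H₂, h₂⟩ := hg' y r hr
  refine ⟨fun x => c * g₁ x + g₂ x, ?_, ?_⟩
  · have hind : ((ball y (2 * r)).indicator fun x => c * f x + f' x) =
        fun x => c * (ball y (2 * r)).indicator f x + (ball y (2 * r)).indicator f' x := by
      ext x
      by_cases hx : x ∈ ball y (2 * r)
      · simp only [indicator_of_mem hx]
      · simp only [indicator_of_notMem hx, mul_zero, add_zero]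
    rw [hind]
    exact H₁.linear hp hw H₂ c
  · filter_upwards [h₁, h₂] with x hx hx'
    have e : (fun z => K x z * (c * f z + f' z)) =
        fun z => c * (K x z * f z) + K x z * f' z := by
      ext z
      ring
    rw [e, integral_add (hx.1.const_mul c) hx'.1, integral_const_mul, hx.2, hx'.2]
    exact ⟨(hx.1.const_mul c).add hx'.1, by ring⟩

end IsLocalValue

/-- Split f at 2B: the inner part is square integrable with bounded support, where the L² and L^p(w)
values coincide; the outer part vanishes on 2B and is given on B by the kernel. -/
theorem IsThetaCZO.isLocalValue_l2Apply (hT : IsThetaCZO θ T T₂ K) (hθ : IsDiniModulus θ)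
    (hn : 1 ≤ n) (hB : IsWeightedBound T₂ p w B) (hp : 1 < p) (hw : IsWeight w)
    (hf : MemLp f 2 volume)
    (hloc : ∀ y r, MemLp ((ball y r).indicator f) (ENNReal.ofReal p) (weightMeasure w)) :
    IsLocalValue T₂ K p w f (l2Apply T₂ f) := by
  intro y r hr
  have h1 : MemLp ((ball y (2 * r)).indicator f) 2 volume := hf.indicator measurableSet_ball
  have h2 : MemLp ((ball y (2 * r))ᶜ.indicator f) 2 volume := hf.indicator measurableSet_ball.compl
  obtain ⟨R, hR⟩ : ∃ R, ball y (2 * r) ⊆ ball 0 R := isBounded_ball.subset_ball 0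
  refine ⟨l2Apply T₂ ((ball y (2 * r)).indicator f), hB.value_of_memLp_two hw hp.le (hloc _ _) h1
    (R := R) fun x hx => indicator_of_notMem (fun h => hx (hR h)) f,
    (ae_restrict_iff' measurableSet_ball).2 ?_⟩
  have hadd := l2Apply_add (T₂ := T₂) h1 h2
  rw [indicator_self_add_compl] at hadd
  filter_upwards [hadd, hT.l2Apply_eq_integral_ball hθ hn hr h2
    fun x hx => indicator_of_notMem (fun h : x ∈ (ball y (2 * r))ᶜ => h hx) f] with x hx hx' hxB
  have e : (fun z => K x z * (ball y (2 * r))ᶜ.indicator f z) =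
      (ball y (2 * r))ᶜ.indicator fun z => K x z * f z := by
    ext z
    by_cases hz : z ∈ (ball y (2 * r))ᶜ
    · rw [indicator_of_mem hz, indicator_of_mem hz]
    · rw [indicator_of_notMem hz, indicator_of_notMem hz, mul_zero]
  have h3 := hx' hxB
  rw [e, integrable_indicator_iff measurableSet_ball.compl,
    integral_indicator measurableSet_ball.compl] at h3
  refine ⟨h3.1, ?_⟩
  rw [hx, Pi.add_apply, h3.2]

end

/-- Boundedness of a `θ`-type Calderón–Zygmund operator on `(L^p, L^q)^α(w; μ)`: the operator is
defined on the whole space with a uniform norm bound, its value is unique up to null sets,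
it is linear, and it agrees with the given operator on `L²`. -/
theorem theorem2p1 (n : ℕ) (hn : 1 ≤ n) (p α : ℝ) (q : ℝ≥0∞)
    (hp : 1 < p) (hpα : p ≤ α) (hαq : ENNReal.ofReal α < q)
    (w μ : RSpace n → ℝ) (hw : IsMuckenhouptAp p w) (hμ : IsDoublingWeight μ)
    (θ : ℝ → ℝ) (hθ : IsDiniModulus θ)
    (T : 𝓢(RSpace n, ℂ) →ₗ[ℂ] 𝓢'(RSpace n, ℂ))
    (T₂ : Lp ℂ 2 (volume : Measure (RSpace n)) →L[ℂ] Lp ℂ 2 (volume : Measure (RSpace n)))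
    (K : RSpace n → RSpace n → ℂ) (hT : IsThetaCZO θ T T₂ K) :
    (∃ C : ℝ≥0, ∀ f : RSpace n → ℂ, MemAmalgam p α q w μ f →
      ∃ g : RSpace n → ℂ, IsLocalValue T₂ K p w f g ∧ MemAmalgam p α q w μ g ∧
        amalgamNorm p α q w μ g ≤ C * amalgamNorm p α q w μ f) ∧
    (∀ f g g' : RSpace n → ℂ, MemAmalgam p α q w μ f →
      IsLocalValue T₂ K p w f g → IsLocalValue T₂ K p w f g' → g =ᵐ[volume] g') ∧
    (∀ (f₁ f₂ g₁ g₂ : RSpace n → ℂ) (c : ℂ),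
      MemAmalgam p α q w μ f₁ → MemAmalgam p α q w μ f₂ →
      IsLocalValue T₂ K p w f₁ g₁ → IsLocalValue T₂ K p w f₂ g₂ →
      IsLocalValue T₂ K p w (fun x => c * f₁ x + f₂ x) (fun x => c * g₁ x + g₂ x)) ∧
    (∀ (f : RSpace n → ℂ) (hf : MemLp f 2 volume), MemAmalgam p α q w μ f →
      IsLocalValue T₂ K p w f (T₂ (hf.toLp f))) := by

  have hp0 : 0 < p := by linarith
  have hα0 : 0 < α := by linarith
  have hq1 : 1 < q := by
    refine lt_of_le_of_lt ?_ hαq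
    simpa using hp.le.trans hpα
  have hq0 : q ≠ 0 := (zero_lt_one.trans hq1).ne'
  -- The strict inequality α < q makes s + 1/p positive, hence the tail series geometric; q = ∞ is
  -- covered with 1/q = 0.
  have hqα : (q⁻¹).toReal < 1 / α := by
    have h1 : q⁻¹ < (ENNReal.ofReal α)⁻¹ := ENNReal.inv_lt_inv.2 hαq
    rw [← ENNReal.ofReal_inv_of_pos hα0] at h1
    rw [one_div, ← ENNReal.toReal_ofReal (inv_nonneg.2 hα0.le)]
    exact (ENNReal.toReal_lt_toReal (ENNReal.inv_ne_top.2 hq0) ENNReal.ofReal_ne_top).2 h1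
  have hs : 1 / α - 1 / p - (q⁻¹).toReal ≤ 0 := by
    have h1 : 1 / α ≤ 1 / p := one_div_le_one_div_of_le hp0 hpα
    have h2 : 0 ≤ (q⁻¹).toReal := ENNReal.toReal_nonneg
    linarith
  have hs' : 0 < 1 / α - 1 / p - (q⁻¹).toReal + 1 / p := by linarith
  obtain ⟨B, hB⟩ := hT.exists_eLpNorm_l2Apply_le hθ hn hp hw
  change IsWeightedBound T₂ p w B at hB
  have hwt := hw.isWeight
  have hloc : ∀ f, MemAmalgam p α q w μ f → ∀ y r,
      MemLp ((ball y r).indicator f) (ENNReal.ofReal p) (weightMeasure w) := fun f hf y r =>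
    hf.memLp_indicator hs hq0 hwt hμ.isWeight y r
  refine ⟨?_, fun f g g' _ hg hg' => hg.unique hB hp.le hwt hg',
    fun f₁ f₂ g₁ g₂ c _ _ h₁ h₂ => h₁.linear hp.le hwt c h₂, fun f hf hfa => ?_⟩
  · obtain ⟨C, hC⟩ := hT.exists_amalgamNorm_le (μ := μ) hθ hn hB hp hw hs hs' hq1
    refine ⟨C, fun f hf => ?_⟩
    have hfm := hf.locallyIntegrable.aestronglyMeasurable
    have htail := fun (y : RSpace n) (r : ℝ) (hr : 0 < r) =>
      hf.lintegral_tail_ne_top hs hs' hq0 hp hn hw hμ.isWeight y hr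
    obtain ⟨g, hgm, hg⟩ := hT.exists_localValue hθ hn hB hp hw hfm (hloc f hf) htail
    have hle := hC f g hfm hg
    refine ⟨g, hg, ⟨hw.locallyIntegrable_of_memLp hp fun r => ?_,
      hle.trans_lt (ENNReal.mul_lt_top ENNReal.coe_lt_top hf.norm_lt_top)⟩, hle⟩
    rcases le_or_gt r 0 with hr | hr
    · rw [ball_eq_empty.2 hr, indicator_empty]
      exact MemLp.zero'
    · exact hg.memLp_indicator hT hθ hB hp hwt hgm 0 hr (hloc f hf _ _) (htail 0 r hr)
  · rw [← l2Apply_of_memLp hf]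
    exact hT.isLocalValue_l2Apply hθ hn hB hp hwt hf (hloc f hfa)
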